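/- One unit of an infinitely divisible good is sold to a finite, linearly ordered set of bidders; bidder $j$ reports a valuation $v_j\ge 0$ per unit and a budget $B_j\ge 0$. The \emph{adaptive clinching auction} is the following process in time $t\ge 0$. Its state consists of the price $p(t)$ per unit and, for each bidder $j$, the effective budget $b_j(t)$, the quantity $x_j(t)$ allocated so far and the amount $P_j(t)$ charged so far; these are continuous in $t$, with $p(0)=x_j(0)=P_j(0)=0$ and $b_j(0)=B_j$. Put $S=1-\sum_j x_j$ and $D_j=b_j/p$ (with $D_j=\infty$ if $p=0<b_j$, and $D_j=0$ if $b_j=0$), and let $A=\{j: v_j>p,\ b_j>0\}$, $E=\{j: v_j=p,\ b_j>0\}$, $C=\{j\in A: S=\sum_{k\ne j}D_k\}$. The auction stops at the first time $f$ at which $\sum_{j\in A}D_j\le S$. At every time $t<f$ the right derivatives are as follows, all those not mentioned being $0$. If $E=\emptyset$: $p'=1$, and for $j\in C$, $b_j'=-S$, $P_j'=S$, $x_j'=S/p$. If $E\ne\emptyset$: $p'=0$; $b_j'=-1$ for the smallest $j\in E$; and for $j\in C$, $b_j'=-1$, $P_j'=1$, $x_j'=1/p$. At time $f$ nonnegative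 quantities are sold at unit price $p(f)$, the total $\sum_{j\in A}D_j$ to the bidders in $A$ and the total $S-\sum_{j\in A}D_j$ to the bidders in $E$, none of these bidders paying more than $b_j(f)$ for it; otherwise the split is arbitrary. Let $X_j$ and $P_j$ be the resulting total quantity and total payment of bidder $j$. A bidder $i$ with true valuation $\eta_i\ge 0$ and true budget $\beta_i\ge 0$ has utility $\eta_iX_i-P_i$ if $P_i\le\beta_i$, and $-\infty$ if $P_i>\beta_i$. \textbf{Theorem.} The adaptive clinching auction for one infinitely divisible good is budget monotone. That is, fix a bidder $i$ with true valuation $\eta_i\ge0$ and true budget $\beta_i\ge0$, and fix arbitrary reports $v_j,B_j\ge 0$ of the bidders $j\ne i$, at least one of whom has $v_j>0$ and $B_j>0$. Then, for all reports $v_i,B_i\ge 0$ of bidder $i$, the auction is well defined (the process above exists and stops at a finite time, and the final sale is possible), and, however the final sale is split: (1) for every reported budget $B_i\in[0,\beta_i]$, the utility of bidder $i$ when she reports $v_i=\eta_i$ is at least her utility when she reports any other $v_i\ge0$; (2) when she reports $v_i=\eta_i$, her utility is non-decreasing in her reported budget: if $0\le B_i^0\le B_i^1\le\beta_i$, then her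 utility with reported budget $B_i^0$ is at most her utility with reported budget $B_i^1$, the reports of the other bidders being the same. -/

import Mathlib

open scoped ENNReal

/-- The state of the auction at one instant: the current price per unit of the good and, for each
bidder, the effective budget, the quantity allocated so far and the amount charged so far. -/
structure AuctionState (ι : Type*) where
  price : ℝ
  budget : ι → ℝ
  alloc : ι → ℝ
  paid : ι → ℝ

namespace AuctionState

variable {ι : Type*} [Fintype ι] [LinearOrder ι]

/-- The supply `S = 1 - ∑ i, x i` that is left of one unit of an infinitely divisible good. -/
noncomputable def supply (s : AuctionState ι) : ℝ := 1 - ∑ i, s.alloc i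

/-- The demand `D i = b i / p`. It is infinite if the price is zero and the effective budget is
positive, and it is zero if the effective budget is zero. -/
noncomputable def demand (s : AuctionState ι) (i : ι) : ℝ≥0∞ :=
  ENNReal.ofReal (s.budget i) / ENNReal.ofReal s.price

open Classical in
/-- Active bidders, at reported valuations `v`. -/
noncomputable def active (v : ι → ℝ) (s : AuctionState ι) : Finset ι :=
  {i | s.price < v i ∧ 0 < s.budget i}

open Classical in
/-- Exiting bidders. -/
noncomputable def exiting (v : ι → ℝ) (s : AuctionState ι) : Finset ι :=
  {i | v i = s.price ∧ 0 < s.budget i}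

open Classical in
/-- Clinching bidders: the active bidders `i` for whom the supply equals the total demand of all
the other bidders. -/
noncomputable def clinching (v : ι → ℝ) (s : AuctionState ι) : Finset ι :=
  {i ∈ active v s | ENNReal.ofReal s.supply = ∑ j ∈ Finset.univ.erase i, s.demand j}

/-- The stopping condition: the total demand of the active bidders is at most the supply. -/
def Stops (v : ι → ℝ) (s : AuctionState ι) : Prop :=
  ∑ i ∈ active v s, s.demand i ≤ ENNReal.ofReal s.supply

open Classical in
/-- Rate of change of the price: the price stands still while there are exiting bidders. -/
noncomputable def priceRate (v : ι → ℝ) (s : AuctionState ι) : ℝ :=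
  if (exiting v s).Nonempty then 0 else 1

open Classical in
/-- Rate at which bidder `i` is charged. -/
noncomputable def paidRate (v : ι → ℝ) (s : AuctionState ι) (i : ι) : ℝ :=
  if i ∈ clinching v s then (if (exiting v s).Nonempty then 1 else s.supply) else 0

/-- Rate at which bidder `i` obtains the good, being charged the current price per unit. -/
noncomputable def allocRate (v : ι → ℝ) (s : AuctionState ι) (i : ι) : ℝ :=
  paidRate v s i / s.price

open Classical in
/-- Rate of change of the effective budget of bidder `i`: the first exiting bidder loses effective
budget at rate one (without being charged), and clinching bidders lose what they are charged. -/
noncomputable def budgetRate (v : ι → ℝ) (s : AuctionState ι) (i : ι) : ℝ :=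
  if IsLeast (exiting v s : Set ι) i then -1 else -paidRate v s i

end AuctionState

open AuctionState in
/-- A run of the adaptive clinching auction for one unit of an infinitely divisible good on the
reported valuations `v` and budgets `B`. Up to the stopping time the state follows the
differential process (all rates are right derivatives in time); at the stopping time there is a
one-shot allocation `lump` at the final price, of which the rules fix the total quantities and the
budget constraints. The values of `state` outside `[0, stopTime]` are irrelevant. -/
structure ClinchingRun {ι : Type*} [Fintype ι] [LinearOrder ι] (v B : ι → ℝ) where
  state : ℝ → AuctionState ι
  stopTime : ℝ
  lump : ι → ℝ
  stopTime_nonneg : 0 ≤ stopTime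
  price_zero : (state 0).price = 0
  budget_zero : ∀ i, (state 0).budget i = B i
  alloc_zero : ∀ i, (state 0).alloc i = 0
  paid_zero : ∀ i, (state 0).paid i = 0
  price_continuous : ContinuousOn (fun t => (state t).price) (Set.Icc 0 stopTime)
  budget_continuous : ∀ i, ContinuousOn (fun t => (state t).budget i) (Set.Icc 0 stopTime)
  alloc_continuous : ∀ i, ContinuousOn (fun t => (state t).alloc i) (Set.Icc 0 stopTime)
  paid_continuous : ∀ i, ContinuousOn (fun t => (state t).paid i) (Set.Icc 0 stopTime)
  not_stops : ∀ t ∈ Set.Ico 0 stopTime, ¬ Stops v (state t)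
  price_deriv : ∀ t ∈ Set.Ico 0 stopTime,
    HasDerivWithinAt (fun u => (state u).price) (priceRate v (state t)) (Set.Ici t) t
  budget_deriv : ∀ t ∈ Set.Ico 0 stopTime, ∀ i,
    HasDerivWithinAt (fun u => (state u).budget i) (budgetRate v (state t) i) (Set.Ici t) t
  alloc_deriv : ∀ t ∈ Set.Ico 0 stopTime, ∀ i,
    HasDerivWithinAt (fun u => (state u).alloc i) (allocRate v (state t) i) (Set.Ici t) t
  paid_deriv : ∀ t ∈ Set.Ico 0 stopTime, ∀ i,
    HasDerivWithinAt (fun u => (state u).paid i) (paidRate v (state t) i) (Set.Ici t) t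
  stops : Stops v (state stopTime)
  lump_nonneg : ∀ i, 0 ≤ lump i
  lump_eq_zero : ∀ i, i ∉ active v (state stopTime) → i ∉ exiting v (state stopTime) → lump i = 0
  lump_budget : ∀ i, i ∈ active v (state stopTime) ∨ i ∈ exiting v (state stopTime) →
    (state stopTime).price * lump i ≤ (state stopTime).budget i
  lump_active : ∑ i ∈ active v (state stopTime), lump i =
    (∑ i ∈ active v (state stopTime), (state stopTime).demand i).toReal
  lump_exiting : ∑ i ∈ exiting v (state stopTime), lump i =
    (state stopTime).supply - (∑ i ∈ active v (state stopTime), (state stopTime).demand i).toReal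

namespace ClinchingRun

variable {ι : Type*} [Fintype ι] [LinearOrder ι] {v B : ι → ℝ}

/-- The total quantity that bidder `i` obtains. -/
def quantity (r : ClinchingRun v B) (i : ι) : ℝ :=
  (r.state r.stopTime).alloc i + r.lump i

/-- The total price that bidder `i` pays. -/
def payment (r : ClinchingRun v B) (i : ι) : ℝ :=
  (r.state r.stopTime).paid i + (r.state r.stopTime).price * r.lump i

/-- The utility of bidder `i` if her true valuation is `η` and her true budget is `β`: it is `-∞`
if she pays more than her true budget. -/
noncomputable def utility (r : ClinchingRun v B) (i : ι) (η β : ℝ) : EReal :=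
  if r.payment i ≤ β then ((η * r.quantity i - r.payment i : ℝ) : EReal) else ⊥

end ClinchingRun

set_option linter.unusedSectionVars false

/-! Call the sum of all effective budgets minus price times supply the level. An active bidder
clinches exactly when her effective budget equals the level (`mem_clinching_iff_level`), and charges
cancel from its rate of change: it falls at rate S while the price rises and at rate one while
somebody exits (`hasRightDerivOn_level`). So an active bidder keeps her reported budget until the
level comes down to it and then follows the level: her effective budget is the minimum of the two
(`budget_eq_min`). One scalar governs all active bidders.

Read as functions of the price q, the level m and the surplus g = q x - P of bidder i with budget b
satisfy m' = -(∑ min(B_k, m) - m)/q and g' = x = (g + b - min(b, m))/q, the sum being over the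
bidders with valuation above q. At the valuation of other bidders m drops by their effective
budgets, cut off at zero, and g is continuous. `IsPriceTrace` records this; with m = 0 and g affine
it persists beyond the final price. The report v_i enters only as the price at which the trace ends.

If b₀ ≤ b₁, then m₁ - b₁ ≤ m₀ - b₀ at every price (`IsPriceTrace.compare`): equality holds near
price zero, jumps respect the inequality, and wherever it failed m₁ would exceed m₀, so that the
other bidders would pull m₁ down at least as fast. Hence the amount charged, max(0, b - m), and with
it g, is larger for the larger budget. The truthful utility is g(η), because η X = g(η) + P; this is
budget monotonicity. For b₀ = b₁ the comparison gives uniqueness of the trace. Reporting w then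
means holding X and P fixed from price w on instead of from η on, and since charges only grow with
the price, no w beats η (`IsPriceTrace.utility_le`).

Existence is by construction in stages: either the first exiting bidder is drained, or the price
rises to the next valuation while the level solves a scalar differential equation. Each stage lowers
a count of active and exiting bidders. -/

open Set Filter Topology in
/-- The continuous function `f` on `[a, b]` has the right derivative `f'` on `[a, b)`. -/
def HasRightDerivOn (f f' : ℝ → ℝ) (a b : ℝ) : Prop :=
  ContinuousOn f (Set.Icc a b) ∧ ∀ t ∈ Set.Ico a b, HasDerivWithinAt f (f' t) (Set.Ici t) t

/-! ### Calculus of right derivatives -/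

namespace HasRightDerivOn

open Set Filter Topology

variable {f f' g g' : ℝ → ℝ} {a b c d : ℝ}

theorem mono (h : HasRightDerivOn f f' a b) (hc : a ≤ c) (hd : d ≤ b) :
    HasRightDerivOn f f' c d :=
  ⟨h.1.mono (Icc_subset_Icc hc hd), fun t ht => h.2 t (Ico_subset_Ico hc hd ht)⟩

theorem congr_deriv (h : HasRightDerivOn f f' a b) (hg : ∀ t ∈ Ico a b, f' t = g' t) :
    HasRightDerivOn f g' a b :=
  ⟨h.1, fun t ht => hg t ht ▸ h.2 t ht⟩

theorem congr (h : HasRightDerivOn f f' a b) (hg : ∀ t ∈ Icc a b, g t = f t) :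
    HasRightDerivOn g f' a b := by
  refine ⟨h.1.congr hg, fun t ht => ?_⟩
  refine (h.2 t ht).congr_of_eventuallyEq ?_ (hg t ⟨ht.1, ht.2.le⟩)
  filter_upwards [Icc_mem_nhdsGE ht.2] with u hu
  exact hg u ⟨ht.1.trans hu.1, hu.2⟩

theorem of_hasDerivAt (h : ∀ t ∈ Icc a b, HasDerivAt f (f' t) t) : HasRightDerivOn f f' a b :=
  ⟨fun t ht => (h t ht).continuousAt.continuousWithinAt,
    fun t ht => (h t ⟨ht.1, ht.2.le⟩).hasDerivWithinAt⟩

theorem const (k : ℝ) : HasRightDerivOn (fun _ => k) (fun _ => 0) a b :=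
  of_hasDerivAt fun t _ => hasDerivAt_const t k

theorem add (hf : HasRightDerivOn f f' a b) (hg : HasRightDerivOn g g' a b) :
    HasRightDerivOn (fun t => f t + g t) (fun t => f' t + g' t) a b :=
  ⟨hf.1.add hg.1, fun t ht => (hf.2 t ht).add (hg.2 t ht)⟩

theorem sub (hf : HasRightDerivOn f f' a b) (hg : HasRightDerivOn g g' a b) :
    HasRightDerivOn (fun t => f t - g t) (fun t => f' t - g' t) a b :=
  ⟨hf.1.sub hg.1, fun t ht => (hf.2 t ht).sub (hg.2 t ht)⟩

theorem neg (hf : HasRightDerivOn f f' a b) :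
    HasRightDerivOn (fun t => -f t) (fun t => -f' t) a b :=
  ⟨hf.1.neg, fun t ht => (hf.2 t ht).neg⟩

theorem mul (hf : HasRightDerivOn f f' a b) (hg : HasRightDerivOn g g' a b) :
    HasRightDerivOn (fun t => f t * g t) (fun t => f' t * g t + f t * g' t) a b :=
  ⟨hf.1.mul hg.1, fun t ht => (hf.2 t ht).mul (hg.2 t ht)⟩

theorem sum {ι : Type*} {s : Finset ι} {f f' : ι → ℝ → ℝ}
    (h : ∀ i ∈ s, HasRightDerivOn (f i) (f' i) a b) :
    HasRightDerivOn (fun t => ∑ i ∈ s, f i t) (fun t => ∑ i ∈ s, f' i t) a b :=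
  ⟨continuousOn_finsetSum _ fun i hi => (h i hi).1,
    fun t ht => HasDerivWithinAt.fun_sum fun i hi => (h i hi).2 t ht⟩

theorem comp_add_const (h : HasRightDerivOn f f' a b) (k : ℝ) :
    HasRightDerivOn (fun t => f (t + k)) (fun t => f' (t + k)) (a - k) (b - k) := by
  constructor
  · exact h.1.comp (by fun_prop) fun t ht => ⟨by linarith [ht.1], by linarith [ht.2]⟩
  · intro t ht
    have h1 := h.2 (t + k) ⟨by linarith [ht.1], by linarith [ht.2]⟩
    have h2 := HasDerivWithinAt.comp t h1 ((hasDerivWithinAt_id t (Ici t)).add_const k)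
      (fun u hu => by simpa using hu)
    simpa [Function.comp_def] using h2

/-- A function that starts nonpositive and grows at most exponentially wherever it is positive
stays nonpositive. -/
theorem nonpos (h : HasRightDerivOn f f' a b) (ha : f a ≤ 0) (K : ℝ)
    (hK : ∀ t ∈ Ico a b, 0 < f t → f' t ≤ K * f t) : ∀ t ∈ Icc a b, f t ≤ 0 := by
  intro t ht
  -- The barrier ε exp((K + 1)(t - a)) grows strictly faster than `f` can at a contact point, where
  -- `f` is positive; the extra 1 in the exponent provides the strictness.
  have key : ∀ ε > 0, f t ≤ ε * Real.exp ((K + 1) * (t - a)) := by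
    intro ε hε
    have hB : ∀ x, HasDerivAt (fun x => ε * Real.exp ((K + 1) * (x - a)))
        ((K + 1) * (ε * Real.exp ((K + 1) * (x - a)))) x := by
      intro x
      have := ((((hasDerivAt_id x).sub_const a).const_mul (K + 1)).exp).const_mul ε
      refine this.congr_deriv ?_
      simp only [id]; ring
    refine image_le_of_deriv_right_lt_deriv_boundary h.1 h.2
      (B := fun x => ε * Real.exp ((K + 1) * (x - a))) ?_ hB ?_ ht
    · simp only [sub_self, mul_zero, Real.exp_zero, mul_one]; linarith
    · intro x hx hfx
      have hpos : 0 < f x := by rw [hfx]; positivity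
      have := hK x hx hpos
      rw [← hfx]; linarith
  by_contra hcon
  push Not at hcon
  have hE := Real.exp_pos ((K + 1) * (t - a))
  have := key (f t / (2 * Real.exp ((K + 1) * (t - a)))) (by positivity)
  have h2 : f t / (2 * Real.exp ((K + 1) * (t - a))) * Real.exp ((K + 1) * (t - a)) = f t / 2 := by
    field_simp
  linarith

theorem antitoneOn (h : HasRightDerivOn f f' a b) (h' : ∀ t ∈ Ico a b, f' t ≤ 0) :
    AntitoneOn f (Icc a b) := by
  intro x hx y hy hxy
  have h1 : HasRightDerivOn (fun t => f t - f x) (fun t => f' t - 0) x b :=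
    (h.mono hx.1 le_rfl).sub (const (f x))
  have := h1.nonpos (by simp) 0 (fun t ht _ => by
    simpa using h' t ⟨hx.1.trans ht.1, ht.2⟩) y ⟨hxy, hy.2⟩
  linarith

theorem monotoneOn (h : HasRightDerivOn f f' a b) (h' : ∀ t ∈ Ico a b, 0 ≤ f' t) :
    MonotoneOn f (Icc a b) := by
  intro x hx y hy hxy
  have := h.neg.antitoneOn (fun t ht => by simpa using h' t ht) hx hy hxy
  simpa using this

theorem eq_left (h : HasRightDerivOn f f' a b) (h' : ∀ t ∈ Ico a b, f' t = 0) :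
    ∀ t ∈ Icc a b, f t = f a := fun t ht => by
  have hab : a ≤ b := ht.1.trans ht.2
  exact le_antisymm
    (h.antitoneOn (fun t ht => (h' t ht).le) (left_mem_Icc.2 hab) ht ht.1)
    (h.monotoneOn (fun t ht => (h' t ht).ge) (left_mem_Icc.2 hab) ht ht.1)

/-- As `eq_left`, but the derivative has to vanish in the interior only. -/
theorem eq_left_of_Ioo (h : HasRightDerivOn f f' a b) (h' : ∀ t ∈ Ioo a b, f' t = 0) :
    ∀ t ∈ Icc a b, f t = f a := by
  intro t ht
  rcases ht.1.eq_or_lt with rfl | hat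
  · rfl
  have hev : ∀ s ∈ Ioo a t, f s = f t := fun s hs =>
    ((h.mono hs.1.le le_rfl).eq_left (fun u hu => h' u ⟨hs.1.trans_le hu.1, hu.2⟩) t
      ⟨hs.2.le, ht.2⟩).symm
  have hc : Tendsto f (𝓝[Ioo a t] a) (𝓝 (f a)) :=
    (h.1 a ⟨le_rfl, ht.1.trans ht.2⟩).mono_left
      (nhdsWithin_mono _ fun u hu => ⟨hu.1.le, hu.2.le.trans ht.2⟩)
  have : (𝓝[Ioo a t] a).NeBot := by
    rw [nhdsWithin_Ioo_eq_nhdsGT hat]; infer_instance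
  refine tendsto_nhds_unique (tendsto_const_nhds.congr' ?_) hc
  filter_upwards [self_mem_nhdsWithin] with s hs
  exact (hev s hs).symm

theorem deriv_unique {k l t : ℝ} (h : HasDerivWithinAt f k (Ici t) t)
    (h' : HasDerivWithinAt f l (Ici t) t) : k = l :=
  (uniqueDiffOn_Ici t t self_mem_Ici).eq_deriv _ h h'

/-- Concatenation of two functions in time. -/
theorem glue (hf : HasRightDerivOn f f' 0 a) (hg : HasRightDerivOn g g' 0 b) (ha : 0 ≤ a)
    (hfg : f a = g 0) :
    HasRightDerivOn (fun t => if t < a then f t else g (t - a))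
      (fun t => if t < a then f' t else g' (t - a)) 0 (a + b) := by
  have hg2 : HasRightDerivOn (fun t => g (t - a)) (fun t => g' (t - a)) a (a + b) := by
    have := hg.comp_add_const (-a)
    simpa [sub_eq_add_neg, add_comm] using this
  constructor
  · have h1 : ContinuousOn (fun t => if t < a then f t else g (t - a)) (Icc 0 a) := by
      refine hf.1.congr fun t ht => ?_
      rcases ht.2.eq_or_lt with h | h
      · subst h; simp [hfg]
      · simp [h]
    have h2 : ContinuousOn (fun t => if t < a then f t else g (t - a)) (Icc a (a + b)) := by
      refine hg2.1.congr fun t ht => ?_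
      simp [ht.1.not_gt]
    intro t ht
    by_cases hb : 0 ≤ b
    · have : Icc 0 (a + b) = Icc 0 a ∪ Icc a (a + b) := (Icc_union_Icc_eq_Icc ha (by linarith)).symm
      rw [this]
      exact (h1.union_of_isClosed h2 isClosed_Icc isClosed_Icc) t (this ▸ ht)
    · exact (h1.mono (Icc_subset_Icc le_rfl (by linarith))) t ht
  · intro t ht
    by_cases hta : t < a
    · simp only [hta, if_true]
      refine (hf.2 t ⟨ht.1, hta⟩).congr_of_eventuallyEq ?_ (by simp [hta])
      filter_upwards [nhdsWithin_le_nhds (Iio_mem_nhds hta)] with u hu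
      simp [mem_Iio.1 hu]
    · simp only [hta, if_false]
      refine (hg2.2 t ⟨not_lt.1 hta, ht.2⟩).congr_of_eventuallyEq ?_ (by simp [hta])
      filter_upwards [self_mem_nhdsWithin] with u hu
      have : ¬ u < a := not_lt.2 ((not_lt.1 hta).trans hu)
      simp [this]

end HasRightDerivOn

/-! ### The level, clinching and stopping in a single state -/

namespace AuctionState

variable {ι : Type*} [Fintype ι] [LinearOrder ι] {v : ι → ℝ} {s : AuctionState ι} {i j : ι}

/-- The amount by which the effective budgets of all bidders exceed the value of the supply at the
current price. An active bidder clinches if this is her effective budget. -/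
noncomputable def level (s : AuctionState ι) : ℝ := ∑ i, s.budget i - s.price * s.supply

@[simp] theorem mem_active : i ∈ active v s ↔ s.price < v i ∧ 0 < s.budget i := by
  simp [active]

@[simp] theorem mem_exiting : i ∈ exiting v s ↔ v i = s.price ∧ 0 < s.budget i := by
  simp [exiting]

theorem mem_clinching : i ∈ clinching v s ↔
    i ∈ active v s ∧ ENNReal.ofReal s.supply = ∑ j ∈ Finset.univ.erase i, s.demand j := by
  simp only [clinching, Finset.mem_filter]

theorem sum_demand (hp : 0 < s.price) (hb : ∀ i, 0 ≤ s.budget i) (t : Finset ι) :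
    ∑ i ∈ t, s.demand i = ENNReal.ofReal ((∑ i ∈ t, s.budget i) / s.price) := by
  simp only [demand, ← ENNReal.ofReal_div_of_pos hp]
  rw [← ENNReal.ofReal_sum_of_nonneg fun i _ => div_nonneg (hb i) hp.le, Finset.sum_div]

theorem demand_eq_top (hp : s.price = 0) (hb : 0 < s.budget i) : s.demand i = ⊤ := by
  simp [demand, hp, ENNReal.div_zero, hb]

theorem demand_eq_zero (hb : s.budget i ≤ 0) : s.demand i = 0 := by
  simp [demand, ENNReal.ofReal_of_nonpos hb]

/-- Multiply the clinching condition by the price and add the bidder's own budget to both sides. -/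
theorem mem_clinching_iff_level (hp : 0 < s.price) (hb : ∀ i, 0 ≤ s.budget i)
    (hS : 0 ≤ s.supply) :
    i ∈ clinching v s ↔ i ∈ active v s ∧ s.budget i = s.level := by
  classical
  rw [mem_clinching, sum_demand hp hb, ENNReal.ofReal_eq_ofReal_iff hS
    (div_nonneg (Finset.sum_nonneg fun i _ => hb i) hp.le), eq_div_iff hp.ne', level,
    ← Finset.add_sum_erase _ _ (Finset.mem_univ i)]
  refine and_congr_right fun _ => ?_
  constructor <;> intro h <;> linarith

/-- At price zero the total demand of the others is either infinite or zero, never one. -/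
theorem notMem_clinching_of_price_zero (hp : s.price = 0) (hS : s.supply = 1) :
    i ∉ clinching v s := by
  classical
  rw [mem_clinching]
  rintro ⟨-, h⟩
  rw [hS] at h
  by_cases hj : ∃ j ∈ Finset.univ.erase i, 0 < s.budget j
  · obtain ⟨j, hj, hb⟩ := hj
    have : ∑ j ∈ Finset.univ.erase i, s.demand j = ⊤ :=
      ENNReal.sum_eq_top.2 ⟨j, hj, demand_eq_top hp hb⟩
    rw [this] at h
    simp at h
  · push Not at hj
    rw [Finset.sum_eq_zero fun j hj' => demand_eq_zero (hj j hj')] at h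
    simp at h

theorem not_stops_of_price_zero (hp : s.price = 0) (hi : i ∈ active v s) : ¬ Stops v s := by
  intro h
  have : ∑ j ∈ active v s, s.demand j = ⊤ :=
    ENNReal.sum_eq_top.2 ⟨i, hi, demand_eq_top hp (mem_active.1 hi).2⟩
  rw [Stops, this] at h
  simp at h

theorem stops_iff (hp : 0 < s.price) (hb : ∀ i, 0 ≤ s.budget i) (hS : 0 ≤ s.supply) :
    Stops v s ↔ ∑ i ∈ active v s, s.budget i ≤ s.price * s.supply := by
  rw [Stops, sum_demand hp hb, ENNReal.ofReal_le_ofReal_iff hS, div_le_iff₀ hp, mul_comm]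

theorem paidRate_of_notMem (h : i ∉ clinching v s) : paidRate v s i = 0 := by
  simp [paidRate, h]

theorem paidRate_nonneg (hS : 0 ≤ s.supply) : 0 ≤ paidRate v s i := by
  unfold paidRate; split_ifs <;> positivity

theorem notMem_clinching_of_notMem_active (h : i ∉ active v s) : i ∉ clinching v s :=
  fun h' => h (mem_clinching.1 h').1

theorem notMem_active_of_mem_exiting (h : i ∈ exiting v s) : i ∉ active v s := by
  simp only [mem_exiting, mem_active] at *
  exact fun h' => h'.1.ne h.1.symm

theorem priceRate_of_nonempty (h : (exiting v s).Nonempty) : priceRate v s = 0 := by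
  simp [priceRate, h]

theorem priceRate_of_empty (h : ¬ (exiting v s).Nonempty) : priceRate v s = 1 := by
  simp [priceRate, h]

theorem budgetRate_of_notMem (h : i ∉ exiting v s) : budgetRate v s i = -paidRate v s i := by
  have : ¬ IsLeast (exiting v s : Set ι) i := fun h' => h h'.1
  simp [budgetRate, this]

theorem budgetRate_of_isLeast (h : IsLeast (exiting v s : Set ι) i) : budgetRate v s i = -1 := by
  simp [budgetRate, h]

theorem budgetRate_nonpos (hS : 0 ≤ s.supply) : budgetRate v s i ≤ 0 := by
  unfold budgetRate
  split_ifs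
  · norm_num
  · linarith [paidRate_nonneg (v := v) (i := i) hS]

/-- Clinching only moves money from the budget to the charge; the one genuine loss is that of the
first exiting bidder, who is not active and so is not charged. -/
theorem budgetRate_add_paidRate :
    budgetRate v s i + paidRate v s i =
      open Classical in if IsLeast (exiting v s : Set ι) i then -1 else 0 := by
  classical
  by_cases h : IsLeast (exiting v s : Set ι) i
  · rw [budgetRate_of_isLeast h, paidRate_of_notMem (notMem_clinching_of_notMem_active
      (notMem_active_of_mem_exiting (by simpa using h.1)))]
    simp [h]
  · simp [budgetRate, h]

theorem sum_budgetRate_add_paidRate :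
    ∑ i, (budgetRate v s i + paidRate v s i) =
      open Classical in if (exiting v s).Nonempty then -1 else 0 := by
  classical
  simp only [budgetRate_add_paidRate]
  split_ifs with h
  · have hl := Finset.isLeast_min' _ h
    rw [Finset.sum_eq_single ((exiting v s).min' h)]
    · simp [hl]
    · intro k _ hk
      rw [if_neg fun hk' => hk (hk'.unique hl)]
    · simp
  · refine Finset.sum_eq_zero fun k _ => ?_
    rw [if_neg fun hk => h ⟨k, by simpa using hk.1⟩]

theorem mul_allocRate (hp : s.price ≠ 0) : s.price * allocRate v s i = paidRate v s i := by
  rw [allocRate]; field_simp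

end AuctionState

open Set in
theorem le_of_forall_mem_Ioo {f g : ℝ → ℝ} {a b : ℝ} (hf : ContinuousOn f (Icc a b))
    (hg : ContinuousOn g (Icc a b)) (hab : a < b) (h : ∀ t ∈ Ioo a b, f t ≤ g t) :
    ∀ t ∈ Icc a b, f t ≤ g t := fun t ht =>
  ContinuousWithinAt.closure_le (s := Ioo a b) (by rwa [closure_Ioo hab.ne])
    ((hf t ht).mono Ioo_subset_Icc_self) ((hg t ht).mono Ioo_subset_Icc_self) h

namespace AuctionState

variable {ι : Type*} [Fintype ι] [LinearOrder ι] {v : ι → ℝ} {s : AuctionState ι} {i j : ι}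

theorem sum_active_budget (hb : ∀ i, 0 ≤ s.budget i) :
    ∑ i ∈ active v s, s.budget i = ∑ i with s.price < v i, s.budget i := by
  refine Finset.sum_subset (fun i hi => by simp [(mem_active.1 hi).1]) fun i hi hi' => ?_
  simp only [Finset.mem_filter, Finset.mem_univ, true_and, mem_active, not_and, not_lt] at hi hi'
  exact le_antisymm (hi' hi) (hb i)

theorem sum_budget_split : ∑ i, s.budget i =
    ∑ i with s.price < v i, s.budget i + ∑ i with v i ≤ s.price, s.budget i := by
  rw [← Finset.sum_filter_add_sum_filter_not Finset.univ (fun i => s.price < v i)]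
  simp only [not_lt]

/-- Total budgets split into those of active bidders and those with valuation at most the price;
subtracting price times supply turns the stopping condition into a bound on the level. -/
theorem stops_iff_level (hp : 0 < s.price) (hb : ∀ i, 0 ≤ s.budget i) (hS : 0 ≤ s.supply) :
    Stops v s ↔ s.level ≤ ∑ i with v i ≤ s.price, s.budget i := by
  rw [stops_iff hp hb hS, sum_active_budget hb, level, sum_budget_split (v := v)]
  constructor <;> intro h <;> linarith

end AuctionState

/-! ### Invariants along a run -/

namespace ClinchingRun

open Set AuctionState

variable {ι : Type*} [Fintype ι] [LinearOrder ι] {v B : ι → ℝ} (r : ClinchingRun v B)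
  {s t : ℝ} {i j : ι}

theorem hasRightDerivOn_price : HasRightDerivOn (fun t => (r.state t).price)
    (fun t => priceRate v (r.state t)) 0 r.stopTime := ⟨r.price_continuous, r.price_deriv⟩

theorem hasRightDerivOn_budget (i : ι) : HasRightDerivOn (fun t => (r.state t).budget i)
    (fun t => budgetRate v (r.state t) i) 0 r.stopTime :=
  ⟨r.budget_continuous i, fun t ht => r.budget_deriv t ht i⟩

theorem hasRightDerivOn_alloc (i : ι) : HasRightDerivOn (fun t => (r.state t).alloc i)
    (fun t => allocRate v (r.state t) i) 0 r.stopTime :=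
  ⟨r.alloc_continuous i, fun t ht => r.alloc_deriv t ht i⟩

theorem hasRightDerivOn_paid (i : ι) : HasRightDerivOn (fun t => (r.state t).paid i)
    (fun t => paidRate v (r.state t) i) 0 r.stopTime :=
  ⟨r.paid_continuous i, fun t ht => r.paid_deriv t ht i⟩

theorem hasRightDerivOn_supply : HasRightDerivOn (fun t => (r.state t).supply)
    (fun t => -∑ i, allocRate v (r.state t) i) 0 r.stopTime := by
  have := (HasRightDerivOn.const (a := 0) (b := r.stopTime) 1).sub
    (HasRightDerivOn.sum fun i (_ : i ∈ Finset.univ) => r.hasRightDerivOn_alloc i)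
  simpa [supply] using this

theorem price_monotoneOn : MonotoneOn (fun t => (r.state t).price) (Icc 0 r.stopTime) :=
  r.hasRightDerivOn_price.monotoneOn fun t _ => by unfold priceRate; split_ifs <;> norm_num

theorem price_nonneg (ht : t ∈ Icc 0 r.stopTime) : 0 ≤ (r.state t).price := by
  have := r.price_monotoneOn (left_mem_Icc.2 r.stopTime_nonneg) ht ht.1
  simpa [r.price_zero] using this

theorem budget_nonneg (hB : ∀ i, 0 ≤ B i) (ht : t ∈ Icc 0 r.stopTime) (i : ι) :
    0 ≤ (r.state t).budget i := by
  have := (r.hasRightDerivOn_budget i).neg.nonpos (by simp [r.budget_zero, hB i]) 0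
    (fun t _ hpos => by
      have h0 : ¬ 0 < (r.state t).budget i := by linarith
      have h1 : i ∉ exiting v (r.state t) := by simp [h0]
      have h2 : i ∉ active v (r.state t) := by simp [h0]
      rw [budgetRate_of_notMem h1, paidRate_of_notMem (notMem_clinching_of_notMem_active h2)]
      simp) t ht
  linarith

/-- If the supply were negative, it could not decrease further: without exiting bidders the charging
rates have the sign of the supply, and with an exiting bidder nobody clinches. -/
theorem supply_nonneg (ht : t ∈ Icc 0 r.stopTime) : 0 ≤ (r.state t).supply := by
  have := r.hasRightDerivOn_supply.neg.nonpos (by simp [supply, r.alloc_zero]) 0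
    (fun t ht hpos => by
      have hS : (r.state t).supply < 0 := by linarith
      rw [zero_mul, neg_neg]
      refine Finset.sum_nonpos fun j _ => div_nonpos_of_nonpos_of_nonneg ?_
        (r.price_nonneg ⟨ht.1, ht.2.le⟩)
      by_cases hj : j ∈ clinching v (r.state t)
      · by_cases hE : (exiting v (r.state t)).Nonempty
        -- `ENNReal.ofReal` truncates the negative supply to zero, so clinching would force all
        -- other demands to vanish, but the exiting bidder has positive demand.
        · exfalso
          obtain ⟨e, he⟩ := hE
          have h1 := (mem_clinching.1 hj).2
          rw [ENNReal.ofReal_of_nonpos hS.le, eq_comm, Finset.sum_eq_zero_iff] at h1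
          have hej : e ≠ j := by
            rintro rfl
            exact notMem_active_of_mem_exiting he (mem_clinching.1 hj).1
          have h2 := h1 e (by simp [hej])
          rw [demand, ENNReal.div_eq_zero_iff] at h2
          rcases h2 with h2 | h2
          · exact absurd (mem_exiting.1 he).2 (by simpa using h2)
          · simp at h2
        · rw [paidRate, if_pos hj, if_neg hE]; exact hS.le
      · rw [paidRate_of_notMem hj]) t ht
  linarith

theorem supply_antitoneOn : AntitoneOn (fun t => (r.state t).supply) (Icc 0 r.stopTime) :=
  r.hasRightDerivOn_supply.antitoneOn fun t ht => by
    have : 0 ≤ ∑ i, allocRate v (r.state t) i := Finset.sum_nonneg fun i _ =>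
      div_nonneg (paidRate_nonneg (r.supply_nonneg ⟨ht.1, ht.2.le⟩))
        (r.price_nonneg ⟨ht.1, ht.2.le⟩)
    linarith

theorem budget_antitoneOn (i : ι) :
    AntitoneOn (fun t => (r.state t).budget i) (Icc 0 r.stopTime) :=
  (r.hasRightDerivOn_budget i).antitoneOn fun _ ht =>
    budgetRate_nonpos (r.supply_nonneg ⟨ht.1, ht.2.le⟩)

theorem budget_le (ht : t ∈ Icc 0 r.stopTime) (i : ι) : (r.state t).budget i ≤ B i := by
  have := r.budget_antitoneOn i (left_mem_Icc.2 r.stopTime_nonneg) ht ht.1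
  simpa [r.budget_zero] using this

theorem price_eq_zero_of_le (ht : t ∈ Icc 0 r.stopTime) (hp : (r.state t).price = 0)
    (hs : s ∈ Icc 0 t) : (r.state s).price = 0 := by
  have hs' : s ∈ Icc 0 r.stopTime := ⟨hs.1, hs.2.trans ht.2⟩
  exact le_antisymm (hp ▸ r.price_monotoneOn hs' ht hs.2) (r.price_nonneg hs')

theorem alloc_of_price_zero (ht : t ∈ Icc 0 r.stopTime) (hp : (r.state t).price = 0) (i : ι) :
    (r.state t).alloc i = 0 := by
  -- Division by zero makes `allocRate` vanish at price zero, whatever the charging rate.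
  have := ((r.hasRightDerivOn_alloc i).mono le_rfl ht.2).eq_left (fun s hs => by
    simp [allocRate, r.price_eq_zero_of_le ht hp ⟨hs.1, hs.2.le⟩]) t ⟨ht.1, le_rfl⟩
  simpa [r.alloc_zero] using this

theorem supply_of_price_zero (ht : t ∈ Icc 0 r.stopTime) (hp : (r.state t).price = 0) :
    (r.state t).supply = 1 := by
  simp [supply, r.alloc_of_price_zero ht hp]

theorem paidRate_of_price_zero (ht : t ∈ Icc 0 r.stopTime) (hp : (r.state t).price = 0) (i : ι) :
    paidRate v (r.state t) i = 0 :=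
  paidRate_of_notMem (notMem_clinching_of_price_zero hp (r.supply_of_price_zero ht hp))

theorem budget_of_price_zero (ht : t ∈ Icc 0 r.stopTime) (hp : (r.state t).price = 0)
    (hi : 0 < v i) : (r.state t).budget i = B i := by
  have := ((r.hasRightDerivOn_budget i).mono le_rfl ht.2).eq_left (fun s hs => by
    have hp0 := r.price_eq_zero_of_le ht hp ⟨hs.1, hs.2.le⟩
    rw [budgetRate_of_notMem (by simp [hp0, hi.ne']),
      r.paidRate_of_price_zero ⟨hs.1, hs.2.le.trans ht.2⟩ hp0, neg_zero]) t ⟨ht.1, le_rfl⟩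
  rw [this, r.budget_zero]

theorem price_stopTime_pos (h : ∃ k, 0 < v k ∧ 0 < B k) : 0 < (r.state r.stopTime).price := by
  have hf := right_mem_Icc.2 r.stopTime_nonneg
  refine (r.price_nonneg hf).lt_of_ne' fun hp => ?_
  obtain ⟨k, hv, hB⟩ := h
  exact not_stops_of_price_zero hp (mem_active.2 ⟨by rwa [hp],
    by rwa [r.budget_of_price_zero hf hp hv]⟩) r.stops

theorem stopTime_pos (h : ∃ k, 0 < v k ∧ 0 < B k) : 0 < r.stopTime :=
  r.stopTime_nonneg.lt_of_ne fun h0 => by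
    have := r.price_stopTime_pos h
    rw [← h0, r.price_zero] at this
    exact lt_irrefl _ this

open Classical in
-- The charges lower the sum of the budgets and, through the supply they buy at the current price,
-- lower price times supply by the same amount. What remains is the loss of the exiting bidder, or
-- the price increase times the supply.
theorem hasRightDerivOn_level : HasRightDerivOn (fun t => (r.state t).level)
    (fun t => -(if (exiting v (r.state t)).Nonempty then 1 else (r.state t).supply))
    0 r.stopTime := by
  have h := (HasRightDerivOn.sum fun i (_ : i ∈ Finset.univ) => r.hasRightDerivOn_budget i).sub
    (r.hasRightDerivOn_price.mul r.hasRightDerivOn_supply)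
  refine HasRightDerivOn.congr_deriv h fun t ht => ?_
  have ht' : t ∈ Icc 0 r.stopTime := ⟨ht.1, ht.2.le⟩
  have h1 : (r.state t).price * ∑ i, allocRate v (r.state t) i =
      ∑ i, paidRate v (r.state t) i := by
    rw [Finset.mul_sum]
    refine Finset.sum_congr rfl fun i _ => ?_
    by_cases hp : (r.state t).price = 0
    · rw [hp, zero_mul, r.paidRate_of_price_zero ht' hp]
    · exact mul_allocRate hp
  have h2 := sum_budgetRate_add_paidRate (v := v) (s := r.state t)
  rw [Finset.sum_add_distrib] at h2
  rw [mul_neg, h1]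
  simp only [priceRate]
  split_ifs with hE
  · rw [if_pos hE] at h2; linarith
  · rw [if_neg hE] at h2; linarith

theorem level_antitoneOn : AntitoneOn (fun t => (r.state t).level) (Icc 0 r.stopTime) :=
  r.hasRightDerivOn_level.antitoneOn fun t ht => by
    have := r.supply_nonneg ⟨ht.1, ht.2.le⟩
    split_ifs <;> linarith

/-- This is the failure of the stopping condition in terms of the level. Price zero is treated
apart: there the level is the sum of all budgets, and a bidder with positive valuation still has her
whole budget. -/
theorem sum_budget_lt_level (hB : ∀ i, 0 ≤ B i) (h : ∃ k, 0 < v k ∧ 0 < B k)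
    (ht : t ∈ Ico 0 r.stopTime) :
    ∑ i with v i ≤ (r.state t).price, (r.state t).budget i < (r.state t).level := by
  have ht' : t ∈ Icc 0 r.stopTime := ⟨ht.1, ht.2.le⟩
  have hb := r.budget_nonneg hB ht'
  rcases (r.price_nonneg ht').eq_or_lt with hp | hp
  · rw [level, ← hp, zero_mul, sub_zero, sum_budget_split (v := v), ← hp]
    obtain ⟨k, hk, hBk⟩ := h
    have h1 := Finset.single_le_sum (f := (r.state t).budget) (fun i _ => hb i)
      (show k ∈ Finset.univ.filter (fun i => (0 : ℝ) < v i) by simpa using hk)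
    rw [r.budget_of_price_zero ht' hp.symm hk] at h1
    linarith
  · have := r.not_stops t ht
    rw [stops_iff_level hp hb (r.supply_nonneg ht')] at this
    exact not_le.1 this

theorem level_nonneg (hB : ∀ i, 0 ≤ B i) (h : ∃ k, 0 < v k ∧ 0 < B k)
    (ht : t ∈ Icc 0 r.stopTime) : 0 ≤ (r.state t).level :=
  le_of_forall_mem_Ioo continuousOn_const r.hasRightDerivOn_level.1 (r.stopTime_pos h)
    (fun _ hs => (Finset.sum_nonneg fun i _ => r.budget_nonneg hB ⟨hs.1.le, hs.2.le⟩ i).trans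
      (r.sum_budget_lt_level hB h ⟨hs.1.le, hs.2⟩).le) t ht

theorem level_pos (hB : ∀ i, 0 ≤ B i) (h : ∃ k, 0 < v k ∧ 0 < B k)
    (ht : t ∈ Ico 0 r.stopTime) : 0 < (r.state t).level :=
  (Finset.sum_nonneg fun i _ => r.budget_nonneg hB ⟨ht.1, ht.2.le⟩ i).trans_lt
      (r.sum_budget_lt_level hB h ht)

/-! ### Effective budgets as functions of the level -/

section Competition

variable (hB : ∀ i, 0 ≤ B i) (hc : ∀ j, ∃ k, k ≠ j ∧ 0 < v k ∧ 0 < B k)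
include hB hc

theorem exists_bidder_of_competition [Nonempty ι] : ∃ k, 0 < v k ∧ 0 < B k := by
  obtain ⟨k, -, hk⟩ := hc (Classical.arbitrary ι)
  exact ⟨k, hk⟩

/-- The untouched budget of a competitor is part of the level. This is where a second bidder is
needed: a lone bidder's budget exceeds the level as soon as the price is positive. -/
theorem budget_lt_level_of_price_zero (ht : t ∈ Icc 0 r.stopTime)
    (hp : (r.state t).price = 0) (j : ι) : (r.state t).budget j < (r.state t).level := by
  obtain ⟨k, hkj, hk, hBk⟩ := hc j
  have hb := r.budget_nonneg hB ht
  rw [level, hp, zero_mul, sub_zero, ← Finset.add_sum_erase _ _ (Finset.mem_univ j)]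
  have := Finset.single_le_sum (f := (r.state t).budget) (fun i _ => hb i)
      (show k ∈ Finset.univ.erase j by simp [hkj])
  rw [r.budget_of_price_zero ht hp hk] at this
  linarith

theorem mem_clinching_iff (ht : t ∈ Icc 0 r.stopTime) :
    j ∈ clinching v (r.state t) ↔
      j ∈ active v (r.state t) ∧ (r.state t).budget j = (r.state t).level := by
  rcases (r.price_nonneg ht).eq_or_lt with hp | hp
  · have h1 := r.budget_lt_level_of_price_zero hB hc ht hp.symm j
    have h2 := notMem_clinching_of_price_zero (v := v) (i := j) hp.symm
      (r.supply_of_price_zero ht hp.symm)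
    simp [h2, h1.ne]
  · exact mem_clinching_iff_level hp (r.budget_nonneg hB ht) (r.supply_nonneg ht)

/-- While the price has not exceeded the valuation of a bidder, her effective budget is at most the
level. -/
theorem budget_le_level (ht : t ∈ Icc 0 r.stopTime)
    (hj : ∀ s ∈ Ico 0 t, (r.state s).price < v j) :
    (r.state t).budget j ≤ (r.state t).level := by
  have hne : Nonempty ι := ⟨j⟩
  have hex := exists_bidder_of_competition hB hc
  by_contra! hcon
  have hbc := ((r.hasRightDerivOn_budget j).mono le_rfl ht.2).1
  have hlc := (r.hasRightDerivOn_level.mono le_rfl ht.2).1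
  have hcl := isClosed_Icc.isClosed_le hbc hlc
  have h0 : (0 : ℝ) ∈ {x ∈ Icc 0 t | (r.state x).budget j ≤ (r.state x).level} :=
    ⟨left_mem_Icc.2 ht.1, (r.budget_lt_level_of_price_zero hB hc
      (left_mem_Icc.2 r.stopTime_nonneg) r.price_zero j).le⟩
  -- The last time at which the budget does not exceed the level; after it the bidder is strictly
  -- above the level, does not clinch, and keeps her budget.
  obtain ⟨a, ⟨ha, hale⟩, hamax⟩ := (isCompact_Icc.of_isClosed_subset hcl
    (fun x hx => hx.1)).exists_isGreatest ⟨0, h0⟩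
  have hat : a < t := ha.2.lt_of_ne fun h => by subst h; linarith
  have ha' : a ∈ Icc 0 r.stopTime := ⟨ha.1, ha.2.trans ht.2⟩
  have hgt : ∀ s ∈ Ioc a t, (r.state s).level < (r.state s).budget j := fun s hs => by
    by_contra! hs'
    exact absurd (hamax ⟨⟨ha.1.trans hs.1.le, hs.2⟩, hs'⟩) (not_le.2 hs.1)
  have hnc : ∀ s ∈ Ico 0 t, j ∉ exiting v (r.state s) := fun s hs => by
    simp [(hj s hs).ne']
  have hbeq : (r.state a).budget j = (r.state a).level := by
    refine le_antisymm hale (le_of_forall_mem_Ioo (hlc.mono (Icc_subset_Icc ha.1 le_rfl))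
      (hbc.mono (Icc_subset_Icc ha.1 le_rfl)) hat (fun s hs => (hgt s ⟨hs.1, hs.2.le⟩).le) a
      ⟨le_rfl, hat.le⟩)
  have hconst : ∀ s ∈ Icc a t, (r.state s).budget j = (r.state a).budget j :=
    ((r.hasRightDerivOn_budget j).mono ha.1 ht.2).eq_left_of_Ioo fun s hs => by
      rw [budgetRate_of_notMem (hnc s ⟨ha.1.trans hs.1.le, hs.2⟩), paidRate_of_notMem, neg_zero]
      rw [r.mem_clinching_iff hB hc ⟨ha.1.trans hs.1.le, hs.2.le.trans ht.2⟩]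
      exact fun h => (hgt s ⟨hs.1, hs.2.le⟩).ne' h.2
  have hbpos : 0 < (r.state a).budget j := by
    rw [← hconst t ⟨hat.le, le_rfl⟩]
    exact (r.level_nonneg hB hex ht).trans_lt hcon
  have hcl : j ∈ clinching v (r.state a) := (r.mem_clinching_iff hB hc ha').2
    ⟨mem_active.2 ⟨hj a ⟨ha.1, hat⟩, hbpos⟩, hbeq⟩
  -- At `a` itself she does clinch, yet her budget has right derivative zero. So nobody is exiting
  -- and the supply is zero; then the level is the sum of all budgets and cannot be below hers.
  have hd0 : HasDerivWithinAt (fun u => (r.state u).budget j) 0 (Ici a) a := by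
    have : HasRightDerivOn (fun u => (r.state u).budget j) (fun _ => 0) a t :=
      (HasRightDerivOn.const ((r.state a).budget j)).congr hconst
    exact this.2 a ⟨le_rfl, hat⟩
  have hrate := HasRightDerivOn.deriv_unique
    (r.budget_deriv a ⟨ha.1, hat.trans_le ht.2⟩ j) hd0
  rw [budgetRate_of_notMem (hnc a ⟨ha.1, hat⟩), paidRate, if_pos hcl] at hrate
  split_ifs at hrate with hE
  · norm_num at hrate
  · have hS : (r.state a).supply = 0 := by linarith
    have hSt : (r.state t).supply = 0 :=
      le_antisymm (hS ▸ r.supply_antitoneOn ha' ht hat.le) (r.supply_nonneg ht)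
    have h1 : (r.state t).level = ∑ k, (r.state t).budget k := by simp [level, hSt]
    have h2 := Finset.single_le_sum (f := (r.state t).budget)
      (fun i _ => r.budget_nonneg hB ht i) (Finset.mem_univ j)
    linarith

/-- A budget that has met the level never falls strictly below it again: whenever the gap is
positive the bidder does not clinch while the level does not rise. A strict gap at `t` therefore
means that she has never clinched. -/
theorem budget_eq_of_lt_level (ht : t ∈ Icc 0 r.stopTime)
    (hj : ∀ s ∈ Ico 0 t, (r.state s).price < v j)
    (hlt : (r.state t).budget j < (r.state t).level) : (r.state t).budget j = B j := by
  have hlt' : ∀ a ∈ Icc 0 t, (r.state a).budget j < (r.state a).level := by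
    intro a ha
    by_contra! hcon
    have := ((r.hasRightDerivOn_level.mono ha.1 ht.2).sub
      ((r.hasRightDerivOn_budget j).mono ha.1 ht.2)).nonpos (by linarith) 0
      (fun s hs hpos => by
        have hs' : s ∈ Icc 0 r.stopTime := ⟨ha.1.trans hs.1, hs.2.le.trans ht.2⟩
        rw [budgetRate_of_notMem (by simp [(hj s ⟨ha.1.trans hs.1, hs.2⟩).ne']),
          paidRate_of_notMem fun h =>
            hpos.ne' (sub_eq_zero.2 ((r.mem_clinching_iff hB hc hs').1 h).2.symm)]
        have := r.supply_nonneg hs'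
        split_ifs <;> linarith) t ⟨ha.2, le_rfl⟩
    linarith
  have := ((r.hasRightDerivOn_budget j).mono le_rfl ht.2).eq_left (fun s hs => by
    rw [budgetRate_of_notMem (by simp [(hj s hs).ne']), paidRate_of_notMem fun h =>
      (hlt' s ⟨hs.1, hs.2.le⟩).ne
        ((r.mem_clinching_iff hB hc ⟨hs.1, hs.2.le.trans ht.2⟩).1 h).2, neg_zero])
    t ⟨ht.1, le_rfl⟩
  rw [this, r.budget_zero]

/-- This reduces the budgets to one number. The hypothesis constrains the price only before `t`, so
the formula still holds when the price has just reached the valuation. -/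
theorem budget_eq_min (ht : t ∈ Icc 0 r.stopTime)
    (hj : ∀ s ∈ Ico 0 t, (r.state s).price < v j) :
    (r.state t).budget j = min (B j) (r.state t).level := by
  rcases (r.budget_le_level hB hc ht hj).eq_or_lt with h | h
  · rw [min_eq_right (h ▸ r.budget_le ht j), h]
  · rw [← r.budget_eq_of_lt_level hB hc ht hj h, min_eq_left h.le]

end Competition

theorem paid_add_budget (ht : t ∈ Icc 0 r.stopTime)
    (hj : ∀ s ∈ Ico 0 t, (r.state s).price < v j) :
    (r.state t).paid j + (r.state t).budget j = B j := by
  have := (((r.hasRightDerivOn_paid j).add (r.hasRightDerivOn_budget j)).mono le_rfl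
    ht.2).eq_left (fun s hs => by
      rw [budgetRate_of_notMem (by simp [(hj s hs).ne'])]; ring) t ⟨ht.1, le_rfl⟩
  simpa [r.paid_zero, r.budget_zero] using this

end ClinchingRun

/-! ### Passing from time to price -/

theorem exists_isolating_radius {ι : Type*} [Finite ι] (v : ι → ℝ) (q : ℝ) :
    ∃ ε > 0, ∀ k, |v k - q| < ε → v k = q := by
  have hfin : (Set.range v \ {q}).Finite := (Set.finite_range v).subset Set.sdiff_subset
  have hmem : (Set.range v \ {q})ᶜ ∈ nhds q := hfin.isClosed.isOpen_compl.mem_nhds (by simp)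
  obtain ⟨ε, hε, hball⟩ := Metric.mem_nhds_iff.1 hmem
  refine ⟨ε, hε, fun k hk => ?_⟩
  by_contra hne
  exact hball (show v k ∈ Metric.ball q ε by rwa [Metric.mem_ball, Real.dist_eq])
    ⟨⟨k, rfl⟩, hne⟩

namespace ClinchingRun

open Set AuctionState

variable {ι : Type*} [Fintype ι] [LinearOrder ι] {v B : ι → ℝ} (r : ClinchingRun v B)
  {s t q : ℝ} {i j : ι}

theorem price_sub_le (hs : s ∈ Icc 0 r.stopTime) (ht : t ∈ Icc 0 r.stopTime) (hst : s ≤ t) :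
    (r.state t).price - (r.state s).price ≤ t - s := by
  have h1 : HasRightDerivOn (fun t : ℝ => t) (fun _ => 1) 0 r.stopTime :=
    HasRightDerivOn.of_hasDerivAt fun t _ => hasDerivAt_id t
  have := (r.hasRightDerivOn_price.sub h1).antitoneOn (fun t _ => by
    unfold priceRate; split_ifs <;> norm_num) hs ht hst
  simp only at this
  linarith

/-- While there are no exiting bidders, the price rises at unit rate. -/
theorem price_eq_add_of_exiting_empty (hs : 0 ≤ s) (ht : t ≤ r.stopTime)
    (hE : ∀ u ∈ Ioo s t, ¬ (exiting v (r.state u)).Nonempty) :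
    ∀ u ∈ Icc s t, (r.state u).price = (r.state s).price + (u - s) := by
  intro u hu
  have h1 : HasRightDerivOn (fun t : ℝ => t) (fun _ => 1) s t :=
    HasRightDerivOn.of_hasDerivAt fun t _ => hasDerivAt_id t
  have := ((r.hasRightDerivOn_price.mono hs ht).sub h1).eq_left_of_Ioo (fun u hu => by
    rw [priceRate_of_empty (hE u hu), sub_self]) u hu
  linarith

/-- Just after the last time at which the price is at most `q`, it rises at unit rate. -/
theorem exists_departure (hq : 0 ≤ q) (hqf : q < (r.state r.stopTime).price) :
    ∃ T ∈ Ico 0 r.stopTime, ∃ ε > 0, T + ε ≤ r.stopTime ∧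
      (∀ u ∈ Icc 0 r.stopTime, (r.state u).price ≤ q → u ≤ T) ∧
      (∀ u ∈ Icc T (T + ε), (r.state u).price = q + (u - T)) ∧
      (∀ u ∈ Ico T (T + ε), ¬ (exiting v (r.state u)).Nonempty) ∧
      ∀ k, v k ∉ Ioo q (q + ε) := by
  have hcl := isClosed_Icc.isClosed_le r.price_continuous
    (continuousOn_const (c := q))
  obtain ⟨T, ⟨hT, hTq⟩, hmax⟩ := (isCompact_Icc.of_isClosed_subset hcl
    (fun x hx => hx.1)).exists_isGreatest
      ⟨0, left_mem_Icc.2 r.stopTime_nonneg, by simpa [r.price_zero] using hq⟩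
  have hmax' : ∀ u ∈ Icc 0 r.stopTime, (r.state u).price ≤ q → u ≤ T :=
    fun u hu h => hmax ⟨hu, h⟩
  have hTf : T < r.stopTime := hT.2.lt_of_ne fun h => by subst h; linarith
  have hTq' : (r.state T).price = q := by
    obtain ⟨u, hu, huq⟩ := intermediate_value_Icc hT.2
      (r.price_continuous.mono (Icc_subset_Icc hT.1 le_rfl)) ⟨hTq, hqf.le⟩
    have h1 := hmax' u ⟨hT.1.trans hu.1, hu.2⟩ huq.le
    have : u = T := le_antisymm h1 hu.1
    rwa [← this]
  obtain ⟨ε₀, hε₀, hiso⟩ := exists_isolating_radius v q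
  obtain ⟨ε, hε, hεε₀, hεf⟩ : ∃ ε > 0, ε ≤ ε₀ ∧ T + ε ≤ r.stopTime :=
    ⟨min ε₀ (r.stopTime - T), lt_min hε₀ (by linarith), min_le_left _ _,
      by linarith [min_le_right ε₀ (r.stopTime - T)]⟩
  have hlev : ∀ k, v k ∉ Ioo q (q + ε) := fun k hk =>
    hk.1.ne' (hiso k (by rw [abs_lt]; constructor <;> linarith [hk.1, hk.2]))
  have hE : ∀ u ∈ Ioo T (T + ε), ¬ (exiting v (r.state u)).Nonempty := by
    rintro u hu ⟨k, hk⟩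
    have hu' : u ∈ Icc 0 r.stopTime := ⟨hT.1.trans hu.1.le, hu.2.le.trans hεf⟩
    have h1 : q < (r.state u).price := by
      by_contra! h
      exact absurd (hmax' u hu' h) (not_le.2 hu.1)
    have h2 := r.price_sub_le hT hu' hu.1.le
    exact hlev k ⟨by rw [(mem_exiting.1 hk).1]; exact h1,
      by rw [(mem_exiting.1 hk).1]; linarith [hu.2]⟩
  have hp := r.price_eq_add_of_exiting_empty hT.1 hεf hE
  rw [hTq'] at hp
  refine ⟨T, ⟨hT.1, hTf⟩, ε, hε, hεf, hmax', hp, fun u hu => ?_, hlev⟩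
  -- At `T` itself the price is not known to have passed q, but its right derivative is 1, which
  -- rules out exiting bidders.
  rcases hu.1.eq_or_lt with rfl | hTu
  · intro hne
    have h1 : HasRightDerivOn (fun u => (r.state u).price) (fun _ => 1) T (T + ε) := by
      have : HasRightDerivOn (fun u => q + (u - T)) (fun _ => 1) T (T + ε) :=
        HasRightDerivOn.of_hasDerivAt fun t _ => by
          simpa using ((hasDerivAt_id t).sub_const T).const_add q
      exact this.congr hp
    have := HasRightDerivOn.deriv_unique (r.price_deriv T ⟨hT.1, hTf⟩)
      (h1.2 T ⟨le_rfl, by linarith⟩)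
    rw [priceRate_of_nonempty hne] at this
    norm_num at this
  · exact hE u ⟨hTu, hu.2⟩

/-- The first time at which the price is at least `q`. -/
noncomputable def arrival (q : ℝ) : ℝ := sInf {t ∈ Icc 0 r.stopTime | q ≤ (r.state t).price}

theorem isLeast_arrival (hqf : q ≤ (r.state r.stopTime).price) :
    IsLeast {t ∈ Icc 0 r.stopTime | q ≤ (r.state t).price} (r.arrival q) := by
  have hcl := isClosed_Icc.isClosed_le (continuousOn_const (c := q)) r.price_continuous
  obtain ⟨a, ha⟩ := (isCompact_Icc.of_isClosed_subset hcl
    (fun x hx => hx.1)).exists_isLeast ⟨r.stopTime, right_mem_Icc.2 r.stopTime_nonneg, hqf⟩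
  rw [arrival, ha.csInf_eq]
  exact ha

theorem arrival_mem (hqf : q ≤ (r.state r.stopTime).price) : r.arrival q ∈ Icc 0 r.stopTime :=
  (r.isLeast_arrival hqf).1.1

theorem price_lt_of_lt_arrival (hqf : q ≤ (r.state r.stopTime).price)
    (ht : t ∈ Ico 0 (r.arrival q)) : (r.state t).price < q := by
  by_contra! h
  exact absurd ((r.isLeast_arrival hqf).2
    ⟨⟨ht.1, ht.2.le.trans (r.arrival_mem hqf).2⟩, h⟩) (not_le.2 ht.2)

theorem price_arrival (hq : 0 ≤ q) (hqf : q ≤ (r.state r.stopTime).price) :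
    (r.state (r.arrival q)).price = q := by
  have ha := r.arrival_mem hqf
  refine le_antisymm ?_ (r.isLeast_arrival hqf).1.2
  rcases ha.1.eq_or_lt with h | h
  · rw [← h, r.price_zero]; exact hq
  · exact le_of_forall_mem_Ioo (r.price_continuous.mono (Icc_subset_Icc le_rfl ha.2))
      continuousOn_const h
      (fun s hs => (r.price_lt_of_lt_arrival hqf ⟨hs.1.le, hs.2⟩).le) _ ⟨h.le, le_rfl⟩

theorem arrival_eq (ht : t ∈ Icc 0 r.stopTime) (hp : q ≤ (r.state t).price)
    (hlt : ∀ s ∈ Ico 0 t, (r.state s).price < q) : r.arrival q = t := by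
  have : IsLeast {t ∈ Icc 0 r.stopTime | q ≤ (r.state t).price} t :=
    ⟨⟨ht, hp⟩, fun s hs => by
      by_contra! hst
      exact absurd (hlt s ⟨hs.1.1, hst⟩) (not_lt.2 hs.2)⟩
  exact this.csInf_eq

/-- Just before the first time at which the price is `q`, it rises at unit rate. -/
theorem exists_approach (hq : 0 < q) (hqf : q ≤ (r.state r.stopTime).price) :
    ∃ ε > 0, ε ≤ r.arrival q ∧ ε ≤ q ∧
      (∀ u ∈ Ioc (q - ε) q, r.arrival u = r.arrival q - (q - u)) ∧
      ∀ k, v k ∉ Ioo (q - ε) q := by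
  have ha := r.arrival_mem hqf
  have hpa := r.price_arrival hq.le hqf
  obtain ⟨ε₀, hε₀, hiso⟩ := exists_isolating_radius v q
  have hapos : 0 < r.arrival q := ha.1.lt_of_ne fun h => by
    rw [← h, r.price_zero] at hpa; linarith
  obtain ⟨ε, hε, hεε₀, hεa, hεq⟩ : ∃ ε > 0, ε ≤ ε₀ ∧ ε ≤ r.arrival q ∧ ε ≤ q :=
    ⟨min ε₀ (min (r.arrival q) q), by positivity, min_le_left _ _,
      (min_le_right _ _).trans (min_le_left _ _), (min_le_right _ _).trans (min_le_right _ _)⟩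
  have hlev : ∀ k, v k ∉ Ioo (q - ε) q := fun k hk =>
    hk.2.ne (hiso k (by rw [abs_lt]; constructor <;> linarith [hk.1, hk.2]))
  have hE : ∀ u ∈ Ioo (r.arrival q - ε) (r.arrival q), ¬ (exiting v (r.state u)).Nonempty := by
    rintro u hu ⟨k, hk⟩
    have hu0 : 0 ≤ u := by linarith [hu.1]
    have h1 := r.price_lt_of_lt_arrival hqf ⟨hu0, hu.2⟩
    have h2 := r.price_sub_le ⟨hu0, hu.2.le.trans ha.2⟩ ha hu.2.le
    exact hlev k ⟨by rw [(mem_exiting.1 hk).1]; linarith [hu.1],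
      by rw [(mem_exiting.1 hk).1]; exact h1⟩
  have hp := r.price_eq_add_of_exiting_empty (by linarith) ha.2 hE
  have hp0 := hp _ (right_mem_Icc.2 (by linarith))
  refine ⟨ε, hε, hεa, hεq, fun u hu => r.arrival_eq ⟨by linarith [hu.1], by linarith [hu.2, ha.2]⟩
    ?_ ?_, hlev⟩
  · rw [hp _ ⟨by linarith [hu.1], by linarith [hu.2]⟩]; linarith
  · intro s hs
    rcases le_total s (r.arrival q - ε) with h | h
    · have := r.price_monotoneOn ⟨hs.1, by linarith [ha.2]⟩ ⟨by linarith, by linarith [ha.2]⟩ h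
      simp only at this
      linarith [hu.1]
    · rw [hp s ⟨h, by linarith [hs.2, hu.2]⟩]; linarith [hs.2]

theorem arrival_eq_of_departure {T ε : ℝ} (hT : T ∈ Ico 0 r.stopTime) (hTε : T + ε ≤ r.stopTime)
    (hp : ∀ u ∈ Icc T (T + ε), (r.state u).price = q + (u - T)) {u : ℝ} (hu : u ∈ Ioc q (q + ε)) :
    r.arrival u = T + (u - q) := by
  have hpT := hp T ⟨le_rfl, by linarith [hu.1, hu.2]⟩
  refine r.arrival_eq ⟨by linarith [hT.1, hu.1], by linarith [hu.2]⟩ ?_ ?_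
  · rw [hp _ ⟨by linarith [hu.1], by linarith [hu.2]⟩]; linarith
  · intro s hs
    rcases le_total s T with h | h
    · have := r.price_monotoneOn ⟨hs.1, h.trans hT.2.le⟩ ⟨hT.1, hT.2.le⟩ h
      simp only at this
      linarith [hu.1]
    · rw [hp s ⟨h, by linarith [hs.2, hu.2]⟩]; linarith [hs.2]

/-- A bidder has no effective budget left once the price has exceeded her valuation. -/
theorem budget_eq_zero_of_lt_price (hB : ∀ i, 0 ≤ B i) (hv : 0 ≤ v j)
    (ht : t ∈ Icc 0 r.stopTime) (hj : v j < (r.state t).price) : (r.state t).budget j = 0 := by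
  have htf : (r.state t).price ≤ (r.state r.stopTime).price :=
    r.price_monotoneOn ht (right_mem_Icc.2 r.stopTime_nonneg) ht.2
  obtain ⟨T, hT, ε, hε, -, hmax, hp, hE, -⟩ := r.exists_departure hv (hj.trans_le htf)
  have hTt : T ≤ t := by
    by_contra! h
    have := r.price_monotoneOn ht ⟨hT.1, hT.2.le⟩ h.le
    simp only at this
    rw [hp T ⟨le_rfl, by linarith⟩] at this
    linarith
  -- When the price departs from `v j` there are no exiting bidders, so `j` has nothing left.
  have h0 : (r.state T).budget j ≤ 0 := by
    by_contra! h
    exact hE T ⟨le_rfl, by linarith⟩ ⟨j, mem_exiting.2 ⟨by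
      rw [hp T ⟨le_rfl, by linarith⟩]; ring, h⟩⟩
  exact le_antisymm ((r.budget_antitoneOn j ⟨hT.1, hT.2.le⟩ ht hTt).trans h0)
    (r.budget_nonneg hB ht j)

/-- While the price stands still, there are exiting bidders. -/
theorem exiting_nonempty_of_price_eq (hs : s ∈ Icc 0 r.stopTime) (ht : t ∈ Icc 0 r.stopTime)
    (hst : s < t) (hp : (r.state s).price = (r.state t).price) :
    (exiting v (r.state s)).Nonempty := by
  by_contra hE
  have hconst : ∀ u ∈ Icc s t, (r.state u).price = (r.state s).price := fun u hu => by
    have hu' : u ∈ Icc 0 r.stopTime := ⟨hs.1.trans hu.1, hu.2.trans ht.2⟩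
    exact le_antisymm (hp ▸ r.price_monotoneOn hu' ht hu.2) (r.price_monotoneOn hs hu' hu.1)
  have h0 : HasRightDerivOn (fun u => (r.state u).price) (fun _ => 0) s t :=
    (HasRightDerivOn.const (r.state s).price).congr hconst
  have := HasRightDerivOn.deriv_unique (r.price_deriv s ⟨hs.1, hst.trans_le ht.2⟩)
    (h0.2 s ⟨le_rfl, hst⟩)
  rw [priceRate_of_empty hE] at this
  norm_num at this

/-- While the price stands still, the level falls by what the exiting bidders lose. -/
theorem level_sub_eq_of_price_eq (hs : s ∈ Icc 0 r.stopTime) (ht : t ∈ Icc 0 r.stopTime)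
    (hst : s ≤ t) (hps : (r.state s).price = q) (hpt : (r.state t).price = q) :
    (r.state t).level - ∑ k with v k = q, (r.state t).budget k =
      (r.state s).level - ∑ k with v k = q, (r.state s).budget k := by
  refine ((r.hasRightDerivOn_level.mono hs.1 ht.2).sub (HasRightDerivOn.sum fun k _ =>
    (r.hasRightDerivOn_budget k).mono hs.1 ht.2)).eq_left (fun u hu => ?_) t ⟨hst, le_rfl⟩
  have hu' : u ∈ Icc 0 r.stopTime := ⟨hs.1.trans hu.1, hu.2.le.trans ht.2⟩
  have hpu : (r.state u).price = q :=
    le_antisymm (hpt ▸ r.price_monotoneOn hu' ht hu.2.le) (hps ▸ r.price_monotoneOn hs hu' hu.1)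
  have hE := r.exiting_nonempty_of_price_eq hu' ht hu.2 (hpu.trans hpt.symm)
  -- While the price is q, bidders with valuation q are not charged, and all others lose exactly
  -- what they are charged; so both sums are the loss of the first exiting bidder.
  have h1 : ∑ k with v k = q, budgetRate v (r.state u) k =
      ∑ k, (budgetRate v (r.state u) k + paidRate v (r.state u) k) := by
    have h2 : ∑ k with v k = q, budgetRate v (r.state u) k =
        ∑ k with v k = q, (budgetRate v (r.state u) k + paidRate v (r.state u) k) := by
      refine Finset.sum_congr rfl fun k hk => ?_
      have hk' : v k = q := by simpa using hk
      rw [paidRate_of_notMem (notMem_clinching_of_notMem_active (by simp [hk', hpu])), add_zero]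
    rw [h2]
    refine Finset.sum_subset (Finset.subset_univ _) fun k _ hk => ?_
    have hk' : v k ≠ q := by simpa using hk
    rw [budgetRate_of_notMem (by simp [hpu, hk'])]
    ring
  rw [h1, sum_budgetRate_add_paidRate, if_pos hE, if_pos hE]
  ring

/-- The value of the allocation of a bidder at the current price, less what she has been charged. -/
noncomputable def surplus (r : ClinchingRun v B) (i : ι) (t : ℝ) : ℝ :=
  (r.state t).price * (r.state t).alloc i - (r.state t).paid i

/-- Purchases are made at the current price, so they cancel; only the revaluation of the holdings
remains. -/
theorem hasRightDerivOn_surplus (i : ι) : HasRightDerivOn (r.surplus i)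
    (fun t => priceRate v (r.state t) * (r.state t).alloc i) 0 r.stopTime := by
  refine ((r.hasRightDerivOn_price.mul (r.hasRightDerivOn_alloc i)).sub
    (r.hasRightDerivOn_paid i)).congr_deriv fun t ht => ?_
  by_cases hp : (r.state t).price = 0
  · rw [r.paidRate_of_price_zero ⟨ht.1, ht.2.le⟩ hp, hp]; ring
  · rw [mul_allocRate hp]; ring

theorem surplus_eq_of_price_eq (hs : s ∈ Icc 0 r.stopTime) (ht : t ∈ Icc 0 r.stopTime)
    (hst : s ≤ t) (hp : (r.state s).price = (r.state t).price) (i : ι) :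
    r.surplus i t = r.surplus i s := by
  refine ((r.hasRightDerivOn_surplus i).mono hs.1 ht.2).eq_left (fun u hu => ?_) t ⟨hst, le_rfl⟩
  have hu' : u ∈ Icc 0 r.stopTime := ⟨hs.1.trans hu.1, hu.2.le.trans ht.2⟩
  have hpu : (r.state u).price = (r.state t).price :=
    le_antisymm (r.price_monotoneOn hu' ht hu.2.le) (hp ▸ r.price_monotoneOn hs hu' hu.1)
  rw [priceRate_of_nonempty (r.exiting_nonempty_of_price_eq hu' ht hu.2 hpu), zero_mul]

end ClinchingRun

/-! ### The trace of a run over the price -/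

open Set Filter Topology in
/-- What a bidder `i` with budget `b` meets in the auction, as a function of the price, up to the
price `w` at which she leaves: the level `m`, and her surplus `g`, the integral of her allocation
over the price. -/
structure IsPriceTrace {ι : Type*} [Fintype ι] [DecidableEq ι] (v B : ι → ℝ) (i : ι) (b w : ℝ)
    (m g : ℝ → ℝ) : Prop where
  start : ∃ ε > 0, ∀ q ∈ Icc 0 ε, m q = b + ∑ k with k ≠ i ∧ 0 < v k, B k - q ∧ g q = 0
  nonneg : ∀ q, 0 ≤ m q
  antitoneOn : AntitoneOn m (Icc 0 w)
  flow : ∀ q ∈ Ioo 0 w, ∃ ε > 0,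
    HasRightDerivOn m (fun u => (m u - min b (m u) - ∑ k with k ≠ i ∧ q < v k, min (B k) (m u)) / u)
      q (q + ε) ∧
    HasRightDerivOn g (fun u => (g u + (b - min b (m u))) / u) q (q + ε)
  jump : ∀ q ∈ Ioc 0 w, ∃ L, 0 ≤ L ∧ Tendsto m (𝓝[<] q) (𝓝 L) ∧
    m q = max 0 (L - ∑ k with k ≠ i ∧ v k = q, min (B k) L)
  gain_left : ∀ q ∈ Ioc 0 w, Tendsto g (𝓝[<] q) (𝓝 (g q))

namespace ClinchingRun

open Set AuctionState Filter Topology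

variable {ι : Type*} [Fintype ι] [LinearOrder ι] {v B : ι → ℝ} (r : ClinchingRun v B)
  {s t q : ℝ} {i j : ι}

/-- The level as a function of the price, after the bidders other than `i` with this valuation have
left. -/
noncomputable def levelAt (i : ι) (q : ℝ) : ℝ :=
  if q ≤ (r.state r.stopTime).price then
    max 0 ((r.state (r.arrival q)).level -
      ∑ k with k ≠ i ∧ v k = q, (r.state (r.arrival q)).budget k)
  else 0

/-- The surplus of bidder `i` as a function of the price. -/
noncomputable def surplusAt (i : ι) (q : ℝ) : ℝ :=
  if q ≤ (r.state r.stopTime).price then r.surplus i (r.arrival q)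
  else r.surplus i r.stopTime + (q - (r.state r.stopTime).price) * r.quantity i

/-- Each active bidder can spend at most her budget, and together they spend the sum of their
budgets, so each spends all of it. -/
theorem lump_eq_of_mem_active (hB : ∀ i, 0 ≤ B i) (hp : 0 < (r.state r.stopTime).price)
    (hi : i ∈ active v (r.state r.stopTime)) :
    (r.state r.stopTime).price * r.lump i = (r.state r.stopTime).budget i := by
  have hf := right_mem_Icc.2 r.stopTime_nonneg
  have hb := r.budget_nonneg hB hf
  have h1 := r.lump_active
  rw [sum_demand hp hb, ENNReal.toReal_ofReal (div_nonneg (Finset.sum_nonneg fun i _ => hb i) hp.le),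
    eq_div_iff hp.ne', Finset.sum_mul] at h1
  have h2 := (Finset.sum_eq_sum_iff_of_le fun k hk => by
    have := r.lump_budget k (Or.inl hk); rwa [mul_comm] at this).1 h1 i hi
  rw [mul_comm, h2]

theorem lump_budget_le (hB : ∀ i, 0 ≤ B i) (i : ι) :
    (r.state r.stopTime).price * r.lump i ≤ (r.state r.stopTime).budget i := by
  by_cases h : i ∈ active v (r.state r.stopTime) ∨ i ∈ exiting v (r.state r.stopTime)
  · exact r.lump_budget i h
  · rw [not_or] at h
    rw [r.lump_eq_zero i h.1 h.2, mul_zero]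
    exact r.budget_nonneg hB (right_mem_Icc.2 r.stopTime_nonneg) i

section Competition

variable (hB : ∀ i, 0 ≤ B i) (hc : ∀ j, ∃ k, k ≠ j ∧ 0 < v k ∧ 0 < B k)
include hB hc

theorem level_stopTime_le (i : ι) (hv : ∀ i, 0 ≤ v i) :
    (r.state r.stopTime).level ≤
      ∑ k with v k = (r.state r.stopTime).price, (r.state r.stopTime).budget k := by
  have : Nonempty ι := ⟨i⟩
  have hf := right_mem_Icc.2 r.stopTime_nonneg
  have hp := r.price_stopTime_pos (exists_bidder_of_competition hB hc)
  refine ((stops_iff_level hp (r.budget_nonneg hB hf) (r.supply_nonneg hf)).1 r.stops).trans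
    (le_of_eq ?_)
  refine (Finset.sum_subset (fun k hk => ?_) fun k hk hk' => ?_).symm
  · simp only [Finset.mem_filter, Finset.mem_univ, true_and] at hk ⊢; exact hk.le
  · simp only [Finset.mem_filter, Finset.mem_univ, true_and] at hk hk'
    exact r.budget_eq_zero_of_lt_price hB (hv k) hf (hk.lt_of_ne hk')

/-- While the price stands still, the level minus the exiting budgets is constant, so the stopping
condition at the final price already holds on arrival there. -/
theorem arrival_stopTime (i : ι) (hv : ∀ i, 0 ≤ v i) :
    r.arrival (r.state r.stopTime).price = r.stopTime := by
  have : Nonempty ι := ⟨i⟩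
  have hf := right_mem_Icc.2 r.stopTime_nonneg
  have ha := r.arrival_mem le_rfl
  have hpa := r.price_arrival (r.price_nonneg hf) le_rfl
  by_contra hne
  have h1 := r.sum_budget_lt_level hB (exists_bidder_of_competition hB hc)
    ⟨ha.1, ha.2.lt_of_ne hne⟩
  have h2 := r.level_sub_eq_of_price_eq ha hf ha.2 hpa rfl
  have h3 := r.level_stopTime_le hB hc i hv
  have h4 : ∑ k with v k = (r.state r.stopTime).price,
      (r.state (r.arrival (r.state r.stopTime).price)).budget k ≤
      ∑ k with v k ≤ (r.state (r.arrival (r.state r.stopTime).price)).price,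
      (r.state (r.arrival (r.state r.stopTime).price)).budget k := by
    refine Finset.sum_le_sum_of_subset_of_nonneg (fun k hk => ?_)
      fun k _ _ => r.budget_nonneg hB ha k
    simp only [Finset.mem_filter, Finset.mem_univ, true_and] at hk ⊢
    rw [hk, hpa]
  linarith

/-- At the final price the budgets of the exiting bidders cover the level, so the cut-off in
`levelAt` gives zero there, in agreement with the value chosen beyond. -/
theorem levelAt_of_price_stopTime_le (hv : ∀ i, 0 ≤ v i)
    (hi : (r.state r.stopTime).price < v i) (hq : (r.state r.stopTime).price ≤ q) :
    r.levelAt i q = 0 := by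
  rw [levelAt]
  split_ifs with h
  · obtain rfl := le_antisymm h hq
    have h1 := r.level_stopTime_le hB hc i hv
    rw [r.arrival_stopTime hB hc i hv, max_eq_left]
    have : (Finset.univ.filter fun k => k ≠ i ∧ v k = (r.state r.stopTime).price) =
        Finset.univ.filter fun k => v k = (r.state r.stopTime).price := by
      refine Finset.filter_congr fun k _ => ⟨fun h => h.2, fun h => ⟨?_, h⟩⟩
      rintro rfl
      exact hi.ne' h
    rw [this]
    linarith
  · rfl

/-- Until the price reaches the valuation of bidder `i`, the process leaves each price with the
level and the surplus of the trace. -/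
theorem exists_departure_levelAt (hq : 0 ≤ q) (hqi : q < v i)
    (hqf : q < (r.state r.stopTime).price) :
    ∃ T ∈ Ico 0 r.stopTime, ∃ ε > 0, T + ε ≤ r.stopTime ∧ q + ε ≤ (r.state r.stopTime).price ∧
      q + ε ≤ v i ∧ r.arrival q ≤ T ∧
      (∀ u ∈ Icc T (T + ε), (r.state u).price = q + (u - T)) ∧
      (∀ u ∈ Ico T (T + ε), ¬ (exiting v (r.state u)).Nonempty) ∧
      (∀ k, v k ∉ Ioo q (q + ε)) ∧
      ∀ u ∈ Ico q (q + ε), r.levelAt i u = (r.state (u + (T - q))).level ∧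
        r.surplusAt i u = r.surplus i (u + (T - q)) := by
  have hne : Nonempty ι := ⟨i⟩
  have hex := exists_bidder_of_competition hB hc
  obtain ⟨T, hT, ε, hε, hTε, hmax, hp, hE, hlev⟩ := r.exists_departure hq hqf
  have hpε := hp (T + ε) ⟨by linarith, le_rfl⟩
  have hqε : q + ε ≤ (r.state r.stopTime).price := by
    have := r.price_monotoneOn ⟨by linarith [hT.1], hTε⟩ (right_mem_Icc.2 r.stopTime_nonneg) hTε
    simp only at this
    linarith
  have hpT := hp T ⟨le_rfl, by linarith⟩
  rw [sub_self, add_zero] at hpT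
  have ha := r.arrival_mem hqf.le
  have hpa := r.price_arrival hq hqf.le
  have haT : r.arrival q ≤ T := hmax _ ha hpa.le
  refine ⟨T, hT, ε, hε, hTε, hqε, ?_, haT, hp, hE, hlev, fun u hu => ?_⟩
  · by_contra! h
    exact hlev i ⟨hqi, h⟩
  have huf : u ≤ (r.state r.stopTime).price := hu.2.le.trans hqε
  rw [levelAt, if_pos huf, surplusAt, if_pos huf]
  rcases hu.1.eq_or_lt with rfl | hqu
  -- Between arrival at q and departure from it the exiting budgets are drained to zero, so the
  -- level on departure is the level on arrival minus those budgets. Bidder `i` is not among them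
  -- because q < v i.
  · have h1 := r.level_sub_eq_of_price_eq ha ⟨hT.1, hT.2.le⟩ haT hpa hpT
    have h2 : ∑ k with v k = q, (r.state T).budget k = 0 := by
      refine Finset.sum_eq_zero fun k hk => ?_
      have hk' : v k = q := by simpa using hk
      refine le_antisymm (not_lt.1 fun h => hE T ⟨le_rfl, by linarith⟩
        ⟨k, mem_exiting.2 ⟨hk'.trans hpT.symm, h⟩⟩) (r.budget_nonneg hB ⟨hT.1, hT.2.le⟩ k)
    have h3 : (Finset.univ.filter fun k => k ≠ i ∧ v k = q) =
        Finset.univ.filter fun k => v k = q := by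
      refine Finset.filter_congr fun k _ => ⟨fun h => h.2, fun h => ⟨?_, h⟩⟩
      rintro rfl
      exact hqi.ne' h
    have h4 := r.level_pos hB hex hT
    have h5 := r.surplus_eq_of_price_eq ha ⟨hT.1, hT.2.le⟩ haT (hpa.trans hpT.symm) i
    rw [h3, ← h1, h2, sub_zero, max_eq_right h4.le, ← h5]
    constructor <;> congr 1 <;> try congr 1
    all_goals ring_nf
  · have h1 := r.arrival_eq_of_departure hT hTε hp (u := u) ⟨hqu, hu.2.le⟩
    have h2 : (Finset.univ.filter fun k => k ≠ i ∧ v k = u) = ∅ :=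
      Finset.filter_eq_empty_iff.2 fun k _ h => hlev k ⟨h.2 ▸ hqu, h.2 ▸ hu.2⟩
    have h3 : r.arrival u = u + (T - q) := by rw [h1]; ring
    rw [h2, h3, Finset.sum_empty, sub_zero, max_eq_right]
    · exact ⟨rfl, rfl⟩
    · refine r.level_nonneg hB hex ⟨?_, ?_⟩ <;> linarith [hT.1, hu.2]

/-- What bidder `i` holds after the final sale if she was still active. -/
theorem payment_of_price_lt (hi : (r.state r.stopTime).price < v i) :
    r.payment i = B i ∧
      (r.state r.stopTime).price * r.quantity i = r.surplus i r.stopTime + B i := by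
  have hne : Nonempty ι := ⟨i⟩
  have hf := right_mem_Icc.2 r.stopTime_nonneg
  have hp := r.price_stopTime_pos (exists_bidder_of_competition hB hc)
  have h1 : (r.state r.stopTime).price * r.lump i = (r.state r.stopTime).budget i := by
    by_cases hA : i ∈ active v (r.state r.stopTime)
    · exact r.lump_eq_of_mem_active hB hp hA
    · have h0 : ¬ 0 < (r.state r.stopTime).budget i := fun h => hA (mem_active.2 ⟨hi, h⟩)
      rw [r.lump_eq_zero i hA (by simp [h0])]
      linarith [r.budget_nonneg hB hf i]
  have h2 := r.paid_add_budget (j := i) hf fun s hs =>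
    (r.price_monotoneOn ⟨hs.1, hs.2.le⟩ hf hs.2.le).trans_lt hi
  rw [payment, quantity, surplus, mul_add, h1]
  exact ⟨h2, by linarith⟩

end Competition

end ClinchingRun

namespace ClinchingRun

open Set AuctionState Filter Topology

variable {ι : Type*} [Fintype ι] [LinearOrder ι] {v B : ι → ℝ} (r : ClinchingRun v B)
  {s t q : ℝ} {i j : ι}

theorem tendsto_of_approach {f : ℝ → ℝ} {a ε : ℝ} (hf : ContinuousOn f (Icc 0 r.stopTime))
    (ha : a ∈ Icc 0 r.stopTime) (hε : 0 < ε) (hεa : ε ≤ a) :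
    Tendsto (fun u => f (a - (q - u))) (𝓝[<] q) (𝓝 (f a)) := by
  have h1 : ContinuousWithinAt (fun u => f (a - (q - u))) (Ioo (q - ε) q) q := by
    have h2 : ContinuousWithinAt f (Icc 0 r.stopTime) (a - (q - q)) := by
      simpa using hf a ha
    refine h2.comp (f := fun u => a - (q - u)) (by fun_prop) fun u hu => ?_
    exact ⟨by linarith [hu.1], by linarith [hu.2, ha.2]⟩
  have h3 := h1.tendsto
  rwa [nhdsWithin_Ioo_eq_nhdsLT (by linarith), sub_self, sub_zero] at h3

theorem alloc_eq_of_le_price (hs : s ∈ Icc 0 r.stopTime) (ht : t ∈ Icc 0 r.stopTime)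
    (hst : s ≤ t) (hi : v i ≤ (r.state s).price) :
    (r.state t).alloc i = (r.state s).alloc i ∧ (r.state t).paid i = (r.state s).paid i := by
  have h : ∀ u ∈ Ico s t, paidRate v (r.state u) i = 0 := fun u hu => by
    have := r.price_monotoneOn hs ⟨hs.1.trans hu.1, hu.2.le.trans ht.2⟩ hu.1
    simp only at this
    refine paidRate_of_notMem (notMem_clinching_of_notMem_active fun hA => ?_)
    linarith [(mem_active.1 hA).1]
  exact ⟨((r.hasRightDerivOn_alloc i).mono hs.1 ht.2).eq_left
    (fun u hu => by simp [allocRate, h u hu]) t ⟨hst, le_rfl⟩,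
    ((r.hasRightDerivOn_paid i).mono hs.1 ht.2).eq_left h t ⟨hst, le_rfl⟩⟩

theorem sum_budget_le_price (hB : ∀ i, 0 ≤ B i) (hv : ∀ i, 0 ≤ v i) (ht : t ∈ Icc 0 r.stopTime) :
    ∑ k with v k ≤ (r.state t).price, (r.state t).budget k =
      ∑ k with v k = (r.state t).price, (r.state t).budget k := by
  refine (Finset.sum_subset (fun k hk => ?_) fun k hk hk' => ?_).symm
  · simp only [Finset.mem_filter, Finset.mem_univ, true_and] at hk ⊢; exact hk.le
  · simp only [Finset.mem_filter, Finset.mem_univ, true_and] at hk hk'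
    exact r.budget_eq_zero_of_lt_price hB (hv k) ht (hk.lt_of_ne hk')

theorem sum_filter_ne_eq {f : ι → ℝ} {p : ι → Prop} [DecidablePred p] (hi : p i) :
    ∑ k with p k, f k = f i + ∑ k with k ≠ i ∧ p k, f k := by
  rw [← Finset.add_sum_erase _ _ (show i ∈ Finset.univ.filter p by simpa using hi)]
  congr 1
  refine Finset.sum_congr ?_ fun _ _ => rfl
  ext k; simp [and_comm]

section Competition

variable (hB : ∀ i, 0 ≤ B i) (hv : ∀ i, 0 ≤ v i) (hc : ∀ j, ∃ k, k ≠ j ∧ 0 < v k ∧ 0 < B k)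
include hB hv hc

theorem sum_budget_of_exiting_empty (ht : t ∈ Icc 0 r.stopTime)
    (hE : ¬ (exiting v (r.state t)).Nonempty) : ∑ k, (r.state t).budget k =
      ∑ k with (r.state t).price < v k, min (B k) (r.state t).level := by
  rw [sum_budget_split (v := v), r.sum_budget_le_price hB hv ht, Finset.sum_eq_zero
    (s := Finset.univ.filter fun k => v k = (r.state t).price), add_zero]
  · refine Finset.sum_congr rfl fun k hk => ?_
    simp only [Finset.mem_filter, Finset.mem_univ, true_and] at hk
    exact r.budget_eq_min hB hc ht fun s hs =>
      (r.price_monotoneOn ⟨hs.1, hs.2.le.trans ht.2⟩ ht hs.2.le).trans_lt hk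
  · intro k hk
    simp only [Finset.mem_filter, Finset.mem_univ, true_and] at hk
    exact le_antisymm (not_lt.1 fun h => hE ⟨k, mem_exiting.2 ⟨hk, h⟩⟩)
      (r.budget_nonneg hB ht k)

theorem levelAt_start (hi : 0 < v i) : ∃ ε > 0, ∀ q ∈ Icc 0 ε,
    r.levelAt i q = B i + ∑ k with k ≠ i ∧ 0 < v k, B k - q ∧ r.surplusAt i q = 0 := by
  have hne : Nonempty ι := ⟨i⟩
  have hpf := r.price_stopTime_pos (exists_bidder_of_competition hB hc)
  obtain ⟨T, hT, ε, hε, hTε, -, -, -, hp, hE, -, hlev⟩ :=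
    r.exists_departure_levelAt hB hc le_rfl hi hpf
  have hT' : T ∈ Icc 0 r.stopTime := ⟨hT.1, hT.2.le⟩
  have hpT : (r.state T).price = 0 := by simpa using hp T ⟨le_rfl, by linarith⟩
  -- On departure from price zero every budget is strictly below the level. By continuity the level
  -- stays above these values for a while, so nobody clinches at first.
  have hev : ∀ᶠ u in 𝓝[Ici T] T, ∀ j, (r.state T).budget j < (r.state u).level := by
    refine eventually_all.2 fun j => ?_
    have hcont := (r.hasRightDerivOn_level.2 T hT).continuousWithinAt
    exact hcont.eventually (lt_mem_nhds (r.budget_lt_level_of_price_zero hB hc hT' hpT j))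
  obtain ⟨T', hTT', hsub⟩ := mem_nhdsGE_iff_exists_Icc_subset.1 hev
  have hδ : 0 < min (ε / 2) (T' - T) := lt_min (by linarith) (sub_pos.2 hTT')
  refine ⟨min (ε / 2) (T' - T), hδ, fun q hq => ?_⟩
  have hq1 : q ≤ ε / 2 := hq.2.trans (min_le_left _ _)
  have hq2 : q ≤ T' - T := hq.2.trans (min_le_right _ _)
  obtain ⟨h1, h2⟩ := hlev q ⟨hq.1, by linarith⟩
  rw [sub_zero] at h1 h2
  have hqT : q + T ∈ Icc 0 r.stopTime := ⟨by linarith [hq.1, hT.1], by linarith⟩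
  have hclin : ∀ u ∈ Ico T (q + T), ∀ j, paidRate v (r.state u) j = 0 := by
    intro u hu j
    have hu' : u ∈ Icc 0 r.stopTime := ⟨hT.1.trans hu.1, hu.2.le.trans hqT.2⟩
    refine paidRate_of_notMem fun hj => ?_
    have h3 := ((r.mem_clinching_iff hB hc hu').1 hj).2
    have h4 : (r.state T).budget j < (r.state u).level := hsub ⟨hu.1, by linarith [hu.2]⟩ j
    have h5 := r.budget_antitoneOn j hT' hu' hu.1
    simp only at h5
    linarith
  have hTq : q + T ∈ Icc T (q + T) := ⟨by linarith [hq.1], le_rfl⟩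
  have hpaid0 : (r.state T).paid i = 0 := by
    have := ((r.hasRightDerivOn_paid i).mono le_rfl hT'.2).eq_left (fun u hu =>
      r.paidRate_of_price_zero ⟨hu.1, hu.2.le.trans hT'.2⟩
        (r.price_eq_zero_of_le hT' hpT ⟨hu.1, hu.2.le⟩) i) T ⟨hT.1, le_rfl⟩
    rw [this, r.paid_zero]
  have hpaid : (r.state (q + T)).paid i = 0 := by
    rw [((r.hasRightDerivOn_paid i).mono hT.1 hqT.2).eq_left (fun u hu => hclin u hu i) _ hTq,
      hpaid0]
  have halloc : ∀ j, (r.state (q + T)).alloc j = 0 := fun j => by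
    rw [((r.hasRightDerivOn_alloc j).mono hT.1 hqT.2).eq_left
      (fun u hu => by simp [allocRate, hclin u hu j]) _ hTq, r.alloc_of_price_zero hT' hpT]
  have hbudget : ∀ j, (r.state (q + T)).budget j = (r.state T).budget j := fun j =>
    ((r.hasRightDerivOn_budget j).mono hT.1 hqT.2).eq_left (fun u hu => by
      rw [budgetRate_of_notMem fun hj => hE u ⟨hu.1, by linarith [hu.2]⟩ ⟨j, hj⟩, hclin u hu j,
        neg_zero]) _ hTq
  have hprice : (r.state (q + T)).price = q := by
    rw [hp _ ⟨hTq.1, by linarith⟩]; ring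
  have hsum := r.sum_budget_of_exiting_empty hB hv hc hT' (hE T ⟨le_rfl, by linarith⟩)
  have hsum' : ∑ k, (r.state T).budget k = B i + ∑ k with k ≠ i ∧ 0 < v k, B k := by
    rw [hsum, hpT, sum_filter_ne_eq (i := i) hi]
    have hmin : ∀ k, 0 < v k → min (B k) (r.state T).level = B k := fun k hk => by
      rw [min_eq_left]
      rw [← r.budget_of_price_zero hT' hpT hk]
      exact (r.budget_lt_level_of_price_zero hB hc hT' hpT k).le
    rw [hmin i hi]
    congr 1
    exact Finset.sum_congr rfl fun k hk => hmin k (by simpa using (Finset.mem_filter.1 hk).2.2)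
  constructor
  · rw [h1, level, Finset.sum_congr rfl fun k _ => hbudget k, hsum', hprice]
    simp [supply, halloc]
  · rw [h2, surplus, hpaid, halloc]; ring

/-- Below the final price this is the rate of the level with the supply expressed through price
times supply = budgets minus level. From the final price on the level is zero, the quantity
constant, and the surplus affine; the equation for the surplus then says that her whole budget has
been spent. -/
theorem levelAt_flow (hq : q ∈ Ioo 0 (v i)) : ∃ ε > 0,
    HasRightDerivOn (r.levelAt i) (fun u => (r.levelAt i u - min (B i) (r.levelAt i u) -
      ∑ k with k ≠ i ∧ q < v k, min (B k) (r.levelAt i u)) / u) q (q + ε) ∧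
    HasRightDerivOn (r.surplusAt i)
      (fun u => (r.surplusAt i u + (B i - min (B i) (r.levelAt i u))) / u) q (q + ε) := by
  have hne : Nonempty ι := ⟨i⟩
  have hpf := r.price_stopTime_pos (exists_bidder_of_competition hB hc)
  rcases lt_or_ge q (r.state r.stopTime).price with hqf | hqf
  · obtain ⟨T, hT, ε, hε, hTε, hqε, hqi, -, hp, hE, hlev, hcongr⟩ :=
      r.exists_departure_levelAt hB hc hq.1.le hq.2 hqf
    refine ⟨ε / 2, by linarith, ?_, ?_⟩
    · have h1 := (r.hasRightDerivOn_level.mono hT.1 (show T + ε / 2 ≤ r.stopTime by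
        linarith)).comp_add_const (T - q)
      rw [show T - (T - q) = q by ring, show T + ε / 2 - (T - q) = q + ε / 2 by ring] at h1
      refine (h1.congr fun u hu => (hcongr u ⟨hu.1, by linarith [hu.2]⟩).1).congr_deriv
        fun u hu => ?_
      have huE := hE (u + (T - q)) ⟨by linarith [hu.1], by linarith [hu.2]⟩
      have hut : u + (T - q) ∈ Icc 0 r.stopTime :=
        ⟨by linarith [hu.1, hT.1], by linarith [hu.2]⟩
      have hpu : (r.state (u + (T - q))).price = u := by
        rw [hp _ ⟨by linarith [hu.1], by linarith [hu.2]⟩]; ring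
      have hsum := r.sum_budget_of_exiting_empty hB hv hc hut huE
      rw [hpu, sum_filter_ne_eq (i := i) (by linarith [hu.2])] at hsum
      have hset : (Finset.univ.filter fun k => k ≠ i ∧ u < v k) =
          Finset.univ.filter fun k => k ≠ i ∧ q < v k := by
        refine Finset.filter_congr fun k _ => and_congr_right fun _ =>
          ⟨fun h => hu.1.trans_lt h, fun h => ?_⟩
        by_contra! h'
        exact hlev k ⟨h, by linarith [hu.2]⟩
      rw [hset] at hsum
      rw [if_neg huE, (hcongr u ⟨hu.1, by linarith [hu.2]⟩).1,
        eq_div_iff (by linarith [hq.1, hu.1])]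
      have hl : (r.state (u + (T - q))).level = ∑ k, (r.state (u + (T - q))).budget k -
        u * (r.state (u + (T - q))).supply := by rw [level, hpu]
      rw [hsum] at hl
      linarith
    · have h1 := ((r.hasRightDerivOn_surplus i).mono hT.1 (show T + ε / 2 ≤ r.stopTime by
        linarith)).comp_add_const (T - q)
      rw [show T - (T - q) = q by ring, show T + ε / 2 - (T - q) = q + ε / 2 by ring] at h1
      refine (h1.congr fun u hu => (hcongr u ⟨hu.1, by linarith [hu.2]⟩).2).congr_deriv
        fun u hu => ?_
      have huE := hE (u + (T - q)) ⟨by linarith [hu.1], by linarith [hu.2]⟩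
      have hut : u + (T - q) ∈ Icc 0 r.stopTime :=
        ⟨by linarith [hu.1, hT.1], by linarith [hu.2]⟩
      have hpu : (r.state (u + (T - q))).price = u := by
        rw [hp _ ⟨by linarith [hu.1], by linarith [hu.2]⟩]; ring
      have hlt : ∀ s ∈ Ico 0 (u + (T - q)), (r.state s).price < v i := fun s hs => by
        have := r.price_monotoneOn ⟨hs.1, hs.2.le.trans hut.2⟩ hut hs.2.le
        simp only at this
        linarith [hu.2]
      have hpb := r.paid_add_budget hut hlt
      rw [r.budget_eq_min hB hc hut hlt] at hpb
      rw [priceRate_of_empty huE, (hcongr u ⟨hu.1, by linarith [hu.2]⟩).1,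
        (hcongr u ⟨hu.1, by linarith [hu.2]⟩).2, eq_div_iff (by linarith [hq.1, hu.1]),
        surplus, hpu]
      linarith
  · have hif := hqf.trans_lt hq.2
    obtain ⟨-, hX⟩ := r.payment_of_price_lt hB hc hif
    have h0 : ∀ u, q ≤ u → r.levelAt i u = 0 := fun u hu =>
      r.levelAt_of_price_stopTime_le hB hc hv hif (hqf.trans hu)
    have hs : ∀ u, q ≤ u → r.surplusAt i u = r.surplus i r.stopTime +
        (u - (r.state r.stopTime).price) * r.quantity i := fun u hu => by
      rw [surplusAt]
      split_ifs with h
      · obtain rfl := le_antisymm h (hqf.trans hu)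
        rw [r.arrival_stopTime hB hc i hv]; ring
      · rfl
    refine ⟨1, one_pos, ?_, ?_⟩
    · refine ((HasRightDerivOn.const 0).congr fun u hu => h0 u hu.1).congr_deriv fun u hu => ?_
      simp [h0 u hu.1, min_eq_right (hB _)]
    · have h2 : HasRightDerivOn (fun u => r.surplus i r.stopTime +
          (u - (r.state r.stopTime).price) * r.quantity i) (fun _ => r.quantity i) q (q + 1) :=
        HasRightDerivOn.of_hasDerivAt fun u _ => by
          simpa using (((hasDerivAt_id u).sub_const (r.state r.stopTime).price).mul_const
            (r.quantity i)).const_add (r.surplus i r.stopTime)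
      refine (h2.congr fun u hu => hs u hu.1).congr_deriv fun u hu => ?_
      rw [h0 u hu.1, hs u hu.1, min_eq_right (hB i), eq_div_iff (by linarith [hq.1, hu.1])]
      linarith

/-- The left limit is the level on arrival at q. Since the price was below q until then, the bidders
with valuation q still have the minimum of budget and level. -/
theorem levelAt_jump (hq : q ∈ Ioc 0 (v i)) :
    (∃ L, 0 ≤ L ∧ Tendsto (r.levelAt i) (𝓝[<] q) (𝓝 L) ∧
      r.levelAt i q = max 0 (L - ∑ k with k ≠ i ∧ v k = q, min (B k) L)) ∧
    Tendsto (r.surplusAt i) (𝓝[<] q) (𝓝 (r.surplusAt i q)) := by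
  have hne : Nonempty ι := ⟨i⟩
  have hex := exists_bidder_of_competition hB hc
  rcases le_or_gt q (r.state r.stopTime).price with hqf | hqf
  · obtain ⟨ε, hε, hεa, hεq, happ, hlev⟩ := r.exists_approach hq.1 hqf
    have ha := r.arrival_mem hqf
    have hev : ∀ᶠ u in 𝓝[<] q, u ∈ Ioo (q - ε) q := Ioo_mem_nhdsLT (by linarith)
    constructor
    · refine ⟨(r.state (r.arrival q)).level, r.level_nonneg hB hex ha,
        (r.tendsto_of_approach r.hasRightDerivOn_level.1 ha hε hεa).congr' ?_, ?_⟩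
      · filter_upwards [hev] with u hu
        have h2 : (Finset.univ.filter fun k => k ≠ i ∧ v k = u) = ∅ :=
          Finset.filter_eq_empty_iff.2 fun k _ h => hlev k (h.2.symm ▸ hu)
        rw [levelAt, if_pos (hu.2.le.trans hqf), h2, Finset.sum_empty, sub_zero,
          happ u ⟨hu.1, hu.2.le⟩, max_eq_right]
        exact r.level_nonneg hB hex ⟨by linarith [hu.1], by linarith [hu.2, ha.2]⟩
      · rw [levelAt, if_pos hqf]
        congr 2
        refine Finset.sum_congr rfl fun k hk => r.budget_eq_min hB hc ha fun s hs => ?_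
        rw [(Finset.mem_filter.1 hk).2.2]
        exact r.price_lt_of_lt_arrival hqf hs
    · rw [surplusAt, if_pos hqf]
      refine (r.tendsto_of_approach (r.hasRightDerivOn_surplus i).1 ha hε hεa).congr' ?_
      filter_upwards [hev] with u hu
      rw [surplusAt, if_pos (hu.2.le.trans hqf), happ u ⟨hu.1, hu.2.le⟩]
  · have hif := hqf.trans_le hq.2
    have hev : ∀ᶠ u in 𝓝[<] q, u ∈ Ioo (r.state r.stopTime).price q := Ioo_mem_nhdsLT hqf
    have h0 : ∀ u, (r.state r.stopTime).price ≤ u → r.levelAt i u = 0 := fun u hu =>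
      r.levelAt_of_price_stopTime_le hB hc hv hif hu
    constructor
    · refine ⟨0, le_rfl, tendsto_const_nhds.congr' ?_, ?_⟩
      · filter_upwards [hev] with u hu
        exact (h0 u hu.1.le).symm
      · simp [h0 q hqf.le, min_eq_right (hB _)]
    · rw [surplusAt, if_neg (not_le.2 hqf)]
      have hcont : Continuous fun u => r.surplus i r.stopTime +
          (u - (r.state r.stopTime).price) * r.quantity i := by fun_prop
      refine ((hcont.tendsto q).mono_left nhdsWithin_le_nhds).congr' ?_
      filter_upwards [hev] with u hu
      rw [surplusAt, if_neg (not_le.2 hu.1)]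

theorem levelAt_antitoneOn : AntitoneOn (r.levelAt i) (Icc 0 (v i)) := by
  intro q hq q' hq' hqq'
  have hne : Nonempty ι := ⟨i⟩
  have hex := exists_bidder_of_competition hB hc
  rcases hqq'.eq_or_lt with rfl | hlt
  · rfl
  have h0 : ∀ u, 0 ≤ r.levelAt i u := fun u => by
    unfold levelAt; split_ifs <;> simp
  rcases le_or_gt q' (r.state r.stopTime).price with hqf | hqf
  · obtain ⟨T, hT, ε, hε, hTε, -, -, -, hp, -, -, hcongr⟩ :=
      r.exists_departure_levelAt hB hc hq.1 (hlt.trans_le hq'.2) (hlt.trans_le hqf)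
    have ha := r.arrival_mem hqf
    have hT' : T ∈ Icc 0 r.stopTime := ⟨hT.1, hT.2.le⟩
    have hTa : T ≤ r.arrival q' := by
      by_contra! h
      have h1 := r.price_monotoneOn ha hT' h.le
      have h2 := hp T ⟨le_rfl, by linarith⟩
      simp only [r.price_arrival hq'.1 hqf] at h1
      linarith
    rw [(hcongr q ⟨le_rfl, by linarith⟩).1, show q + (T - q) = T by ring, levelAt, if_pos hqf]
    refine max_le (r.level_nonneg hB hex hT') ?_
    have h1 := r.level_antitoneOn hT' ha hTa
    have h2 : 0 ≤ ∑ k with k ≠ i ∧ v k = q', (r.state (r.arrival q')).budget k :=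
      Finset.sum_nonneg fun k _ => r.budget_nonneg hB ha k
    simp only at h1
    linarith
  · rw [levelAt, if_neg (not_le.2 hqf)]
    exact h0 q

theorem isPriceTrace (hi : 0 < v i) :
    IsPriceTrace v B i (B i) (v i) (r.levelAt i) (r.surplusAt i) where
  start := r.levelAt_start hB hv hc hi
  nonneg q := by unfold levelAt; split_ifs <;> simp
  antitoneOn := r.levelAt_antitoneOn hB hv hc
  flow _ hq := r.levelAt_flow hB hv hc hq
  jump _ hq := (r.levelAt_jump hB hv hc hq).1
  gain_left _ hq := (r.levelAt_jump hB hv hc hq).2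

/-- What bidder `i` pays and obtains in terms of her trace. -/
theorem outcome (hi : 0 < v i) :
    v i * r.quantity i = r.surplusAt i (v i) + r.payment i ∧
    min (B i) (r.levelAt i (v i)) ≤ B i - r.payment i ∧
    ∀ q ∈ Ico 0 (v i), B i - r.payment i ≤ min (B i) (r.levelAt i q) := by
  have hne : Nonempty ι := ⟨i⟩
  have hex := exists_bidder_of_competition hB hc
  have hpf := r.price_stopTime_pos hex
  have hf := right_mem_Icc.2 r.stopTime_nonneg
  rcases lt_or_ge (r.state r.stopTime).price (v i) with hqf | hqf
  · obtain ⟨hP, hX⟩ := r.payment_of_price_lt hB hc hqf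
    have h0 := r.levelAt_of_price_stopTime_le hB hc hv hqf hqf.le
    refine ⟨?_, ?_, fun q hq => ?_⟩
    · rw [surplusAt, if_neg (not_le.2 hqf), hP]; linarith
    · rw [h0, hP, min_eq_right (hB i), sub_self]
    · rw [hP, sub_self]
      refine le_min (hB i) ?_
      unfold levelAt; split_ifs <;> simp
  · have ha := r.arrival_mem hqf
    have hpa := r.price_arrival hi.le hqf
    have hlt : ∀ s ∈ Ico 0 (r.arrival (v i)), (r.state s).price < v i :=
      fun s hs => r.price_lt_of_lt_arrival hqf hs
    obtain ⟨hx, hP⟩ := r.alloc_eq_of_le_price ha hf ha.2 hpa.ge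
    have hpb := r.paid_add_budget ha hlt
    have hbm := r.budget_eq_min hB hc ha hlt
    have hl : r.lump i ≠ 0 → (r.state r.stopTime).price = v i ∧
        i ∈ exiting v (r.state r.stopTime) := fun hl => by
      have hA : i ∉ active v (r.state r.stopTime) := by simp [hqf]
      have hE : i ∈ exiting v (r.state r.stopTime) := by
        by_contra hE; exact hl (r.lump_eq_zero i hA hE)
      exact ⟨(mem_exiting.1 hE).1.symm, hE⟩
    have hpl : (r.state r.stopTime).price * r.lump i = v i * r.lump i := by
      by_cases h : r.lump i = 0
      · simp [h]
      · rw [(hl h).1]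
    have hl0 := r.lump_nonneg i
    have hvl : 0 ≤ v i * r.lump i := mul_nonneg hi.le hl0
    rw [payment, quantity, hx, hP, hpl]
    refine ⟨?_, ?_, fun q hq => ?_⟩
    · rw [surplusAt, if_pos hqf, surplus, hpa]; ring
    · rw [levelAt, if_pos hqf]
      have hsum0 : 0 ≤ ∑ k with k ≠ i ∧ v k = v i, (r.state (r.arrival (v i))).budget k :=
        Finset.sum_nonneg fun k _ => r.budget_nonneg hB ha k
      by_cases h : r.lump i = 0
      · rw [h, mul_zero, add_zero, show B i - (r.state (r.arrival (v i))).paid i =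
          (r.state (r.arrival (v i))).budget i by linarith, hbm]
        refine min_le_min le_rfl (max_le (r.level_nonneg hB hex ha) (by linarith))
      -- Bidder `i` buys in the final sale as an exiting bidder. Her share is at most what the
      -- active bidders leave, whose value is her budget plus those of the other exiting bidders
      -- minus the level. Rearranged, this bounds the level after the others' exit by what she
      -- keeps.
      · obtain ⟨hpi, hE⟩ := hl h
        have haf : r.arrival (v i) = r.stopTime := by
          rw [← hpi]; exact r.arrival_stopTime hB hc i hv
        refine (min_le_right _ _).trans ?_
        rw [haf] at hpb ⊢
        have h1 := r.lump_budget_le hB i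
        rw [hpi] at h1
        refine max_le (by linarith) ?_
        have h2 := r.lump_exiting
        rw [sum_demand hpf (r.budget_nonneg hB hf), ENNReal.toReal_ofReal (div_nonneg
          (Finset.sum_nonneg fun i _ => r.budget_nonneg hB hf i) hpf.le),
          sum_active_budget (r.budget_nonneg hB hf)] at h2
        have h3 := Finset.single_le_sum (f := r.lump) (fun k _ => r.lump_nonneg k) hE
        rw [h2, hpi] at h3
        have h4 : v i * r.lump i ≤ v i * (r.state r.stopTime).supply -
            ∑ k with v i < v k, (r.state r.stopTime).budget k := by
          have := mul_le_mul_of_nonneg_left h3 hi.le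
          rwa [mul_sub, mul_div_cancel₀ _ hi.ne'] at this
        have h5 := sum_budget_split (v := v) (s := r.state r.stopTime)
        rw [r.sum_budget_le_price hB hv hf, hpi, sum_filter_ne_eq (i := i) (p := fun k => v k = v i) rfl] at h5
        have h6 : (r.state r.stopTime).level = ∑ k, (r.state r.stopTime).budget k -
          v i * (r.state r.stopTime).supply := by rw [level, hpi]
        linarith
    · obtain ⟨T, hT, ε, hε, hTε, -, -, -, hp, -, -, hcongr⟩ :=
        r.exists_departure_levelAt hB hc hq.1 hq.2 (hq.2.trans_le hqf)
      have hT' : T ∈ Icc 0 r.stopTime := ⟨hT.1, hT.2.le⟩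
      have hpT : (r.state T).price = q := by simpa using hp T ⟨le_rfl, by linarith⟩
      have hTa : T ≤ r.arrival (v i) := by
        by_contra! h
        have h1 := r.price_monotoneOn ha hT' h.le
        simp only [hpa, hpT] at h1
        linarith [hq.2]
      rw [(hcongr q ⟨le_rfl, by linarith⟩).1, show q + (T - q) = T by ring,
        ← r.budget_eq_min hB hc hT' fun s hs => hlt s ⟨hs.1, hs.2.trans_le hTa⟩]
      have h1 := r.budget_antitoneOn i hT' ha hTa
      simp only at h1
      linarith

end Competition

end ClinchingRun

/-! ### Comparison of traces -/

namespace IsPriceTrace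

open Set Filter Topology

variable {ι : Type*} [Fintype ι] [DecidableEq ι] {v B : ι → ℝ} {i : ι} {b b₀ b₁ w w₀ w₁ : ℝ}
  {m m₀ m₁ g g₀ g₁ : ℝ → ℝ}

/-- If the left side is positive, every budget in the sum is below `x`, since one truncated at `x`
would already exhaust it. The sums then agree. -/
theorem jump_mono {s : Finset ι} (hB : ∀ i, 0 ≤ B i) {x y : ℝ} (hx : 0 ≤ x) (hxy : x ≤ y) :
    max 0 (x - ∑ k ∈ s, min (B k) x) ≤ max 0 (y - ∑ k ∈ s, min (B k) y) := by
  rcases le_or_gt (x - ∑ k ∈ s, min (B k) x) 0 with h | h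
  · rw [max_eq_left h]; exact le_max_left _ _
  · have hk : ∀ k ∈ s, min (B k) x = min (B k) y := fun k hk => by
      have h1 := Finset.single_le_sum (f := fun k => min (B k) x)
        (fun k _ => le_min (hB k) hx) hk
      have h2 : B k < x := by
        by_contra! h3
        simp only [min_eq_right h3] at h1
        linarith
      rw [min_eq_left h2.le, min_eq_left (h2.le.trans hxy)]
    rw [Finset.sum_congr rfl hk]
    exact max_le_max le_rfl (by linarith)

/-- With a larger budget, the amount by which the level exceeds the budget is smaller, and the
surplus is larger, at every price. -/
theorem compare (hB : ∀ i, 0 ≤ B i) (h₀ : IsPriceTrace v B i b₀ w₀ m₀ g₀)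
    (h₁ : IsPriceTrace v B i b₁ w₁ m₁ g₁) (hb : b₀ ≤ b₁) :
    ∀ q ∈ Icc 0 (min w₀ w₁), m₁ q - b₁ ≤ m₀ q - b₀ ∧ g₀ q ≤ g₁ q := by
  by_contra! hcon
  obtain ⟨q₀, hq₀, hbad₀⟩ := hcon
  set Q := min w₀ w₁ with hQ
  let S := {q ∈ Icc 0 Q | ¬ (m₁ q - b₁ ≤ m₀ q - b₀ ∧ g₀ q ≤ g₁ q)}
  have hq₀S : q₀ ∈ S := ⟨hq₀, fun h => (hbad₀ h.1).not_ge h.2⟩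
  have hbdd : BddBelow S := ⟨0, fun q hq => hq.1.1⟩
  set a := sInf S with ha
  have haq : ∀ q ∈ S, a ≤ q := fun q hq => csInf_le hbdd hq
  -- `a` is the infimum of the bad prices. It is positive because near zero the two excesses
  -- coincide; it is good itself, and so is an interval to its right, a contradiction.
  have hgood : ∀ q ∈ Ico 0 a, m₁ q - b₁ ≤ m₀ q - b₀ ∧ g₀ q ≤ g₁ q := fun q hq => by
    by_contra h
    exact absurd (haq q ⟨⟨hq.1, hq.2.le.trans ((haq _ hq₀S).trans hq₀.2)⟩, h⟩) (not_le.2 hq.2)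
  have haQ : a ≤ Q := (haq _ hq₀S).trans hq₀.2
  have hapos : 0 < a := by
    obtain ⟨ε₀, hε₀, hs₀⟩ := h₀.start
    obtain ⟨ε₁, hε₁, hs₁⟩ := h₁.start
    refine (lt_min hε₀ hε₁).trans_le (le_csInf ⟨_, hq₀S⟩ fun q hq => ?_)
    by_contra! h
    refine hq.2 ?_
    obtain ⟨h1, h2⟩ := hs₀ q ⟨hq.1.1, h.le.trans (min_le_left _ _)⟩
    obtain ⟨h3, h4⟩ := hs₁ q ⟨hq.1.1, h.le.trans (min_le_right _ _)⟩
    rw [h1, h2, h3, h4]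
    exact ⟨by linarith, le_rfl⟩
  have ha₀ : a ≤ w₀ := haQ.trans (min_le_left _ _)
  have ha₁ : a ≤ w₁ := haQ.trans (min_le_right _ _)
  have hev : ∀ᶠ q in 𝓝[<] a, q ∈ Ico 0 a := Ico_mem_nhdsLT hapos
  have hgooda : m₁ a - b₁ ≤ m₀ a - b₀ ∧ g₀ a ≤ g₁ a := by
    obtain ⟨L₀, hL₀, ht₀, hj₀⟩ := h₀.jump a ⟨hapos, ha₀⟩
    obtain ⟨L₁, hL₁, ht₁, hj₁⟩ := h₁.jump a ⟨hapos, ha₁⟩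
    refine ⟨?_, le_of_tendsto_of_tendsto (h₀.gain_left a ⟨hapos, ha₀⟩)
      (h₁.gain_left a ⟨hapos, ha₁⟩) (hev.mono fun q hq => (hgood q hq).2)⟩
    have hL : L₁ - b₁ ≤ L₀ - b₀ := le_of_tendsto_of_tendsto (ht₁.sub_const b₁)
      (ht₀.sub_const b₀) (hev.mono fun q hq => (hgood q hq).1)
    rw [hj₀, hj₁]
    -- If L₁ ≤ L₀ the jump preserves the order of the levels, which suffices as b₀ ≤ b₁. Otherwise
    -- the truncated budgets, hence the drop, are at least as large for the second trace.
    rcases le_total L₁ L₀ with h | h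
    · have := jump_mono (s := Finset.univ.filter fun k => k ≠ i ∧ v k = a) hB hL₁ h
      linarith
    · have h1 : ∑ k with k ≠ i ∧ v k = a, min (B k) L₀ ≤
          ∑ k with k ≠ i ∧ v k = a, min (B k) L₁ :=
        Finset.sum_le_sum fun k _ => min_le_min le_rfl h
      rw [sub_le_iff_le_add]
      refine max_le ?_ ?_
      · have := le_max_left 0 (L₀ - ∑ k with k ≠ i ∧ v k = a, min (B k) L₀)
        linarith
      · have := le_max_right 0 (L₀ - ∑ k with k ≠ i ∧ v k = a, min (B k) L₀)
        linarith
  have haQ' : a < Q := haQ.lt_of_ne fun h => by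
    have h1 : q₀ = a := le_antisymm (h ▸ hq₀.2) (haq _ hq₀S)
    exact hq₀S.2 (h1 ▸ hgooda)
  obtain ⟨ε₀, hε₀, hm₀, hg₀⟩ := h₀.flow a ⟨hapos, haQ'.trans_le (min_le_left _ _)⟩
  obtain ⟨ε₁, hε₁, hm₁, hg₁⟩ := h₁.flow a ⟨hapos, haQ'.trans_le (min_le_right _ _)⟩
  set ε := min ε₀ ε₁
  have hε : 0 < ε := lt_min hε₀ hε₁
  have hl : a + ε ≤ a + ε₀ := by linarith [min_le_left ε₀ ε₁]
  have hr : a + ε ≤ a + ε₁ := by linarith [min_le_right ε₀ ε₁]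
  -- Where the difference of excesses is positive, m₀ ≤ m₁, so the others' terms only help; the own
  -- term max(0, m - b) contributes at most the difference divided by q, and q ≥ a.
  have hm : ∀ q ∈ Icc a (a + ε), (m₁ q - b₁) - (m₀ q - b₀) ≤ 0 := by
    refine (((hm₁.mono le_rfl hr).sub (HasRightDerivOn.const b₁)).sub
      ((hm₀.mono le_rfl hl).sub (HasRightDerivOn.const b₀))).nonpos (by linarith [hgooda.1]) (1 / a)
      fun q hq hpos => ?_
    have hqpos : 0 < q := hapos.trans_le hq.1
    have h1 : ∑ k with k ≠ i ∧ a < v k, min (B k) (m₀ q) ≤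
        ∑ k with k ≠ i ∧ a < v k, min (B k) (m₁ q) :=
      Finset.sum_le_sum fun k _ => min_le_min le_rfl (by linarith)
    have h2 : (m₁ q - min b₁ (m₁ q)) - (m₀ q - min b₀ (m₀ q)) ≤
        (m₁ q - b₁) - (m₀ q - b₀) := by
      rcases min_cases b₁ (m₁ q) with h | h <;> rcases min_cases b₀ (m₀ q) with h' | h' <;>
        rw [h.1, h'.1] <;> linarith [h.2, h'.2]
    rw [sub_zero, sub_zero, ← sub_div, one_div_mul_eq_div]
    refine (div_le_div_of_nonneg_right (c := q) ?_ hqpos.le).trans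
      (div_le_div_of_nonneg_left hpos.le hapos hq.1)
    linarith
  have hg : ∀ q ∈ Icc a (a + ε), g₀ q - g₁ q ≤ 0 := by
    refine ((hg₀.mono le_rfl hl).sub (hg₁.mono le_rfl hr)).nonpos (by linarith [hgooda.2]) (1 / a)
      fun q hq hpos => ?_
    have hqpos : 0 < q := hapos.trans_le hq.1
    have h1 := hm q ⟨hq.1, hq.2.le⟩
    -- The amount charged is max(0, b - m), increasing in b - m.
    have h2 : b₀ - min b₀ (m₀ q) ≤ b₁ - min b₁ (m₁ q) := by
      rcases min_cases b₁ (m₁ q) with h | h <;> rcases min_cases b₀ (m₀ q) with h' | h' <;>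
        rw [h.1, h'.1] <;> linarith [h.2, h'.2]
    rw [← sub_div, one_div_mul_eq_div]
    refine (div_le_div_of_nonneg_right (c := q) ?_ hqpos.le).trans
      (div_le_div_of_nonneg_left hpos.le hapos hq.1)
    linarith
  obtain ⟨q, hqS, hq⟩ := exists_lt_of_csInf_lt ⟨_, hq₀S⟩ (show sInf S < a + ε by linarith)
  have hqa : q ∈ Icc a (a + ε) := ⟨haq q hqS, hq.le⟩
  exact hqS.2 ⟨by linarith [hm q hqa], by linarith [hg q hqa]⟩

/-- The flow is only local, as `m` may jump, but `g` is left continuous everywhere, so its right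
derivatives fit together over the whole interval. -/
theorem hasRightDerivOn_gain (h : IsPriceTrace v B i b w m g) {q q' : ℝ} (hq : 0 < q)
    (hq' : q' ≤ w) :
    HasRightDerivOn g (fun u => (g u + (b - min b (m u))) / u) q q' := by
  have hd : ∀ u ∈ Ioo 0 w, HasDerivWithinAt g ((g u + (b - min b (m u))) / u) (Ici u) u :=
    fun u hu => by
      obtain ⟨ε, hε, -, hg⟩ := h.flow u hu
      exact hg.2 u ⟨le_rfl, by linarith⟩
  refine ⟨fun u hu => ?_, fun u hu => hd u ⟨hq.trans_le hu.1, hu.2.trans_le hq'⟩⟩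
  have hu0 : 0 < u := hq.trans_le hu.1
  have hleft : ContinuousWithinAt g (Iio u) u := h.gain_left u ⟨hu0, hu.2.trans hq'⟩
  rcases hu.2.eq_or_lt with rfl | huq
  · exact (continuousWithinAt_Iio_iff_Iic.1 hleft).mono fun x hx => hx.2
  · have hright := (hd u ⟨hu0, huq.trans_le hq'⟩).continuousWithinAt
    exact (continuousAt_iff_continuous_left_right.2
      ⟨continuousWithinAt_Iio_iff_Iic.1 hleft, hright⟩).continuousWithinAt

/-- If the charge is at least c, then g lies above the solution of u g' = g + c with the same
initial value, which is affine with slope (g q + c) / q. The bound is stated with q multiplied out.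
-/
theorem le_gain (h : IsPriceTrace v B i b w m g) {q q' c : ℝ} (hq : 0 < q) (hqq' : q ≤ q')
    (hq' : q' ≤ w) (hc : ∀ u ∈ Ico q q', c ≤ b - min b (m u)) :
    g q * q' + c * (q' - q) ≤ g q' * q := by
  have hl : HasRightDerivOn (fun u => g q + (u - q) * ((g q + c) / q)) (fun _ => (g q + c) / q)
      q q' := HasRightDerivOn.of_hasDerivAt fun u _ => by
    simpa using (((hasDerivAt_id u).sub_const q).mul_const ((g q + c) / q)).const_add (g q)
  have := (hl.sub (h.hasRightDerivOn_gain hq hq')).nonpos (by simp) (1 / q) (fun u hu hpos => by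
    have hu0 : 0 < u := hq.trans_le hu.1
    have h1 : (g q + c) / q = (g q + (u - q) * ((g q + c) / q) + c) / u := by
      field_simp; ring
    rw [h1, ← sub_div, ← h1, one_div_mul_eq_div]
    refine (div_le_div_of_nonneg_right (c := u) ?_ hu0.le).trans
      (div_le_div_of_nonneg_left hpos.le hq hu.1)
    linarith [hc u hu]) q' ⟨hqq', le_rfl⟩
  have h2 : (g q + (q' - q) * ((g q + c) / q)) * q = g q * q' + c * (q' - q) := by
    field_simp; ring
  rw [← h2]
  exact mul_le_mul_of_nonneg_right (by linarith) hq.le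

theorem gain_le (h : IsPriceTrace v B i b w m g) {q q' c : ℝ} (hq : 0 < q) (hqq' : q ≤ q')
    (hq' : q' ≤ w) (hc : ∀ u ∈ Ico q q', b - min b (m u) ≤ c) :
    g q' * q ≤ g q * q' + c * (q' - q) := by
  have hl : HasRightDerivOn (fun u => g q + (u - q) * ((g q + c) / q)) (fun _ => (g q + c) / q)
      q q' := HasRightDerivOn.of_hasDerivAt fun u _ => by
    simpa using (((hasDerivAt_id u).sub_const q).mul_const ((g q + c) / q)).const_add (g q)
  have := ((h.hasRightDerivOn_gain hq hq').sub hl).nonpos (by simp) (1 / q) (fun u hu hpos => by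
    have hu0 : 0 < u := hq.trans_le hu.1
    have h1 : (g q + c) / q = (g q + (u - q) * ((g q + c) / q) + c) / u := by
      field_simp; ring
    rw [h1, ← sub_div, ← h1, one_div_mul_eq_div]
    refine (div_le_div_of_nonneg_right (c := u) ?_ hu0.le).trans
      (div_le_div_of_nonneg_left hpos.le hq hu.1)
    linarith [hc u hu]) q' ⟨hqq', le_rfl⟩
  have h2 : (g q + (q' - q) * ((g q + c) / q)) * q = g q * q' + c * (q' - q) := by
    field_simp; ring
  rw [← h2]
  exact mul_le_mul_of_nonneg_right (by linarith) hq.le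

theorem gain_nonneg (h : IsPriceTrace v B i b w m g) {q : ℝ} (hq : q ∈ Ioc 0 w) : 0 ≤ g q := by
  obtain ⟨ε, hε, hs⟩ := h.start
  have hpos : 0 < min ε q := lt_min hε hq.1
  have h0 := (hs (min ε q) ⟨hpos.le, min_le_left _ _⟩).2
  have := h.le_gain hpos (min_le_right _ _) hq.2 (c := 0)
    fun u _ => sub_nonneg.2 (min_le_left _ _)
  rw [h0] at this
  nlinarith

/-- Among all reported valuations the true one is best. -/
theorem utility_le (hB : ∀ i, 0 ≤ B i) {η X P : ℝ} (hη : 0 < η) (hw : 0 < w)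
    (h₀ : IsPriceTrace v B i b η m₀ g₀) (h : IsPriceTrace v B i b w m g)
    (hX : w * X = g w + P) (hP : min b (m w) ≤ b - P)
    (hP' : ∀ q ∈ Ico 0 w, b - P ≤ min b (m q)) : η * X - P ≤ g₀ η := by
  -- With equal budgets the comparison applies in both directions, so the two traces coincide up to
  -- the lower report.
  have hg : ∀ q ∈ Icc 0 (min η w), g₀ q = g q := fun q hq =>
    le_antisymm (compare hB h₀ h le_rfl q hq).2
      (compare hB h h₀ le_rfl q (by rwa [min_comm])).2
  have hm : ∀ q ∈ Icc 0 (min η w), m₀ q = m q := fun q hq => by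
    have h1 := (compare hB h₀ h le_rfl q hq).1
    have h2 := (compare hB h h₀ le_rfl q (by rwa [min_comm])).1
    linarith
  have hX' : X = (g w + P) / w := by rw [← hX]; field_simp
  have hU : (η * X - P) * w = g w * η + P * (η - w) := by
    rw [hX']; field_simp; ring
  -- For w ≤ η the truthful bidder is charged at least P from price w on, so her surplus at η is at
  -- least that of holding (X, P) fixed. For η ≤ w the charge between η and w is at most P, so the
  -- surplus gained there is at most what the holding at w would earn.
  rcases le_total w η with hwη | hwη
  · have hwm : w ∈ Icc 0 (min η w) := ⟨hw.le, le_min hwη le_rfl⟩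
    have h1 := h₀.le_gain hw hwη le_rfl (c := b - min b (m₀ w)) fun u hu =>
      sub_le_sub_left (min_le_min le_rfl
        (h₀.antitoneOn ⟨hw.le, hwη⟩ ⟨hw.le.trans hu.1, hu.2.le⟩ hu.1)) _
    rw [hm w hwm, hg w hwm] at h1
    refine le_of_mul_le_mul_right ?_ hw
    rw [hU]
    nlinarith
  · have h1 := h.gain_le hη hwη le_rfl (c := P) fun u hu => by
      linarith [hP' u ⟨hη.le.trans hu.1, hu.2⟩]
    rw [← hg η ⟨hη.le, le_min le_rfl hwη⟩] at h1
    refine le_of_mul_le_mul_right ?_ hw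
    rw [hU]
    linarith

/-- The sums in a trace run over the bidders other than `i` only, so her own reports drop out and
different reports share the same environment. -/
theorem of_update {b' w' : ℝ}
    (h : IsPriceTrace (Function.update v i w') (Function.update B i b') i b w m g) :
    IsPriceTrace v B i b w m g := by
  have hs : ∀ (p : ℝ → Prop) [DecidablePred p] (f : ℝ → ℝ),
      ∑ k with k ≠ i ∧ p (Function.update v i w' k), f (Function.update B i b' k) =
        ∑ k with k ≠ i ∧ p (v k), f (B k) := by
    intro p _ f
    refine Finset.sum_congr (Finset.filter_congr fun k _ => and_congr_right fun hk => by
      rw [Function.update_of_ne hk]) fun k hk => by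
        rw [Function.update_of_ne (Finset.mem_filter.1 hk).2.1]
  refine ⟨?_, h.nonneg, h.antitoneOn, fun q hq => ?_, fun q hq => ?_, h.gain_left⟩
  · simpa only [hs (fun x => 0 < x) (fun x => x)] using h.start
  · obtain ⟨ε, hε, h1, h2⟩ := h.flow q hq
    exact ⟨ε, hε, h1.congr_deriv fun u _ => by
      rw [hs (fun x => q < x) (fun x => min x (m u))], h2⟩
  · obtain ⟨L, hL, h1, h2⟩ := h.jump q hq
    exact ⟨L, hL, h1, by rw [h2, hs (fun x => x = q) (fun x => min x L)]⟩

end IsPriceTrace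

/-! ### From traces to utilities -/

namespace ClinchingRun

open Set AuctionState

variable {ι : Type*} [Fintype ι] [LinearOrder ι] {v B : ι → ℝ} (r : ClinchingRun v B) {i : ι}

/-- A bidder who reports the valuation zero or the budget zero obtains and pays nothing. -/
theorem outcome_of_eq_zero (hex : ∃ k, 0 < v k ∧ 0 < B k)
    (hi : v i = 0 ∨ B i = 0) : r.quantity i = 0 ∧ r.payment i = 0 := by
  have hf := right_mem_Icc.2 r.stopTime_nonneg
  have hA : ∀ t ∈ Icc 0 r.stopTime, i ∉ active v (r.state t) := fun t ht hA => by
    rcases hi with hi | hi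
    · linarith [(mem_active.1 hA).1, r.price_nonneg ht]
    · linarith [(mem_active.1 hA).2, r.budget_le ht i]
  have hC : ∀ t ∈ Ico 0 r.stopTime, paidRate v (r.state t) i = 0 := fun t ht =>
    paidRate_of_notMem (notMem_clinching_of_notMem_active (hA t ⟨ht.1, ht.2.le⟩))
  have hl : r.lump i = 0 := r.lump_eq_zero i (hA _ hf) fun hE => by
    rcases hi with hi | hi
    · linarith [(mem_exiting.1 hE).1, r.price_stopTime_pos hex]
    · linarith [(mem_exiting.1 hE).2, r.budget_le hf i]
  rw [quantity, payment, hl, (r.hasRightDerivOn_paid i).eq_left hC _ hf, r.paid_zero,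
    (r.hasRightDerivOn_alloc i).eq_left (fun t ht => by simp [allocRate, hC t ht]) _ hf,
    r.alloc_zero]
  simp

theorem utility_eq {η β : ℝ} (h : r.payment i ≤ β) :
    r.utility i η β = ((η * r.quantity i - r.payment i : ℝ) : EReal) := by
  rw [utility, if_pos h]

end ClinchingRun

section Comparison

open Set

variable {ι : Type*} [Fintype ι] [LinearOrder ι] {i : ι} {v B : ι → ℝ}

theorem update_nonneg {f : ι → ℝ} (hf : ∀ j, j ≠ i → 0 ≤ f j) {x : ℝ} (hx : 0 ≤ x) (j : ι) :
    0 ≤ Function.update f i x j := by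
  rcases eq_or_ne j i with rfl | h
  · simpa
  · simpa [h] using hf j h

theorem exists_competitor_update (hcomp : ∃ j, j ≠ i ∧ 0 < v j ∧ 0 < B j) (w b : ℝ) :
    ∃ k, k ≠ i ∧ 0 < Function.update v i w k ∧ 0 < Function.update B i b k := by
  obtain ⟨j, hj, h⟩ := hcomp
  exact ⟨j, hj, by simpa [hj] using h⟩

/-- The budget of `i` in the environment is set to 0 merely to have one nonnegative vector common to
all her reports. -/
theorem ClinchingRun.exists_isPriceTrace (hv : ∀ j, j ≠ i → 0 ≤ v j) (hB : ∀ j, j ≠ i → 0 ≤ B j)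
    (hcomp : ∃ j, j ≠ i ∧ 0 < v j ∧ 0 < B j) {w b : ℝ} (hw : 0 < w) (hb : 0 < b)
    (r : ClinchingRun (Function.update v i w) (Function.update B i b)) :
    ∃ m g, IsPriceTrace v (Function.update B i 0) i b w m g ∧
      w * r.quantity i = g w + r.payment i ∧ min b (m w) ≤ b - r.payment i ∧
      (∀ q ∈ Ico 0 w, b - r.payment i ≤ min b (m q)) ∧ r.payment i ∈ Icc 0 b := by
  have hB' := update_nonneg hB hb.le
  have hv' := update_nonneg hv hw.le
  -- For `i` the given competitor serves; for everyone else `i` herself does, which is why w and b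
  -- have to be positive.
  have hc : ∀ j, ∃ k, k ≠ j ∧ 0 < Function.update v i w k ∧ 0 < Function.update B i b k := by
    intro j
    rcases eq_or_ne j i with rfl | hj
    · exact exists_competitor_update hcomp w b
    · exact ⟨i, hj.symm, by simpa using ⟨hw, hb⟩⟩
  have htr := r.isPriceTrace (i := i) hB' hv' hc (by simpa using hw)
  obtain ⟨h1, h2, h3⟩ := r.outcome (i := i) hB' hv' hc (by simpa using hw)
  simp only [Function.update_self] at htr h1 h2 h3
  have h4 : IsPriceTrace v (Function.update B i 0) i b w (r.levelAt i) (r.surplusAt i) := by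
    refine IsPriceTrace.of_update (w' := w) (b' := b) ?_
    simpa using htr
  refine ⟨_, _, h4, h1, h2, h3, ?_, ?_⟩
  · linarith [h3 0 ⟨le_rfl, hw⟩, min_le_left b (r.levelAt i 0)]
  · linarith [le_min hb.le (h4.nonneg w)]

theorem utility_truthful {η : ℝ} (hη : 0 ≤ η) (hv : ∀ j, j ≠ i → 0 ≤ v j) (hB : ∀ j, j ≠ i → 0 ≤ B j)
    (hcomp : ∃ j, j ≠ i ∧ 0 < v j ∧ 0 < B j) {β b w : ℝ} (hb : b ∈ Icc 0 β) (hw : 0 ≤ w)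
    (r : ClinchingRun (Function.update v i η) (Function.update B i b))
    (r' : ClinchingRun (Function.update v i w) (Function.update B i b)) :
    r'.utility i η β ≤ r.utility i η β := by
  -- Zero reports have no trace and are settled directly; they give utility zero.
  have hzero : ∀ w (r : ClinchingRun (Function.update v i w) (Function.update B i b)),
      w = 0 ∨ b = 0 → r.quantity i = 0 ∧ r.payment i = 0 := fun w r h => by
    obtain ⟨k, -, hk⟩ := exists_competitor_update hcomp w b
    exact r.outcome_of_eq_zero ⟨k, hk⟩ (by simpa using h)
  have hβ : 0 ≤ β := hb.1.trans hb.2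
  rcases hb.1.eq_or_lt with hb0 | hb0
  · obtain ⟨h1, h2⟩ := hzero _ r (Or.inr hb0.symm)
    obtain ⟨h3, h4⟩ := hzero _ r' (Or.inr hb0.symm)
    rw [r.utility_eq (by rwa [h2]), r'.utility_eq (by rwa [h4]), h1, h2, h3, h4]
  have hB0 := update_nonneg (i := i) hB le_rfl
  rcases hη.eq_or_lt with rfl | hη0 <;> rcases hw.eq_or_lt with rfl | hw0
  · obtain ⟨h1, h2⟩ := hzero _ r (Or.inl rfl)
    obtain ⟨h3, h4⟩ := hzero _ r' (Or.inl rfl)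
    rw [r.utility_eq (by rwa [h2]), r'.utility_eq (by rwa [h4]), h1, h2, h3, h4]
  · obtain ⟨h1, h2⟩ := hzero _ r (Or.inl rfl)
    obtain ⟨m, g, -, -, -, -, hP⟩ := r'.exists_isPriceTrace hv hB hcomp hw0 hb0
    rw [r.utility_eq (by rwa [h2]), r'.utility_eq (hP.2.trans hb.2), EReal.coe_le_coe_iff, h1, h2]
    linarith [hP.1]
  · obtain ⟨h3, h4⟩ := hzero _ r' (Or.inl rfl)
    obtain ⟨m, g, htr, hX, -, -, hP⟩ := r.exists_isPriceTrace hv hB hcomp hη0 hb0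
    rw [r.utility_eq (hP.2.trans hb.2), r'.utility_eq (by rwa [h4]), EReal.coe_le_coe_iff, h3, h4,
      hX]
    linarith [htr.gain_nonneg ⟨hη0, le_rfl⟩]
  · obtain ⟨m, g, htr, hX, -, -, hP⟩ := r.exists_isPriceTrace hv hB hcomp hη0 hb0
    obtain ⟨m', g', htr', hX', hP1, hP2, hP'⟩ := r'.exists_isPriceTrace hv hB hcomp hw0 hb0
    rw [r.utility_eq (hP.2.trans hb.2), r'.utility_eq (hP'.2.trans hb.2), EReal.coe_le_coe_iff, hX]
    linarith [htr.utility_le hB0 hη0 hw0 htr' hX' hP1 hP2]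

theorem utility_budget_monotone {η : ℝ} (hη : 0 ≤ η) (hv : ∀ j, j ≠ i → 0 ≤ v j)
    (hB : ∀ j, j ≠ i → 0 ≤ B j) (hcomp : ∃ j, j ≠ i ∧ 0 < v j ∧ 0 < B j) {β b₀ b₁ : ℝ}
    (hb₀ : b₀ ∈ Icc 0 β) (hb₁ : b₁ ∈ Icc 0 β) (hb : b₀ ≤ b₁)
    (r₀ : ClinchingRun (Function.update v i η) (Function.update B i b₀))
    (r₁ : ClinchingRun (Function.update v i η) (Function.update B i b₁)) :
    r₀.utility i η β ≤ r₁.utility i η β := by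
  have hzero : ∀ b, ∀ r : ClinchingRun (Function.update v i η) (Function.update B i b),
      η = 0 ∨ b = 0 → r.quantity i = 0 ∧ r.payment i = 0 := fun b r h => by
    obtain ⟨k, -, hk⟩ := exists_competitor_update hcomp η b
    exact r.outcome_of_eq_zero ⟨k, hk⟩ (by simpa using h)
  have hβ : 0 ≤ β := hb₀.1.trans hb₀.2
  have hB0 := update_nonneg (i := i) hB le_rfl
  rcases hη.eq_or_lt with hη0 | hη0
  · obtain ⟨h1, h2⟩ := hzero _ r₀ (Or.inl hη0.symm)
    obtain ⟨h3, h4⟩ := hzero _ r₁ (Or.inl hη0.symm)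
    rw [r₀.utility_eq (by rwa [h2]), r₁.utility_eq (by rwa [h4]), h1, h2, h3, h4]
  rcases hb₀.1.eq_or_lt with hb0 | hb0
  · obtain ⟨h1, h2⟩ := hzero _ r₀ (Or.inr hb0.symm)
    rcases hb₁.1.eq_or_lt with hb1 | hb1
    · obtain ⟨h3, h4⟩ := hzero _ r₁ (Or.inr hb1.symm)
      rw [r₀.utility_eq (by rwa [h2]), r₁.utility_eq (by rwa [h4]), h1, h2, h3, h4]
    · obtain ⟨m, g, htr, hX, -, -, hP⟩ := r₁.exists_isPriceTrace hv hB hcomp hη0 hb1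
      rw [r₁.utility_eq (hP.2.trans hb₁.2), r₀.utility_eq (by rwa [h2]), EReal.coe_le_coe_iff, h1,
        h2, hX]
      linarith [htr.gain_nonneg ⟨hη0, le_rfl⟩]
  · obtain ⟨m₀, g₀, htr₀, hX₀, -, -, hP₀⟩ := r₀.exists_isPriceTrace hv hB hcomp hη0 hb0
    obtain ⟨m₁, g₁, htr₁, hX₁, -, -, hP₁⟩ :=
      r₁.exists_isPriceTrace hv hB hcomp hη0 (hb0.trans_le hb)
    rw [r₀.utility_eq (hP₀.2.trans hb₀.2), r₁.utility_eq (hP₁.2.trans hb₁.2),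
      EReal.coe_le_coe_iff, hX₀, hX₁]
    linarith [(htr₀.compare hB0 htr₁ hb η ⟨hη0.le, by simp⟩).2]

end Comparison

/-! ### Tools for existence -/

namespace HasRightDerivOn

open Set Filter Topology

variable {f f' : ℝ → ℝ} {a b : ℝ}

/-- Since `f` decreases, it stays below `c` once it has reached it, so the minimum has a right
derivative even at the kink. -/
theorem const_min (h : HasRightDerivOn f f' a b) (h' : ∀ t ∈ Ico a b, f' t ≤ 0) (c : ℝ) :
    HasRightDerivOn (fun t => min c (f t)) (fun t => if f t ≤ c then f' t else 0) a b := by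
  refine ⟨continuousOn_const.inf h.1, fun t ht => ?_⟩
  have hanti := h.antitoneOn h'
  dsimp only
  split_ifs with hc
  · refine (h.2 t ht).congr_of_eventuallyEq ?_ (min_eq_right hc)
    filter_upwards [Icc_mem_nhdsGE ht.2] with u hu
    exact min_eq_right ((hanti ⟨ht.1, ht.2.le⟩ ⟨ht.1.trans hu.1, hu.2⟩ hu.1).trans hc)
  · push Not at hc
    refine (hasDerivWithinAt_const t _ c).congr_of_eventuallyEq ?_ (min_eq_left hc.le)
    filter_upwards [(h.2 t ht).continuousWithinAt.eventually (lt_mem_nhds hc)] with u hu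
    exact min_eq_left hu.le

/-- A continuous function has an antiderivative. -/
theorem exists_integral (hab : a ≤ b) (hf : ContinuousOn f (Icc a b)) :
    ∃ F : ℝ → ℝ, F a = 0 ∧ HasRightDerivOn F f a b := by
  have hg : Continuous (IccExtend hab ((Icc a b).domRestrict f)) :=
    (continuousOn_iff_continuous_domRestrict.1 hf).Icc_extend'
  refine ⟨fun t => ∫ u in a..t, IccExtend hab ((Icc a b).domRestrict f) u,
    intervalIntegral.integral_same, ?_⟩
  refine (of_hasDerivAt fun t _ => intervalIntegral.integral_hasDerivAt_right
    (hg.intervalIntegrable _ _) (hg.stronglyMeasurableAtFilter _ _) hg.continuousAt).congr_deriv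
    fun t ht => ?_
  exact IccExtend_of_mem hab _ ⟨ht.1, ht.2.le⟩

theorem of_Icc (h : ∀ t ∈ Icc a b, HasDerivWithinAt f (f' t) (Icc a b) t) :
    HasRightDerivOn f f' a b :=
  ⟨fun t ht => (h t ht).continuousWithinAt, fun t ht =>
    (h t ⟨ht.1, ht.2.le⟩).mono_of_mem_nhdsWithin (mem_of_superset (Icc_mem_nhdsGE ht.2)
      (Icc_subset_Icc ht.1 le_rfl))⟩

open scoped NNReal in
-- Picard–Lindelöf applies on the whole interval at once: as p + t ≥ p > 0, the field is bounded by
-- L / p and Lipschitz with constant K / p.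
theorem exists_solution {G : ℝ → ℝ} {K L : ℝ≥0} (hG : LipschitzWith K G) (hL : ∀ x, |G x| ≤ L)
    {p δ : ℝ} (hp : 0 < p) (hδ : 0 ≤ δ) (x₀ : ℝ) :
    ∃ M : ℝ → ℝ, M 0 = x₀ ∧ HasRightDerivOn M (fun t => -(G (M t) / (p + t))) 0 δ := by
  have hpt : ∀ t ∈ Icc 0 δ, p ≤ p + t := fun t ht => by linarith [ht.1]
  have hPL : IsPicardLindelof (fun t x => -(G x / (p + t))) (⟨0, left_mem_Icc.2 hδ⟩ : Icc 0 δ) x₀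
      (L / p.toNNReal * δ.toNNReal) 0 (L / p.toNNReal) (K / p.toNNReal) := by
    have hpn : (p.toNNReal : ℝ) = p := Real.coe_toNNReal _ hp.le
    refine ⟨fun t ht => LipschitzWith.lipschitzOnWith (LipschitzWith.of_dist_le_mul fun x y => ?_),
      fun x _ => ?_, fun t ht x _ => ?_, ?_⟩
    · have h1 := hG.dist_le_mul x y
      have h2 := hpt t ht
      rw [Real.dist_eq] at h1 ⊢
      rw [neg_sub_neg, ← sub_div, abs_div, abs_sub_comm, abs_of_pos (hp.trans_le h2), NNReal.coe_div,
        hpn, div_mul_eq_mul_div]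
      exact div_le_div₀ (by positivity) h1 hp h2
    · refine ContinuousOn.neg (continuousOn_const.div (by fun_prop) fun t ht => ?_)
      exact (hp.trans_le (hpt t ht)).ne'
    · rw [norm_neg, norm_div, NNReal.coe_div, hpn, Real.norm_eq_abs, Real.norm_eq_abs,
        abs_of_pos (hp.trans_le (hpt t ht))]
      exact div_le_div₀ L.2 (hL x) hp (hpt t ht)
    · simp [hδ]
  obtain ⟨M, hM0, hM⟩ := hPL.exists_eq_forall_mem_Icc_hasDerivWithinAt₀
  exact ⟨M, hM0, of_Icc hM⟩

end HasRightDerivOn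

/-! ### Concatenation of processes and the final sale -/

namespace AuctionState

open Set

variable {ι : Type*} [Fintype ι] [LinearOrder ι] {v : ι → ℝ}

/-- A path that obeys the rules of the auction up to the time `f`. -/
structure IsProcess (v : ι → ℝ) (st : ℝ → AuctionState ι) (f : ℝ) : Prop where
  price : HasRightDerivOn (fun t => (st t).price) (fun t => priceRate v (st t)) 0 f
  budget : ∀ i, HasRightDerivOn (fun t => (st t).budget i) (fun t => budgetRate v (st t) i) 0 f
  alloc : ∀ i, HasRightDerivOn (fun t => (st t).alloc i) (fun t => allocRate v (st t) i) 0 f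
  paid : ∀ i, HasRightDerivOn (fun t => (st t).paid i) (fun t => paidRate v (st t) i) 0 f
  not_stops : ∀ t ∈ Ico 0 f, ¬ Stops v (st t)

/-- The one-shot allocation with which the auction ends in the state `s`. -/
structure IsFinalSale (v : ι → ℝ) (s : AuctionState ι) (lump : ι → ℝ) : Prop where
  nonneg : ∀ i, 0 ≤ lump i
  eq_zero : ∀ i, i ∉ active v s → i ∉ exiting v s → lump i = 0
  budget : ∀ i, i ∈ active v s ∨ i ∈ exiting v s → s.price * lump i ≤ s.budget i
  sum_active : ∑ i ∈ active v s, lump i = (∑ i ∈ active v s, s.demand i).toReal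
  sum_exiting : ∑ i ∈ exiting v s, lump i =
    s.supply - (∑ i ∈ active v s, s.demand i).toReal

/-- The auction can be brought to its end from the state `s`. -/
def Completable (v : ι → ℝ) (s : AuctionState ι) : Prop :=
  ∃ (st : ℝ → AuctionState ι) (f : ℝ) (lump : ι → ℝ), st 0 = s ∧ 0 ≤ f ∧ IsProcess v st f ∧
    Stops v (st f) ∧ IsFinalSale v (st f) lump

theorem IsProcess.completable {st : ℝ → AuctionState ι} {δ : ℝ} (h : IsProcess v st δ)
    (hδ : 0 ≤ δ) (hc : Completable v (st δ)) : Completable v (st 0) := by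
  obtain ⟨st', f, lump, h0, hf, h', hfinal, hsale⟩ := hc
  let st'' : ℝ → AuctionState ι := fun t => if t < δ then st t else st' (t - δ)
  have hglue : ∀ F R : AuctionState ι → ℝ,
      HasRightDerivOn (fun t => F (st t)) (fun t => R (st t)) 0 δ →
      HasRightDerivOn (fun t => F (st' t)) (fun t => R (st' t)) 0 f →
      HasRightDerivOn (fun t => F (st'' t)) (fun t => R (st'' t)) 0 (δ + f) := by
    intro F R h1 h2
    have := h1.glue h2 hδ (by rw [h0])
    have hF : ∀ F : AuctionState ι → ℝ, (fun t => F (st'' t)) =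
        fun t => if t < δ then F (st t) else F (st' (t - δ)) := fun F => by
      funext t; simp only [st'']; split_ifs <;> rfl
    rw [hF F, hF R]
    exact this
  have hend : st'' (δ + f) = st' f := by simp [st'', hf]
  refine ⟨st'', δ + f, lump, ?_, by linarith, ⟨hglue _ _ h.price h'.price,
    fun i => hglue (fun s => s.budget i) (fun s => budgetRate v s i) (h.budget i) (h'.budget i),
    fun i => hglue (fun s => s.alloc i) (fun s => allocRate v s i) (h.alloc i) (h'.alloc i),
    fun i => hglue (fun s => s.paid i) (fun s => paidRate v s i) (h.paid i) (h'.paid i),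
    fun t ht => ?_⟩, hend ▸ hfinal, hend ▸ hsale⟩
  · simp only [st'']
    split_ifs with hd
    · rfl
    · have : δ = 0 := le_antisymm (not_lt.1 hd) hδ
      subst this
      simpa using h0
  · simp only [st'']
    split_ifs with hd
    · exact h.not_stops t ⟨ht.1, hd⟩
    · exact h'.not_stops _ ⟨by linarith, by linarith [ht.2]⟩

theorem Completable.of_stops {s : AuctionState ι} {lump : ι → ℝ} (h : Stops v s)
    (hl : IsFinalSale v s lump) : Completable v s := by
  have hc : ∀ c : ℝ, ∀ R : ℝ → ℝ, HasRightDerivOn (fun _ => c) R 0 0 := fun c R =>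
    ⟨continuousOn_const, fun t ht => absurd ht.1 (not_le.2 ht.2)⟩
  exact ⟨fun _ => s, 0, lump, rfl, le_rfl, ⟨hc _ _, fun i => hc _ _, fun i => hc _ _,
    fun i => hc _ _, fun t ht => absurd ht.1 (not_le.2 ht.2)⟩, h, hl⟩

theorem Completable.nonempty_clinchingRun {B : ι → ℝ}
    (h : Completable v ⟨0, B, fun _ => 0, fun _ => 0⟩) : Nonempty (ClinchingRun v B) := by
  obtain ⟨st, f, lump, h0, hf, h, hfinal, hl⟩ := h
  exact ⟨{ state := st, stopTime := f, lump := lump, stopTime_nonneg := hf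
           price_zero := by rw [h0]
           budget_zero := fun i => by rw [h0]
           alloc_zero := fun i => by rw [h0]
           paid_zero := fun i => by rw [h0]
           price_continuous := h.price.1
           budget_continuous := fun i => (h.budget i).1
           alloc_continuous := fun i => (h.alloc i).1
           paid_continuous := fun i => (h.paid i).1
           not_stops := h.not_stops
           price_deriv := h.price.2
           budget_deriv := fun t ht i => (h.budget i).2 t ht
           alloc_deriv := fun t ht i => (h.alloc i).2 t ht
           paid_deriv := fun t ht i => (h.paid i).2 t ht
           stops := hfinal
           lump_nonneg := hl.nonneg
           lump_eq_zero := hl.eq_zero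
           lump_budget := hl.budget
           lump_active := hl.sum_active
           lump_exiting := hl.sum_exiting }⟩

theorem sum_budget_le_price_eq {s : AuctionState ι} (hd : ∀ k, v k < s.price → s.budget k = 0)
    (hb : ∀ k, 0 ≤ s.budget k) :
    ∑ k with v k ≤ s.price, s.budget k = ∑ k ∈ exiting v s, s.budget k := by
  refine (Finset.sum_subset (fun k hk => ?_) fun k hk hk' => ?_).symm
  · simp [(mem_exiting.1 hk).1]
  · simp only [Finset.mem_filter, Finset.mem_univ, true_and, mem_exiting, not_and, not_lt] at hk hk'
    rcases hk.lt_or_eq with h | h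
    · exact hd k h
    · exact le_antisymm (hk' h) (hb k)

/-- Active bidders spend their whole budgets, and every exiting bidder gets the same fraction of her
demand. The fraction is at least 0 by the stopping condition and at most 1 because the level is
nonnegative. -/
theorem exists_isFinalSale {s : AuctionState ι} (hp : 0 < s.price) (hb : ∀ k, 0 ≤ s.budget k)
    (hS : 0 ≤ s.supply) (hd : ∀ k, v k < s.price → s.budget k = 0) (hl : 0 ≤ s.level)
    (hfinal : Stops v s) : ∃ lump, IsFinalSale v s lump := by
  set a := ∑ k ∈ active v s, s.budget k with ha
  set e := ∑ k ∈ exiting v s, s.budget k with he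
  have h1 : a ≤ s.price * s.supply := (stops_iff hp hb hS).1 hfinal
  have h2 : s.price * s.supply - a ≤ e := by
    have := sum_budget_split (v := v) (s := s)
    rw [sum_budget_le_price_eq hd hb, ← sum_active_budget hb, ← ha, ← he] at this
    rw [level, this] at hl
    linarith
  have he0 : 0 ≤ e := Finset.sum_nonneg fun k _ => hb k
  have hρ0 : 0 ≤ (s.price * s.supply - a) / e := div_nonneg (by linarith) he0
  have hρ1 : (s.price * s.supply - a) / e ≤ 1 := div_le_one_of_le₀ h2 he0
  have hdis : ∀ k ∈ exiting v s, k ∉ active v s := fun k hk => notMem_active_of_mem_exiting hk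
  have htoReal : (∑ i ∈ active v s, s.demand i).toReal = a / s.price := by
    rw [sum_demand hp hb, ENNReal.toReal_ofReal (div_nonneg
      (Finset.sum_nonneg fun k _ => hb k) hp.le)]
  refine ⟨fun k => if k ∈ active v s then s.budget k / s.price else if k ∈ exiting v s then
    s.budget k / s.price * ((s.price * s.supply - a) / e) else 0, fun k => ?_, fun k h h' => ?_,
    fun k _ => ?_, ?_, ?_⟩
  · have := div_nonneg (hb k) hp.le
    split_ifs
    · exact this
    · exact mul_nonneg this hρ0
    · exact le_rfl
  · simp only [h, h', if_false]
  · split_ifs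
    · rw [mul_div_cancel₀ _ hp.ne']
    · rw [← mul_assoc, mul_div_cancel₀ _ hp.ne']
      exact mul_le_of_le_one_right (hb k) hρ1
    · rw [mul_zero]; exact hb k
  · rw [htoReal, Finset.sum_congr rfl fun k hk => if_pos hk, ← Finset.sum_div]
  · rw [htoReal, Finset.sum_congr rfl fun k hk => (if_neg (hdis k hk)).trans (if_pos hk),
      ← Finset.sum_mul, ← Finset.sum_div, ← he]
    -- If the exiting bidders have no budget, the fraction is 0 by division by zero, and nothing is
    -- left to sell to them.
    rcases he0.eq_or_lt with h0 | h0
    · rw [← h0]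
      have : s.price * s.supply = a := by linarith
      rw [← this]
      field_simp
      simp
    · field_simp

end AuctionState

/-! ### Construction of the process stage by stage -/

namespace AuctionState

open Set

variable {ι : Type*} [Fintype ι] [LinearOrder ι] {v : ι → ℝ} {s : AuctionState ι}

/-- The states from which the auction can be continued. -/
structure IsRegular (v : ι → ℝ) (s : AuctionState ι) : Prop where
  price_nonneg : 0 ≤ s.price
  of_price_zero : s.price = 0 → s.supply = 1 ∧ (active v s).Nonempty
  budget_nonneg : ∀ k, 0 ≤ s.budget k
  supply_nonneg : 0 ≤ s.supply
  budget_eq_zero : ∀ k, v k < s.price → s.budget k = 0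
  level_nonneg : 0 ≤ s.level
  budget_le_level : ∀ k, s.price < v k → s.budget k ≤ s.level

theorem IsRegular.sum_exiting_lt_level (h : IsRegular v s) (hns : ¬ Stops v s) :
    ∑ k ∈ exiting v s, s.budget k < s.level := by
  rw [← sum_budget_le_price_eq h.budget_eq_zero h.budget_nonneg]
  rcases h.price_nonneg.eq_or_lt with hp | hp
  · obtain ⟨k, hk⟩ := (h.of_price_zero hp.symm).2
    rw [level, sum_budget_split (v := v), ← sum_active_budget h.budget_nonneg, ← hp]
    have := Finset.single_le_sum (f := s.budget) (fun k _ => h.budget_nonneg k) hk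
    linarith [(mem_active.1 hk).2]
  · rw [stops_iff_level hp h.budget_nonneg h.supply_nonneg] at hns
    exact not_le.1 hns

theorem IsRegular.completable_of_stops (h : IsRegular v s) (hs : Stops v s) :
    Completable v s := by
  have hp : 0 < s.price := h.price_nonneg.lt_of_ne fun hp => by
    obtain ⟨k, hk⟩ := (h.of_price_zero hp.symm).2
    exact not_stops_of_price_zero hp.symm hk hs
  obtain ⟨lump, hl⟩ := exists_isFinalSale hp h.budget_nonneg h.supply_nonneg h.budget_eq_zero
    h.level_nonneg hs
  exact Completable.of_stops hs hl

/-- The first exiting bidder loses all her effective budget. -/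
theorem IsRegular.exists_process_of_isLeast_exiting (h : IsRegular v s) (hns : ¬ Stops v s) {e : ι}
    (he : IsLeast (exiting v s : Set ι) e) :
    ∃ st : ℝ → AuctionState ι, st 0 = s ∧ IsProcess v st (s.budget e) ∧
      IsRegular v (st (s.budget e)) ∧ (st (s.budget e)).price = s.price ∧
      active v (st (s.budget e)) = active v s ∧
      exiting v (st (s.budget e)) = (exiting v s).erase e := by
  have heE : e ∈ exiting v s := by simpa using he.1
  obtain ⟨hve, hbe⟩ := mem_exiting.1 heE
  set M := s.level with hM
  have hlt := h.sum_exiting_lt_level hns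
  have hbM : s.budget e < M :=
    (Finset.single_le_sum (f := s.budget) (fun k _ => h.budget_nonneg k) heE).trans_lt hlt
  -- The amount charged by time t, read off from the expected solution: the level is M - t and an
  -- active budget is its minimum with the initial one.
  let d : ℝ → ι → ℝ := fun t k => if s.price < v k then s.budget k - min (s.budget k) (M - t) else 0
  let st : ℝ → AuctionState ι := fun t =>
    { price := s.price
      budget := fun k => s.budget k - d t k - if k = e then t else 0
      alloc := fun k => s.alloc k + d t k / s.price
      paid := fun k => s.paid k + d t k }
  have hde : ∀ t, d t e = 0 := fun t => by simp [d, hve]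
  have hdp : s.price = 0 → ∀ t ∈ Icc 0 (s.budget e), ∀ k, d t k = 0 := fun hp t ht k => by
    simp only [d]; split_ifs with hk
    · have hke : k ≠ e := by rintro rfl; linarith
      have h1 := Finset.add_le_sum (f := s.budget) (s := Finset.univ)
        (fun k _ => h.budget_nonneg k) (Finset.mem_univ k) (Finset.mem_univ e) hke
      -- At price zero the level contains both the budget of `k` and that of `e`, so it cannot come
      -- down to the former while the latter is drained.
      have h2 : M = ∑ k, s.budget k := by rw [hM, level, hp]; ring
      rw [min_eq_left (by linarith [ht.2]), sub_self]
    · rfl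
  have hpd : ∀ t ∈ Icc 0 (s.budget e), ∀ k, s.price * (d t k / s.price) = d t k :=
    fun t ht k => by
      rcases eq_or_ne s.price 0 with hp | hp
      · rw [hdp hp t ht k]; simp
      · field_simp
  have hsup : ∀ t, (st t).supply = s.supply - ∑ k, d t k / s.price := fun t => by
    simp only [supply, st, Finset.sum_add_distrib]; ring
  have hsup1 : s.price = 0 → ∀ t, (st t).supply = 1 := fun hp t => by
    rw [hsup, (h.of_price_zero hp).1, hp]; simp
  have hlev : ∀ t ∈ Icc 0 (s.budget e), (st t).level = M - t := fun t ht => by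
    rw [level, hsup]
    simp only [st, Finset.sum_sub_distrib, mul_sub, Finset.mul_sum, hpd t ht, hM, level]
    simp
    ring
  have hbud : ∀ t k, k ≠ e → (st t).budget k = s.budget k - d t k := fun t k hk => by
    simp [st, hk]
  have hbude : ∀ t, (st t).budget e = s.budget e - t := fun t => by simp [st, hde]
  have hbuda : ∀ t k, s.price < v k → (st t).budget k = min (s.budget k) (M - t) :=
    fun t k hk => by
      have hke : k ≠ e := by rintro rfl; linarith
      rw [hbud t k hke]; simp [d, hk]
  have hbudn : ∀ t k, k ≠ e → v k ≤ s.price → (st t).budget k = s.budget k := fun t k hke hk => by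
    rw [hbud t k hke]; simp [d, not_lt.2 hk]
  have hbnn : ∀ t ∈ Icc 0 (s.budget e), ∀ k, 0 ≤ (st t).budget k := fun t ht k => by
    rcases eq_or_ne k e with rfl | hke
    · rw [hbude]; linarith [ht.2]
    · rcases lt_or_ge s.price (v k) with hk | hk
      · rw [hbuda t k hk]; exact le_min (h.budget_nonneg k) (by linarith [ht.2])
      · rw [hbudn t k hke hk]; exact h.budget_nonneg k
  have hsnn : ∀ t ∈ Icc 0 (s.budget e), 0 ≤ (st t).supply := fun t ht => by
    rcases h.price_nonneg.eq_or_lt with hp | hp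
    · rw [hsup1 hp.symm]; exact zero_le_one
    -- If somebody has been charged, her budget equals the level, so the level is at most the sum of
    -- the budgets and the supply is nonnegative.
    by_cases hz : ∀ k, d t k = 0
    · rw [hsup]; simpa [hz] using h.supply_nonneg
    · push Not at hz
      obtain ⟨k, hk⟩ := hz
      have hvk : s.price < v k := by by_contra h'; exact hk (by simp [d, h'])
      have hbk : (st t).budget k = M - t := by
        rw [hbuda t k hvk]
        refine min_eq_right ?_
        by_contra! h'
        exact hk (by simp [d, hvk, min_eq_left h'.le])
      have h1 := Finset.single_le_sum (f := (st t).budget) (fun k _ => hbnn t ht k)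
        (Finset.mem_univ k)
      have h2 := hlev t ht
      rw [level] at h2
      have h3 : 0 ≤ s.price * (st t).supply := by
        change _ - s.price * _ = _ at h2
        linarith
      exact nonneg_of_mul_nonneg_right h3 hp
  have hact : ∀ t ∈ Icc 0 (s.budget e), active v (st t) = active v s := fun t ht => by
    ext k
    rw [mem_active, mem_active]
    refine and_congr_right fun hk => ?_
    change s.price < v k at hk
    rw [hbuda t k hk, lt_min_iff]
    exact ⟨fun h => h.1, fun h => ⟨h, by linarith [ht.2]⟩⟩
  have hexi : ∀ t ∈ Ico 0 (s.budget e), exiting v (st t) = exiting v s := fun t ht => by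
    ext k
    rw [mem_exiting, mem_exiting]
    refine and_congr_right fun hk => ?_
    change v k = s.price at hk
    rcases eq_or_ne k e with rfl | hke
    · rw [hbude]; exact ⟨fun _ => hbe, fun _ => by linarith [ht.2]⟩
    · rw [hbudn t k hke hk.le]
  have hd : ∀ k, HasRightDerivOn (fun t => d t k) (fun t => paidRate v (st t) k) 0 (s.budget e) := by
    intro k
    by_cases hk : s.price < v k
    · rcases h.price_nonneg.eq_or_lt with hp | hp
      · refine ((HasRightDerivOn.const 0).congr fun t ht => hdp hp.symm t ht k).congr_deriv
          fun t ht => ?_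
        rw [paidRate_of_notMem (notMem_clinching_of_price_zero (s := st t) hp.symm (hsup1 hp.symm t))]
      · have h1 : HasRightDerivOn (fun t => M - t) (fun _ => -1) 0 (s.budget e) :=
          HasRightDerivOn.of_hasDerivAt fun t _ => by
            simpa using (hasDerivAt_id t).const_sub M
        have h2 := (HasRightDerivOn.const (s.budget k)).sub
          (h1.const_min (fun _ _ => by norm_num) (s.budget k))
        refine (h2.congr fun t _ => by simp [d, hk]).congr_deriv fun t ht => ?_
        have ht' : t ∈ Icc 0 (s.budget e) := ⟨ht.1, ht.2.le⟩
        have hE : (exiting v (st t)).Nonempty := by rw [hexi t ht]; exact ⟨e, heE⟩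
        have hC : k ∈ clinching v (st t) ↔ M - t ≤ s.budget k := by
          rw [mem_clinching_iff_level (s := st t) hp (hbnn t ht') (hsnn t ht'), hact t ht', mem_active,
            hbuda t k hk, hlev t ht', min_eq_right_iff]
          exact ⟨fun h => h.2, fun h => ⟨⟨hk, by linarith [ht.2]⟩, h⟩⟩
        simp only [paidRate, hC, hE, if_true]
        split_ifs <;> norm_num
    · refine ((HasRightDerivOn.const 0).congr fun t ht => by simp [d, hk]).congr_deriv
        fun t ht => ?_
      rw [paidRate_of_notMem (s := st t) (notMem_clinching_of_notMem_active fun hA =>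
        hk (mem_active.1 hA).1)]
  have hr : s.budget e ∈ Icc 0 (s.budget e) := ⟨hbe.le, le_rfl⟩
  refine ⟨st, ?_, ⟨?_, fun k => ?_, fun k => ?_, fun k => ?_, fun t ht => ?_⟩,
    ⟨h.price_nonneg, fun hp => ⟨hsup1 hp _, ?_⟩, hbnn _ hr, hsnn _ hr, fun k hk => ?_, ?_,
    fun k hk => ?_⟩, rfl, hact _ hr, ?_⟩
  · have hz : ∀ k, d 0 k = 0 := fun k => by
      simp only [d]; split_ifs with hk
      · rw [sub_zero, min_eq_left (h.budget_le_level k hk), sub_self]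
      · rfl
    simp only [st, hz]
    cases s; simp
  · refine (HasRightDerivOn.const s.price).congr_deriv fun t ht => ?_
    rw [priceRate_of_nonempty (by rw [hexi t ht]; exact ⟨e, heE⟩)]
  · rcases eq_or_ne k e with rfl | hke
    · have h1 : HasRightDerivOn (fun t => s.budget k - t) (fun _ => -1) 0 (s.budget k) :=
        HasRightDerivOn.of_hasDerivAt fun t _ => by
          simpa using (hasDerivAt_id t).const_sub (s.budget k)
      refine (h1.congr fun t _ => hbude t).congr_deriv fun t ht => ?_
      rw [budgetRate_of_isLeast (by rw [hexi t ht]; exact he)]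
    · refine (((HasRightDerivOn.const (s.budget k)).sub (hd k)).congr fun t _ =>
        hbud t k hke).congr_deriv fun t ht => ?_
      have : ¬ IsLeast (exiting v (st t) : Set ι) k := fun h' => by
        rw [hexi t ht] at h'
        exact hke (h'.unique he)
      simp [budgetRate, this]
  · refine ((HasRightDerivOn.const (s.alloc k)).add ((hd k).mul
      (HasRightDerivOn.const (1 / s.price)))).congr (fun t _ => ?_) |>.congr_deriv fun t ht => ?_
    · simp only [st, mul_one_div]
    · simp [allocRate, st, div_eq_mul_inv]
  · exact ((HasRightDerivOn.const (s.paid k)).add (hd k)).congr_deriv fun t _ => zero_add _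
  · have ht' : t ∈ Icc 0 (s.budget e) := ⟨ht.1, ht.2.le⟩
    rcases h.price_nonneg.eq_or_lt with hp | hp
    · obtain ⟨k, hk⟩ := (h.of_price_zero hp.symm).2
      exact not_stops_of_price_zero (i := k) hp.symm (by rwa [hact t ht'])
    · rw [stops_iff_level (s := st t) hp (hbnn t ht') (hsnn t ht'), hlev t ht', not_le]
      have hdrop : ∀ k, v k < (st t).price → (st t).budget k = 0 := fun k hk => by
        change v k < s.price at hk
        rw [hbudn t k (by rintro rfl; linarith) hk.le, h.budget_eq_zero k hk]
      rw [sum_budget_le_price_eq hdrop (hbnn t ht'), hexi t ht]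
      -- The level and the total exiting budget both fall at unit rate, so their gap stays positive.
      rw [← Finset.add_sum_erase _ _ heE] at hlt ⊢
      rw [hbude, Finset.sum_congr rfl fun k hk => hbudn t k (Finset.ne_of_mem_erase hk)
        (mem_exiting.1 (Finset.mem_of_mem_erase hk)).1.le]
      linarith
  · rw [hact _ hr]; exact (h.of_price_zero hp).2
  · change v k < s.price at hk
    rw [hbudn _ k (by rintro rfl; linarith) hk.le, h.budget_eq_zero k hk]
  · rw [hlev _ hr]; linarith
  · rw [hlev _ hr, hbuda _ k hk]; exact min_le_right _ _
  · ext k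
    rw [Finset.mem_erase, mem_exiting, mem_exiting]
    change v k = s.price ∧ _ ↔ _
    rcases eq_or_ne k e with rfl | hke
    · simp [hbude]
    · constructor
      · rintro ⟨h1, h2⟩; rw [hbudn _ k hke h1.le] at h2; exact ⟨hke, h1, h2⟩
      · rintro ⟨-, h1, h2⟩; rw [hbudn _ k hke h1.le]; exact ⟨h1, h2⟩

end AuctionState

namespace AuctionState

open Set

variable {ι : Type*} [Fintype ι] [LinearOrder ι] {v : ι → ℝ} {s : AuctionState ι}

/-- The equation for the level while the price is p + t. Its right side involves the supply times
the price, F(x) = ∑ min(b_k, x) - x, which is nonnegative on [0, M₀]: either some b_k ≥ x, or F(x) =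
∑ b_k - x. -/
theorem exists_level_path {b : ι → ℝ} (hb : ∀ k, 0 ≤ b k) {p δ M₀ : ℝ} (hp : 0 < p) (hδ : 0 ≤ δ)
    (hM₀ : 0 < M₀) (hM₀b : M₀ ≤ ∑ k, b k) :
    ∃ M : ℝ → ℝ, M 0 = M₀ ∧
      HasRightDerivOn M (fun t => -((∑ k, min (b k) (M t) - M t) / (p + t))) 0 δ ∧
      ∀ t ∈ Icc 0 δ, 0 < M t ∧ 0 ≤ ∑ k, min (b k) (M t) - M t := by
  let F : ℝ → ℝ := fun x => ∑ k, min (b k) x - x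
  let c : ℝ → ℝ := fun x => max 0 (min M₀ x)
  let G : ℝ → ℝ := fun x => F (c x)
  have hF0 : ∀ x, 0 ≤ x → x ≤ M₀ → 0 ≤ F x := fun x hx hxM => by
    by_cases hk : ∃ k, x ≤ b k
    · obtain ⟨k, hk⟩ := hk
      have := Finset.single_le_sum (f := fun k => min (b k) x) (fun k _ => le_min (hb k) hx)
        (Finset.mem_univ k)
      simp only [min_eq_right hk] at this
      exact sub_nonneg.2 this
    · push Not at hk
      simp only [F, min_eq_left (hk _).le]
      linarith
  have hFle : ∀ x, 0 ≤ x → F x ≤ ∑ k, b k := fun x hx => by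
    have : ∑ k, min (b k) x ≤ ∑ k, b k := Finset.sum_le_sum fun k _ => min_le_left _ _
    simp only [F]; linarith
  have hFn : ∀ x, 0 ≤ x → F x ≤ Fintype.card ι * x := fun x hx => by
    have : ∑ k, min (b k) x ≤ ∑ _k : ι, x := Finset.sum_le_sum fun k _ => min_le_right _ _
    rw [Finset.sum_const, nsmul_eq_mul, Finset.card_univ] at this
    simp only [F]; linarith
  -- Clamping to [0, M₀] makes the field bounded and globally Lipschitz; the solution is then shown
  -- never to leave this interval.
  have hc0 : ∀ x, 0 ≤ c x := fun x => le_max_left _ _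
  have hcM : ∀ x, c x ≤ M₀ := fun x => max_le hM₀.le (min_le_left _ _)
  have hG0 : ∀ x, 0 ≤ G x := fun x => hF0 _ (hc0 x) (hcM x)
  have hcL : LipschitzWith 1 c := (LipschitzWith.id.const_min M₀).const_max 0
  have hGL : LipschitzWith (Fintype.card ι + 1) G := by
    refine LipschitzWith.of_dist_le_mul fun x y => ?_
    have hxy : |c x - c y| ≤ |x - y| := by simpa [Real.dist_eq] using hcL.dist_le_mul x y
    have hmin : ∀ k, |min (b k) (c x) - min (b k) (c y)| ≤ |x - y| := fun k => by
      refine le_trans ?_ hxy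
      simpa [Real.dist_eq] using ((LipschitzWith.id (α := ℝ)).const_min (b k)).dist_le_mul (c x) (c y)
    have hsum : |∑ k, (min (b k) (c x) - min (b k) (c y))| ≤ Fintype.card ι * |x - y| := by
      refine (Finset.abs_sum_le_sum_abs _ _).trans ((Finset.sum_le_sum fun k _ => hmin k).trans ?_)
      rw [Finset.sum_const, nsmul_eq_mul, Finset.card_univ]
    rw [Real.dist_eq, Real.dist_eq]
    have : G x - G y = ∑ k, (min (b k) (c x) - min (b k) (c y)) - (c x - c y) := by
      simp only [G, F, Finset.sum_sub_distrib]; ring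
    rw [this]
    refine (abs_sub _ _).trans ?_
    push_cast
    linarith
  have hsum0 : 0 ≤ ∑ k, b k := Finset.sum_nonneg fun k _ => hb k
  obtain ⟨M, hM0, hM⟩ := HasRightDerivOn.exists_solution hGL
    (L := (∑ k, b k).toNNReal) (fun x => by
      rw [Real.coe_toNNReal _ hsum0, abs_of_nonneg (hG0 x)]
      exact hFle _ (hc0 x)) hp hδ M₀
  have hpt : ∀ t ∈ Ico 0 δ, 0 < p + t := fun t ht => by linarith [ht.1]
  have hMle : ∀ t ∈ Icc 0 δ, M t ≤ M₀ := fun t ht => by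
    rw [← hM0]
    exact hM.antitoneOn (fun t ht => neg_nonpos.2 (div_nonneg (hG0 _) (hpt t ht).le))
      (left_mem_Icc.2 hδ) ht ht.1
  have hM0' : ∀ t ∈ Icc 0 δ, 0 ≤ M t := fun t ht => by
    have := hM.neg.nonpos (by rw [hM0]; linarith) 0 (fun t ht hpos => by
      have : c (M t) = 0 := max_eq_left ((min_le_right _ _).trans (by linarith))
      have hG : G (M t) = 0 := by simp [G, F, this, hb]
      simp [hG]) t ht
    linarith
  have hcM' : ∀ t ∈ Icc 0 δ, c (M t) = M t := fun t ht => by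
    simp only [c]; rw [min_eq_right (hMle t ht), max_eq_right (hM0' t ht)]
  have hM' : HasRightDerivOn M (fun t => -(F (M t) / (p + t))) 0 δ :=
    hM.congr_deriv fun t ht => by simp only [G]; rw [hcM' t ⟨ht.1, ht.2.le⟩]
  refine ⟨M, hM0, hM', fun t ht => ⟨?_, hF0 _ (hM0' t ht) (hMle t ht)⟩⟩
  -- Since F(x) ≤ n x for n bidders, M decays at most exponentially and stays positive.
  have hexp : HasRightDerivOn (fun t => M₀ * Real.exp (-(Fintype.card ι / p) * t))
      (fun t => -(Fintype.card ι / p) * (M₀ * Real.exp (-(Fintype.card ι / p) * t))) 0 δ :=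
    HasRightDerivOn.of_hasDerivAt fun t _ =>
      ((((hasDerivAt_id t).const_mul (-(Fintype.card ι / p))).exp).const_mul M₀).congr_deriv (by
        simp only [id]; ring)
  have := (hexp.sub hM').nonpos (by simp [hM0]) (-(Fintype.card ι / p)) (fun t ht _ => by
    have ht' : t ∈ Icc 0 δ := ⟨ht.1, ht.2.le⟩
    have h1 : F (M t) / (p + t) ≤ Fintype.card ι / p * M t := by
      rw [div_mul_eq_mul_div]
      exact div_le_div₀ (mul_nonneg (Nat.cast_nonneg _) (hM0' t ht')) (hFn _ (hM0' t ht')) hp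
        (by linarith [ht.1])
    rw [mul_sub]
    linarith) t ht
  have hpos : 0 < M₀ * Real.exp (-(Fintype.card ι / p) * t) := by positivity
  linarith

/-- Without exiting bidders, the price rises to the next valuation of an active bidder. -/
theorem IsRegular.exists_process_of_exiting_empty (h : IsRegular v s) (hns : ¬ Stops v s)
    (hE : exiting v s = ∅) (hp : 0 < s.price) {j : ι} (hj : j ∈ active v s)
    (hmin : ∀ k ∈ active v s, v j ≤ v k) :
    ∃ st : ℝ → AuctionState ι, st 0 = s ∧ IsProcess v st (v j - s.price) ∧
      IsRegular v (st (v j - s.price)) ∧ (st (v j - s.price)).price = v j ∧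
      ∀ k, (st (v j - s.price)).budget k ≤ s.budget k := by
  set p := s.price with hpdef
  set δ := v j - p with hδdef
  have hδ : 0 < δ := by have := (mem_active.1 hj).1; linarith
  have hM₀ : 0 < s.level := by
    have := h.sum_exiting_lt_level hns
    rwa [hE, Finset.sum_empty] at this
  have hM₀b : s.level ≤ ∑ k, s.budget k := by
    rw [level]; linarith [mul_nonneg hp.le h.supply_nonneg]
  obtain ⟨M, hM0, hM, hMpos⟩ := exists_level_path h.budget_nonneg hp hδ.le hM₀ hM₀b
  have hpos : ∀ k, 0 < s.budget k → v j ≤ v k := fun k hk => by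
    refine hmin k (mem_active.2 ⟨?_, hk⟩)
    by_contra! hkp
    rcases hkp.lt_or_eq with hlt | heq
    · exact hk.ne' (h.budget_eq_zero k hlt)
    · have : k ∈ exiting v s := mem_exiting.2 ⟨heq, hk⟩
      rw [hE] at this
      simp at this
  have hpt : ∀ t ∈ Icc 0 δ, 0 < p + t := fun t ht => by linarith [ht.1]
  let σ : ℝ → ℝ := fun t => (∑ k, min (s.budget k) (M t) - M t) / (p + t)
  have hσ0 : ∀ t ∈ Icc 0 δ, 0 ≤ σ t := fun t ht => div_nonneg (hMpos t ht).2 (hpt t ht).le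
  let d : ℝ → ι → ℝ := fun t k => s.budget k - min (s.budget k) (M t)
  have hd : ∀ k, HasRightDerivOn (fun t => d t k)
      (fun t => if M t ≤ s.budget k then σ t else 0) 0 δ := fun k => by
    refine ((HasRightDerivOn.const (s.budget k)).sub (hM.const_min (fun t ht =>
      neg_nonpos.2 (hσ0 t ⟨ht.1, ht.2.le⟩)) (s.budget k))).congr_deriv fun t _ => ?_
    split_ifs <;> simp [σ]
  have hprice : HasRightDerivOn (fun t => p + t) (fun _ => 1) 0 δ :=
    HasRightDerivOn.of_hasDerivAt fun t _ => by simpa using (hasDerivAt_id t).const_add p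
  have hinv : HasRightDerivOn (fun t => (p + t)⁻¹) (fun t => -1 / (p + t) ^ 2) 0 δ :=
    HasRightDerivOn.of_hasDerivAt fun t ht =>
      ((hasDerivAt_id t).const_add p).inv (hpt t ht).ne'
  have hint : ∀ k, ∃ I : ℝ → ℝ, I 0 = 0 ∧
      HasRightDerivOn I (fun t => d t k / (p + t) ^ 2) 0 δ := fun k =>
    HasRightDerivOn.exists_integral hδ.le ((hd k).1.div (by fun_prop) fun t ht =>
      (pow_pos (hpt t ht) 2).ne')
  choose I hI0 hI using hint
  -- The allocation is the integral of d' / (p + t), integrated by parts, because d' jumps when a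
  -- bidder starts clinching while d is continuous.
  let st : ℝ → AuctionState ι := fun t =>
    { price := p + t
      budget := fun k => min (s.budget k) (M t)
      alloc := fun k => s.alloc k + (d t k * (p + t)⁻¹ + I k t)
      paid := fun k => s.paid k + d t k }
  have halloc : ∀ k, HasRightDerivOn (fun t => (st t).alloc k)
      (fun t => (if M t ≤ s.budget k then σ t else 0) / (p + t)) 0 δ := fun k =>
    ((HasRightDerivOn.const (s.alloc k)).add (((hd k).mul hinv).add (hI k))).congr_deriv
      fun t ht => by
        have := (hpt t ⟨ht.1, ht.2.le⟩).ne'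
        field_simp
        ring
  have hM0le : ∀ k, s.budget k ≤ s.level := fun k => by
    rcases (h.budget_nonneg k).eq_or_lt with h0 | h0
    · rw [← h0]; exact hM₀.le
    · exact h.budget_le_level k (by linarith [hpos k h0])
  have hd00 : ∀ k, d 0 k = 0 := fun k => by
    simp only [d]; rw [hM0, min_eq_left (hM0le k), sub_self]
  have hst0 : st 0 = s := by
    have h1 : ∀ k, min (s.budget k) (M 0) = s.budget k := fun k => by
      rw [hM0, min_eq_left (hM0le k)]
    simp only [st, h1, hd00, hI0]
    simp [hpdef]
  have hsupply : ∀ t ∈ Icc 0 δ, (p + t) * (st t).supply =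
      ∑ k, min (s.budget k) (M t) - M t := by
    have hS : HasRightDerivOn (fun t => (st t).supply)
        (fun t => 0 - ∑ k, (if M t ≤ s.budget k then σ t else 0) / (p + t)) 0 δ :=
      (HasRightDerivOn.const 1).sub (HasRightDerivOn.sum fun k _ => halloc k)
    have hZ := ((hprice.mul hS).add (HasRightDerivOn.sum fun k (_ : k ∈ Finset.univ) => hd k)).add hM
    -- The level of the constructed state must be M. Equivalently Z remains ∑ b_k: the difference y
    -- satisfies y' = y / (p + t) and y(0) = 0, so it vanishes.
    let Z : ℝ → ℝ := fun t => (p + t) * (st t).supply + ∑ k, d t k + M t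
    have hZ' : HasRightDerivOn (fun t => Z t - ∑ k, s.budget k)
        (fun t => (Z t - ∑ k, s.budget k) / (p + t)) 0 δ := by
      refine (hZ.sub (HasRightDerivOn.const (∑ k, s.budget k))).congr_deriv fun t ht => ?_
      have hne := (hpt t ⟨ht.1, ht.2.le⟩).ne'
      have h1 : ∑ k, d t k = ∑ k, s.budget k - ∑ k, min (s.budget k) (M t) := by
        simp only [d, Finset.sum_sub_distrib]
      simp only [Z]
      rw [← Finset.sum_div, h1]
      field_simp
      ring
    have hZ0 : Z 0 - ∑ k, s.budget k = 0 := by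
      simp only [Z, hst0, hd00, hM0, level]
      simp [hpdef]
    have hle : ∀ x t, t ∈ Ico 0 δ → 0 < x → x / (p + t) ≤ 1 / p * x := fun x t ht hx => by
      rw [one_div_mul_eq_div]
      exact div_le_div_of_nonneg_left hx.le hp (by linarith [ht.1])
    intro t ht
    have h1 := hZ'.nonpos hZ0.le (1 / p) (fun t ht hx => hle _ t ht hx) t ht
    have h2 := hZ'.neg.nonpos (by rw [hZ0, neg_zero]) (1 / p) (fun t ht hx => by
      rw [← neg_div]; exact hle _ t ht hx) t ht
    have h3 : ∑ k, d t k = ∑ k, s.budget k - ∑ k, min (s.budget k) (M t) := by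
      simp only [d, Finset.sum_sub_distrib]
    simp only [Z] at h1 h2
    linarith
  have hsup : ∀ t ∈ Icc 0 δ, (st t).supply = σ t := fun t ht => by
    rw [eq_div_iff (hpt t ht).ne', ← hsupply t ht, mul_comm]
  have hlev : ∀ t ∈ Icc 0 δ, (st t).level = M t := fun t ht => by
    rw [level]
    change ∑ k, min (s.budget k) (M t) - (p + t) * (st t).supply = _
    rw [hsupply t ht]; ring
  have hbnn : ∀ t ∈ Icc 0 δ, ∀ k, 0 ≤ (st t).budget k := fun t ht k =>
    le_min (h.budget_nonneg k) (hMpos t ht).1.le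
  have hsnn : ∀ t ∈ Icc 0 δ, 0 ≤ (st t).supply := fun t ht => (hsup t ht).symm ▸ hσ0 t ht
  have hbpos : ∀ t, ∀ k, 0 < (st t).budget k → v j ≤ v k := fun t k hk =>
    hpos k (lt_of_lt_of_le hk (min_le_left _ _))
  have hdrop : ∀ t ∈ Icc 0 δ, ∀ k, v k < p + t → (st t).budget k = 0 := fun t ht k hk => by
    by_contra hne
    have := hbpos t k ((hbnn t ht k).lt_of_ne' hne)
    linarith [ht.2]
  have hexi : ∀ t ∈ Ico 0 δ, ¬ (exiting v (st t)).Nonempty := by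
    rintro t ht ⟨k, hk⟩
    have h1 : v k = p + t := (mem_exiting.1 hk).1
    have := hbpos t k (mem_exiting.1 hk).2
    linarith [ht.2]
  have hpaid : ∀ t ∈ Ico 0 δ, ∀ k, paidRate v (st t) k = if M t ≤ s.budget k then σ t else 0 := by
    intro t ht k
    have ht' : t ∈ Icc 0 δ := ⟨ht.1, ht.2.le⟩
    have hC : k ∈ clinching v (st t) ↔ M t ≤ s.budget k := by
      rw [mem_clinching_iff_level (s := st t) (hpt t ht') (hbnn t ht') (hsnn t ht'), hlev t ht',
        mem_active]
      change (p + t < v k ∧ 0 < min (s.budget k) (M t)) ∧ min (s.budget k) (M t) = M t ↔ _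
      rw [min_eq_right_iff]
      refine ⟨fun h => h.2, fun hk => ?_⟩
      have hb := (hMpos t ht').1.trans_le hk
      exact ⟨⟨by linarith [hpos k hb, ht.2], lt_min hb (hMpos t ht').1⟩, hk⟩
    simp only [paidRate, hC, hexi t ht, if_false, hsup t ht']
  have hr : δ ∈ Icc 0 δ := ⟨hδ.le, le_rfl⟩
  refine ⟨st, hst0, ⟨?_, fun k => ?_, fun k => ?_, fun k => ?_, fun t ht => ?_⟩,
    ⟨(hpt _ hr).le, fun h0 => absurd h0 (hpt _ hr).ne', hbnn _ hr, hsnn _ hr, hdrop _ hr, ?_,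
    fun k _ => ?_⟩, ?_, fun k => min_le_left _ _⟩
  · exact hprice.congr_deriv fun t ht => (priceRate_of_empty (hexi t ht)).symm
  · refine (((HasRightDerivOn.const (s.budget k)).sub (hd k)).congr fun t _ => ?_).congr_deriv
      fun t ht => ?_
    · simp [st, d]
    · rw [budgetRate_of_notMem fun hk => hexi t ht ⟨k, hk⟩, hpaid t ht, zero_sub]
  · exact (halloc k).congr_deriv fun t ht => by rw [allocRate, hpaid t ht]
  · exact ((HasRightDerivOn.const (s.paid k)).add (hd k)).congr_deriv fun t ht => by
      rw [hpaid t ht, zero_add]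
  · have ht' : t ∈ Icc 0 δ := ⟨ht.1, ht.2.le⟩
    rw [stops_iff_level (s := st t) (hpt t ht') (hbnn t ht') (hsnn t ht'), hlev t ht', not_le,
      sum_budget_le_price_eq (hdrop t ht') (hbnn t ht'),
      Finset.not_nonempty_iff_eq_empty.1 (hexi t ht), Finset.sum_empty]
    exact (hMpos t ht').1
  · rw [hlev _ hr]; exact (hMpos _ hr).1.le
  · rw [hlev _ hr]; exact min_le_right _ _
  · change p + δ = v j
    rw [hδdef]; ring

/-- At the beginning the price rises from zero without anybody clinching. -/
theorem IsRegular.isProcess_of_price_zero (h : IsRegular v s) (hp : s.price = 0) {δ : ℝ} (hδ : ∀ k, 0 < s.budget k → δ ≤ v k)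
    (hC : ∀ k, 0 < s.budget k → ∀ t ∈ Ioo 0 δ, s.budget k ≠ ∑ k, s.budget k - t)
    (hsum : δ ≤ ∑ k, s.budget k) :
    IsProcess v (fun t => { s with price := t }) δ := by
  set st : ℝ → AuctionState ι := fun t => { s with price := t } with hst
  obtain ⟨hS, a, ha⟩ := h.of_price_zero hp
  have hsup : ∀ t, (st t).supply = 1 := fun t => hS
  have hlev : ∀ t, (st t).level = ∑ k, s.budget k - t := fun t => by
    rw [level, hsup, mul_one]
  have hexi : ∀ t ∈ Ico 0 δ, ¬ (exiting v (st t)).Nonempty := by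
    rintro t ht ⟨k, hk⟩
    have h1 : v k = t := (mem_exiting.1 hk).1
    linarith [hδ k (mem_exiting.1 hk).2, ht.2]
  have hpaid : ∀ t ∈ Ico 0 δ, ∀ k, paidRate v (st t) k = 0 := fun t ht k => by
    refine paidRate_of_notMem ?_
    rcases ht.1.eq_or_lt with rfl | ht0
    · exact notMem_clinching_of_price_zero rfl (hsup 0)
    · rw [mem_clinching_iff_level (s := st t) ht0 h.budget_nonneg (by rw [hsup]; exact zero_le_one),
        hlev]
      exact fun hk => hC k (mem_active.1 hk.1).2 t ⟨ht0, ht.2⟩ hk.2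
  refine ⟨?_, fun k => ?_, fun k => ?_, fun k => ?_, fun t ht => ?_⟩
  · exact (HasRightDerivOn.of_hasDerivAt fun t _ => hasDerivAt_id t :
      HasRightDerivOn (fun t => t) (fun _ => 1) 0 δ).congr_deriv fun t ht =>
        (priceRate_of_empty (hexi t ht)).symm
  · refine (HasRightDerivOn.const (s.budget k)).congr_deriv fun t ht => ?_
    rw [budgetRate_of_notMem fun hk => hexi t ht ⟨k, hk⟩, hpaid t ht, neg_zero]
  · refine (HasRightDerivOn.const (s.alloc k)).congr_deriv fun t ht => ?_
    rw [allocRate, hpaid t ht, zero_div]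
  · exact (HasRightDerivOn.const (s.paid k)).congr_deriv fun t ht => (hpaid t ht k).symm
  · rcases ht.1.eq_or_lt with rfl | ht0
    · have : st 0 = s := by simp [hst, ← hp]
      rw [this]
      exact not_stops_of_price_zero hp ha
    · have hdrop : ∀ k, v k < (st t).price → (st t).budget k = 0 := fun k hk => by
        by_contra hne
        have := hδ k ((h.budget_nonneg k).lt_of_ne' hne)
        change v k < t at hk
        linarith [ht.2]
      rw [stops_iff_level (s := st t) ht0 h.budget_nonneg (by rw [hsup]; exact zero_le_one), hlev,
        sum_budget_le_price_eq hdrop h.budget_nonneg,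
        Finset.not_nonempty_iff_eq_empty.1 (hexi t ht), Finset.sum_empty]
      linarith [ht.2]

theorem IsRegular.completable_of_price_zero (h : IsRegular v s) (hp : s.price = 0)
    (hE : exiting v s = ∅)
    (ih : ∀ s' : AuctionState ι, IsRegular v s' → 0 < s'.price → Completable v s') : Completable v s := by
  obtain ⟨hS, hA⟩ := h.of_price_zero hp
  have hbv : ∀ k, 0 < s.budget k → 0 < v k := fun k hk => by
    by_contra! hv
    rcases hv.lt_or_eq with hlt | heq
    · exact hk.ne' (h.budget_eq_zero k (by rwa [hp]))
    · have : k ∈ exiting v s := mem_exiting.2 ⟨by rw [heq, hp], hk⟩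
      rw [hE] at this
      simp at this
  have hst0 : ({ s with price := 0 } : AuctionState ι) = s := by rw [← hp]
  have hlev : ∀ t, ({ s with price := t } : AuctionState ι).level = ∑ k, s.budget k - t :=
    fun t => by
      have : ({ s with price := t } : AuctionState ι).supply = 1 := hS
      rw [level, this, mul_one]
  have hdrop : ∀ δ, (∀ k, 0 < s.budget k → δ ≤ v k) → ∀ k, v k < δ → s.budget k = 0 :=
    fun δ hδ k hk => by
      by_contra hne
      linarith [hδ k ((h.budget_nonneg k).lt_of_ne' hne)]
  have hne : (Finset.univ.filter fun k => 0 < s.budget k).Nonempty := by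
    obtain ⟨a, ha⟩ := hA
    exact ⟨a, by simpa using (mem_active.1 ha).2⟩
  obtain ⟨a, ha, hav⟩ := Finset.exists_min_image _ v hne
  have ha0 : 0 < s.budget a := by simpa using ha
  have hav' : ∀ k, 0 < s.budget k → v a ≤ v k := fun k hk => hav k (by simpa using hk)
  -- With two or more positive budgets the price rises, nobody clinching, until it meets a valuation
  -- or the level meets the largest budget; the state is then regular. With a single positive budget
  -- regularity would be lost at once, but nobody ever clinches and the auction stops at the smaller
  -- of her valuation and budget.
  by_cases hmany : ∀ k, s.budget k < ∑ l, s.budget l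
  · obtain ⟨c, -, hc⟩ := Finset.exists_max_image Finset.univ s.budget ⟨a, Finset.mem_univ a⟩
    set δ := min (v a) (∑ l, s.budget l - s.budget c) with hδ
    have hδ0 : 0 < δ := lt_min (hbv a ha0) (sub_pos.2 (hmany c))
    have hδc : δ ≤ ∑ l, s.budget l - s.budget c := min_le_right _ _
    have hδv : ∀ k, 0 < s.budget k → δ ≤ v k := fun k hk => (min_le_left _ _).trans (hav' k hk)
    have hcc : ∀ k, s.budget k ≤ s.budget c := fun k => hc k (Finset.mem_univ k)
    have hP := h.isProcess_of_price_zero hp hδv (fun k _ t ht heq => by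
      linarith [hcc k, ht.2]) (by linarith [h.budget_nonneg c])
    rw [← hst0]
    refine hP.completable hδ0.le (ih _ ⟨hδ0.le, fun h0 => absurd h0 hδ0.ne', h.budget_nonneg,
      h.supply_nonneg, hdrop δ hδv, ?_, fun k _ => ?_⟩ hδ0)
    · rw [hlev]; linarith [h.budget_nonneg c]
    · rw [hlev]
      have := hcc k
      change s.budget k ≤ _
      linarith
  · push Not at hmany
    obtain ⟨c, hc⟩ := hmany
    have hother : ∀ k, k ≠ c → s.budget k = 0 := fun k hk => by
      have := Finset.add_le_sum (f := s.budget) (s := Finset.univ)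
        (fun k _ => h.budget_nonneg k) (Finset.mem_univ k) (Finset.mem_univ c) hk
      linarith [h.budget_nonneg k]
    have hsum : ∑ l, s.budget l = s.budget c :=
      Finset.sum_eq_single c (fun k _ hk => hother k hk) (by simp)
    have hac : a = c := by
      by_contra hne
      exact ha0.ne' (hother a hne)
    subst hac
    set δ := min (v a) (s.budget a) with hδ
    have hδ0 : 0 < δ := lt_min (hbv a ha0) ha0
    have hδb : δ ≤ s.budget a := min_le_right _ _
    have hδv : ∀ k, 0 < s.budget k → δ ≤ v k := fun k hk => (min_le_left _ _).trans (hav' k hk)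
    have hP := h.isProcess_of_price_zero hp hδv (fun k hk t ht heq => by
      have hka : k = a := by
        by_contra hne
        exact hk.ne' (hother k hne)
      rw [hsum, hka] at heq
      linarith [ht.1]) (by rw [hsum]; exact hδb)
    rw [← hst0]
    refine hP.completable hδ0.le ?_
    have hl0 : 0 ≤ ({ s with price := δ } : AuctionState ι).level := by rw [hlev, hsum]; linarith
    have hfinal : Stops v { s with price := δ } := by
      rw [stops_iff_level (s := { s with price := δ }) hδ0 h.budget_nonneg h.supply_nonneg, hlev,
        hsum]
      change _ ≤ ∑ k with v k ≤ δ, s.budget k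
      rcases min_choice (v a) (s.budget a) with hv | hb
      · have := Finset.single_le_sum (f := s.budget) (fun k _ => h.budget_nonneg k)
          (show a ∈ Finset.univ.filter fun k => v k ≤ δ by simp [hδ, hv])
        linarith
      · have : 0 ≤ ∑ k with v k ≤ δ, s.budget k := Finset.sum_nonneg fun k _ => h.budget_nonneg k
        rw [← hδ] at hb
        linarith
    obtain ⟨lump, hl⟩ := exists_isFinalSale (s := { s with price := δ }) hδ0 h.budget_nonneg
      h.supply_nonneg (hdrop δ hδv) hl0 hfinal
    exact Completable.of_stops hfinal hl

/-- Active bidders count twice because a price rise may turn them into exiting ones; it turns at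
least one active bidder inactive, and draining removes one exiting bidder. -/
theorem IsRegular.completable_of_price_pos (n : ℕ) : ∀ s : AuctionState ι, IsRegular v s →
    0 < s.price → 2 * (active v s).card + (exiting v s).card ≤ n → Completable v s := by
  induction n with
  | zero =>
    intro s h hp hn
    have hA : active v s = ∅ := Finset.card_eq_zero.1 (by omega)
    refine h.completable_of_stops ?_
    rw [Stops, hA, Finset.sum_empty]
    exact zero_le
  | succ n ih =>
    intro s h hp hn
    by_cases hs : Stops v s
    · exact h.completable_of_stops hs
    rcases (exiting v s).eq_empty_or_nonempty with hE | hE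
    · have hA : (active v s).Nonempty := by
        by_contra hA
        rw [Finset.not_nonempty_iff_eq_empty] at hA
        exact hs (by rw [Stops, hA, Finset.sum_empty]; exact zero_le)
      obtain ⟨j, hj, hmin⟩ := Finset.exists_min_image _ v hA
      obtain ⟨st, h0, hP, hreg, hprice, hbud⟩ :=
        h.exists_process_of_exiting_empty hs hE hp hj hmin
      have hjp := (mem_active.1 hj).1
      rw [← h0]
      refine hP.completable (by linarith) (ih _ hreg (by rw [hprice]; linarith) ?_)
      set s' := st (v j - s.price)
      have hsub : active v s' ∪ exiting v s' ⊆ active v s := fun k hk => by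
        rw [Finset.mem_union, mem_active, mem_exiting, hprice] at hk
        rw [mem_active]
        rcases hk with hk | hk
        · exact ⟨hjp.trans hk.1, hk.2.trans_le (hbud k)⟩
        · exact ⟨hk.1 ▸ hjp, hk.2.trans_le (hbud k)⟩
      have hdis : Disjoint (active v s') (exiting v s') :=
        Finset.disjoint_left.2 fun k hk hk' => notMem_active_of_mem_exiting hk' hk
      have h1 := Finset.card_le_card hsub
      rw [Finset.card_union_of_disjoint hdis] at h1
      have h2 : (active v s').card < (active v s).card := by
        refine Finset.card_lt_card ⟨Finset.subset_union_left.trans hsub, fun hcon => ?_⟩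
        have := (mem_active.1 (hcon hj)).1
        rw [hprice] at this
        exact lt_irrefl _ this
      omega
    · have he := Finset.isLeast_min' _ hE
      obtain ⟨st, h0, hP, hreg, hprice, hact, hexi⟩ := h.exists_process_of_isLeast_exiting hs he
      rw [← h0]
      refine hP.completable (h.budget_nonneg _) (ih _ hreg (by rwa [hprice]) ?_)
      rw [hact, hexi, Finset.card_erase_of_mem (by simpa using he.1)]
      have := Finset.card_pos.2 hE
      omega

/-- At price zero the bidders with valuation zero are drained one by one before the price can rise.
-/
theorem IsRegular.completable_of_card_exiting (n : ℕ) : ∀ s : AuctionState ι, IsRegular v s →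
    s.price = 0 → (exiting v s).card ≤ n → Completable v s := by
  have hpos : ∀ s' : AuctionState ι, IsRegular v s' → 0 < s'.price → Completable v s' :=
    fun s' h' hp' => completable_of_price_pos _ s' h' hp' le_rfl
  induction n with
  | zero =>
    intro s h hp hn
    exact h.completable_of_price_zero hp (Finset.card_eq_zero.1 (by omega)) hpos
  | succ n ih =>
    intro s h hp hn
    have hs : ¬ Stops v s := by
      obtain ⟨k, hk⟩ := (h.of_price_zero hp).2
      exact not_stops_of_price_zero hp hk
    rcases (exiting v s).eq_empty_or_nonempty with hE | hE
    · exact h.completable_of_price_zero hp hE hpos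
    · have he := Finset.isLeast_min' _ hE
      obtain ⟨st, h0, hP, hreg, hprice, hact, hexi⟩ := h.exists_process_of_isLeast_exiting hs he
      rw [← h0]
      refine hP.completable (h.budget_nonneg _) (ih _ hreg (by rw [hprice, hp]) ?_)
      rw [hexi, Finset.card_erase_of_mem (by simpa using he.1)]
      omega

end AuctionState

open AuctionState in
/-- The auction is well defined if some bidder reports a positive valuation and a positive
budget. -/
theorem nonempty_clinchingRun {ι : Type*} [Fintype ι] [LinearOrder ι] {v B : ι → ℝ}
    (hv : ∀ k, 0 ≤ v k) (hB : ∀ k, 0 ≤ B k) (hex : ∃ k, 0 < v k ∧ 0 < B k) :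
    Nonempty (ClinchingRun v B) := by
  refine Completable.nonempty_clinchingRun
    (IsRegular.completable_of_card_exiting _ _ ⟨le_rfl, fun _ => ⟨?_, ?_⟩, hB, ?_, ?_, ?_, ?_⟩ rfl
      le_rfl)
  · simp [supply]
  · obtain ⟨k, hk⟩ := hex
    exact ⟨k, mem_active.2 hk⟩
  · simp [supply]
  · exact fun k hk => absurd (hv k) (not_le.2 hk)
  · simp only [level, zero_mul, sub_zero]
    exact Finset.sum_nonneg fun k _ => hB k
  · intro k _
    simp only [level, zero_mul, sub_zero]
    exact Finset.single_le_sum (fun k _ => hB k) (Finset.mem_univ k)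

theorem theorem3 {ι : Type*} [Fintype ι] [LinearOrder ι]
    (i : ι) (η β : ℝ) (hη : 0 ≤ η) (hβ : 0 ≤ β)
    (v B : ι → ℝ) (hv : ∀ j, j ≠ i → 0 ≤ v j) (hB : ∀ j, j ≠ i → 0 ≤ B j)
    (hcomp : ∃ j, j ≠ i ∧ 0 < v j ∧ 0 < B j) :
    (∀ w b : ℝ, 0 ≤ w → 0 ≤ b →
      Nonempty (ClinchingRun (Function.update v i w) (Function.update B i b))) ∧
    (∀ b ∈ Set.Icc 0 β, ∀ w : ℝ, 0 ≤ w →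
      ∀ (r : ClinchingRun (Function.update v i η) (Function.update B i b))
        (r' : ClinchingRun (Function.update v i w) (Function.update B i b)),
        r'.utility i η β ≤ r.utility i η β) ∧
    (∀ b₀ ∈ Set.Icc 0 β, ∀ b₁ ∈ Set.Icc 0 β, b₀ ≤ b₁ →
      ∀ (r₀ : ClinchingRun (Function.update v i η) (Function.update B i b₀))
        (r₁ : ClinchingRun (Function.update v i η) (Function.update B i b₁)),
        r₀.utility i η β ≤ r₁.utility i η β) := by
  refine ⟨fun w b hw hb => ?_, fun b hb w hw r r' => ?_, fun b₀ hb₀ b₁ hb₁ hb r₀ r₁ => ?_⟩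
  · obtain ⟨k, -, hk⟩ := exists_competitor_update hcomp w b
    exact nonempty_clinchingRun (update_nonneg hv hw) (update_nonneg hB hb) ⟨k, hk⟩
  · exact utility_truthful hη hv hB hcomp hb hw r r'
  · exact utility_budget_monotone hη hv hB hcomp hb₀ hb₁ hb r₀ r₁
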